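/- Let $\mathbf H^2$ be the hyperbolic plane and let $P\subset\mathbf H^2$ be a convex geodesic polygon with $p\ge 3$ vertices $a_1,\dots,a_p$, listed counterclockwise (indices mod $p$). Let $R_i$ be the geodesic ray that extends the side $a_ia_{i+1}$ beyond $a_i$. The rays $R_1,\dots,R_p$ cut $X=\mathbf H^2\setminus P$ into $p$ open regions $X_1,\dots,X_p$, where $X_i$ consists of the points $x\in X$ such that the geodesic from $x$ to $a_i$ meets $P$ only at $a_i$ when prolonged, and has $P$ on its left. The outer billiard map $T$ about $P$ acts on $X_i$ as the geodesic symmetry about $a_i$. A point $x\in X$ is regular if $x,Tx,T^2x,\dots$ all lie in $X_1\cup\dots\cup X_p$; its code is the sequence $s_0s_1s_2\dots$ with $T^kx\in X_{s_k}$. The complexity $f(n)$ of the outer billiard is the number of words of length $n$ that occur in the codes of regular points. The map $T$ extends to a homeomorphism $\tau$ of the circle at infinity $S$: $\tau(x)$ is the second endpoint of the geodesic that starts at $x\in S$ and supports $P$, with $P$ on its left. Let $\rho(P)$ be its rotation number, i.e. the translation number of the lift $F:\mathbf R\to\mathbf R$ of $\tau$ with $t<F(t)<t+1$ (where $S$ is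 identified with $\mathbf R/\mathbf Z$). The $p$-gon $P$ is called large if $\rho(P)=1/p$ and $\tau$ has a hyperbolic $p$-periodic orbit, i.e. a point $x\in S$ of exact period $p$ at which $\tau^p$ is differentiable with derivative of modulus different from $1$. Theorem. For every convex polygon $P\subset\mathbf H^2$ there is a constant $C$ (depending on $P$) such that $n\le C f(n)$ for all sufficiently large $n$. If $P$ is large, then moreover $f(n)\sim n$, that is, there are constants $C,C'$ such that $n\le Cf(n)$ and $f(n)\le C'n$ for all sufficiently large $n$. -/

import Mathlib

open Filter Asymptotics

noncomputable section

/-! The hyperbolic plane is represented by the Klein-Beltrami (projective) model: the open unit disc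
`Metric.ball (0 : ℂ) 1`, whose geodesics are the Euclidean chords; `ℂ` serves as the real plane.
The circle at infinity is the unit circle. -/

namespace KleinDisc

/-- The Euclidean scalar product of the plane. -/
def dot (u w : ℂ) : ℝ := u.re * w.re + u.im * w.im

/-- The Euclidean cross product (determinant) of two vectors of the plane. It is positive iff `w`
points to the left of `u`. -/
def cross (u w : ℂ) : ℝ := u.re * w.im - u.im * w.re

/-- The hyperbolic cosine of the distance of two points of the Klein disc. -/
def coshDist (x y : ℂ) : ℝ := (1 - dot x y) / √((1 - dot x x) * (1 - dot y y))

/-- The standard identification of the upper half-plane with the Klein disc. -/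
def ofUpperHalfPlane (z : UpperHalfPlane) : ℂ :=
  ⟨2 * z.re / (z.re ^ 2 + z.im ^ 2 + 1), (z.re ^ 2 + z.im ^ 2 - 1) / (z.re ^ 2 + z.im ^ 2 + 1)⟩

/-- The metric of the Klein disc agrees with the hyperbolic metric of the upper half-plane. -/
theorem coshDist_ofUpperHalfPlane (z w : UpperHalfPlane) :
    coshDist (ofUpperHalfPlane z) (ofUpperHalfPlane w) = Real.cosh (dist z w) := by
  have hz := z.im_pos
  have hw := w.im_pos
  have key : ∀ u v : UpperHalfPlane, 1 - dot (ofUpperHalfPlane u) (ofUpperHalfPlane v) =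
      2 * ((u.re - v.re) ^ 2 + u.im ^ 2 + v.im ^ 2) /
        ((u.re ^ 2 + u.im ^ 2 + 1) * (v.re ^ 2 + v.im ^ 2 + 1)) := by
    intro u v
    have h1 : u.re ^ 2 + u.im ^ 2 + 1 ≠ 0 := by positivity
    have h2 : v.re ^ 2 + v.im ^ 2 + 1 ≠ 0 := by positivity
    simp only [dot, ofUpperHalfPlane]
    field_simp
    ring
  rw [UpperHalfPlane.cosh_dist', coshDist, key, key, key]
  have h1 : 0 < z.re ^ 2 + z.im ^ 2 + 1 := by positivity
  have h2 : 0 < w.re ^ 2 + w.im ^ 2 + 1 := by positivity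
  have e : 2 * ((z.re - z.re) ^ 2 + z.im ^ 2 + z.im ^ 2) /
        ((z.re ^ 2 + z.im ^ 2 + 1) * (z.re ^ 2 + z.im ^ 2 + 1)) *
      (2 * ((w.re - w.re) ^ 2 + w.im ^ 2 + w.im ^ 2) /
        ((w.re ^ 2 + w.im ^ 2 + 1) * (w.re ^ 2 + w.im ^ 2 + 1))) =
      (4 * z.im * w.im / ((z.re ^ 2 + z.im ^ 2 + 1) * (w.re ^ 2 + w.im ^ 2 + 1))) ^ 2 := by
    field_simp
    ring
  rw [e, Real.sqrt_sq (by positivity)]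
  field_simp
  ring

/-- The geodesic symmetry about a point `a` of the open disc: the hyperbolic isometry that sends
`x` to the point `y` such that `a` is the midpoint of the geodesic segment from `x` to `y`.
The formula makes sense on the closed disc; a point `x` at infinity goes to the second endpoint of
the chord through `x` and `a`. -/
def pointSymm (a x : ℂ) : ℂ :=
  (1 - 2 * dot x a + dot a a)⁻¹ • ((2 * (1 - dot x a)) • a - (1 - dot a a) • x)

theorem pointSymm_re (a x : ℂ) : (pointSymm a x).re =
    (1 - 2 * dot x a + dot a a)⁻¹ * (2 * (1 - dot x a) * a.re - (1 - dot a a) * x.re) := by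
  rw [pointSymm, Complex.smul_re, Complex.sub_re, Complex.smul_re, Complex.smul_re]
  simp only [smul_eq_mul]

theorem pointSymm_im (a x : ℂ) : (pointSymm a x).im =
    (1 - 2 * dot x a + dot a a)⁻¹ * (2 * (1 - dot x a) * a.im - (1 - dot a a) * x.im) := by
  rw [pointSymm, Complex.smul_im, Complex.sub_im, Complex.smul_im, Complex.smul_im]
  simp only [smul_eq_mul]

theorem dot_self_eq (a : ℂ) : dot a a = ‖a‖ ^ 2 := by
  rw [Complex.sq_norm, Complex.normSq_apply, dot]

theorem dot_self_lt_one {a : ℂ} (ha : a ∈ Metric.ball (0 : ℂ) 1) : dot a a < 1 := by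
  rw [mem_ball_zero_iff] at ha
  rw [dot_self_eq]
  nlinarith [norm_nonneg a]

theorem dot_self_nonneg (a : ℂ) : 0 ≤ dot a a := by
  rw [dot_self_eq]; positivity

theorem one_sub_dot_pos {a x : ℂ} (ha : dot a a < 1) (hx : dot x x ≤ 1) : 0 < 1 - dot x a := by
  unfold dot at *
  nlinarith [sq_nonneg (a.re - x.re), sq_nonneg (a.im - x.im)]

theorem denom_pos {a x : ℂ} (ha : dot a a < 1) (hx : dot x x ≤ 1) :
    0 < 1 - 2 * dot x a + dot a a := by
  by_contra h
  have h1 : (x.re - a.re) ^ 2 + (x.im - a.im) ^ 2 ≤ 0 := by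
    unfold dot at *
    nlinarith
  have h2 : x.re = a.re := by nlinarith [sq_nonneg (x.re - a.re), sq_nonneg (x.im - a.im)]
  have h3 : x.im = a.im := by nlinarith [sq_nonneg (x.re - a.re), sq_nonneg (x.im - a.im)]
  unfold dot at *
  rw [h2, h3] at h
  nlinarith

theorem one_sub_dot_pointSymm {a x y : ℂ} (ha : dot a a < 1) (hx : dot x x ≤ 1)
    (hy : dot y y ≤ 1) : 1 - dot (pointSymm a x) (pointSymm a y) =
      (1 - dot a a) ^ 2 * (1 - dot x y) /
        ((1 - 2 * dot x a + dot a a) * (1 - 2 * dot y a + dot a a)) := by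
  have h1 := (denom_pos ha hx).ne'
  have h2 := (denom_pos ha hy).ne'
  rw [dot, pointSymm_re, pointSymm_im, pointSymm_re, pointSymm_im]
  field_simp
  unfold dot
  ring

/-- The geodesic symmetry is an isometry of the hyperbolic plane. -/
theorem coshDist_pointSymm {a x y : ℂ} (ha : dot a a < 1) (hx : dot x x < 1) (hy : dot y y < 1) :
    coshDist (pointSymm a x) (pointSymm a y) = coshDist x y := by
  have h1 := denom_pos ha hx.le
  have h2 := denom_pos ha hy.le
  have h3 : 0 < 1 - dot a a := by linarith
  have h4 : 0 < (1 - dot x x) * (1 - dot y y) := mul_pos (by linarith) (by linarith)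
  have h5 := Real.sqrt_pos.2 h4
  unfold coshDist
  rw [one_sub_dot_pointSymm ha hx.le hy.le, one_sub_dot_pointSymm ha hx.le hx.le,
    one_sub_dot_pointSymm ha hy.le hy.le]
  set D := 1 - 2 * dot x a + dot a a
  set E := 1 - 2 * dot y a + dot a a
  set A := 1 - dot a a
  have h6 : A ^ 2 * (1 - dot x x) / (D * D) * (A ^ 2 * (1 - dot y y) / (E * E)) =
      (A ^ 2 / (D * E)) ^ 2 * ((1 - dot x x) * (1 - dot y y)) := by
    field_simp
  rw [h6, Real.sqrt_mul (sq_nonneg _), Real.sqrt_sq (by positivity)]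
  field_simp

theorem pointSymm_sub {a x : ℂ} (ha : dot a a < 1) (hx : dot x x ≤ 1) :
    pointSymm a x - x =
      (2 * (1 - dot x a) * (1 - 2 * dot x a + dot a a)⁻¹) • (a - x) := by
  have h1 := (denom_pos ha hx).ne'
  apply Complex.ext
  · rw [Complex.sub_re, pointSymm_re]
    simp only [Complex.real_smul, Complex.mul_re, Complex.ofReal_re, Complex.ofReal_im,
      Complex.sub_re, zero_mul, sub_zero]
    field_simp
    ring
  · rw [Complex.sub_im, pointSymm_im]
    simp only [Complex.real_smul, Complex.mul_im, Complex.ofReal_re, Complex.ofReal_im,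
      Complex.sub_im, zero_mul, add_zero]
    field_simp
    ring

/-- The centre of the symmetry lies on the geodesic segment between a point and its image. -/
theorem mem_segment_pointSymm {a x : ℂ} (ha : dot a a < 1) (hx : dot x x ≤ 1) :
    a ∈ segment ℝ x (pointSymm a x) := by
  have h1 := denom_pos ha hx
  have h2 := one_sub_dot_pos ha hx
  have h3 : 0 < 1 - dot a a := by linarith
  refine ⟨(1 - dot a a) / (2 * (1 - dot x a)),
    (1 - 2 * dot x a + dot a a) / (2 * (1 - dot x a)), by positivity, by positivity, ?_, ?_⟩
  · field_simp
    ring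
  · rw [pointSymm, smul_smul, smul_sub, smul_smul, smul_smul]
    have e1 : (1 - 2 * dot x a + dot a a) / (2 * (1 - dot x a)) *
        (1 - 2 * dot x a + dot a a)⁻¹ * (2 * (1 - dot x a)) = 1 := by field_simp
    have e2 : (1 - 2 * dot x a + dot a a) / (2 * (1 - dot x a)) *
        (1 - 2 * dot x a + dot a a)⁻¹ * (1 - dot a a) =
          (1 - dot a a) / (2 * (1 - dot x a)) := by field_simp
    rw [e1, e2, one_smul]
    abel

theorem dot_coe_circle (x : Circle) : dot (x : ℂ) x = 1 := by
  rw [dot_self_eq, Circle.norm_coe, one_pow]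

theorem pointSymm_circle_mem {a : ℂ} (ha : dot a a < 1) (x : Circle) :
    pointSymm a x ∈ Submonoid.unitSphere ℂ := by
  have h := one_sub_dot_pointSymm ha (dot_coe_circle x).le (dot_coe_circle x).le
  rw [dot_coe_circle, sub_self, mul_zero, zero_div, dot_self_eq] at h
  have h2 : ‖pointSymm a x‖ = 1 := by
    nlinarith [norm_nonneg (pointSymm a x)]
  exact mem_sphere_zero_iff_norm.2 h2

theorem pointSymm_circle_ne {a : ℂ} (ha : dot a a < 1) (x : Circle) : pointSymm a x ≠ x := by
  intro h
  have h1 := pointSymm_sub ha (dot_coe_circle x).le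
  rw [h, sub_self, eq_comm, smul_eq_zero] at h1
  have h2 := one_sub_dot_pos ha (dot_coe_circle x).le
  have h3 := denom_pos ha (dot_coe_circle x).le
  rcases h1 with h1 | h1
  · have : 0 < 2 * (1 - dot x a) * (1 - 2 * dot x a + dot a a)⁻¹ := by positivity
    exact this.ne' h1
  · rw [sub_eq_zero] at h1
    rw [h1, dot_coe_circle] at ha
    exact lt_irrefl _ ha

/-- The point of the circle at infinity at the angle of `t` full turns. -/
def circlePt (t : ℝ) : Circle := Circle.exp (2 * Real.pi * t)

theorem circlePt_add_one (t : ℝ) : circlePt (t + 1) = circlePt t := by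
  unfold circlePt
  rw [mul_add, mul_one]
  exact Circle.periodic_exp _

theorem circlePt_re (t : ℝ) : (circlePt t : ℂ).re = Real.cos (2 * Real.pi * t) := by
  rw [circlePt, Circle.coe_exp, Complex.exp_ofReal_mul_I_re]

theorem circlePt_im (t : ℝ) : (circlePt t : ℂ).im = Real.sin (2 * Real.pi * t) := by
  rw [circlePt, Circle.coe_exp, Complex.exp_ofReal_mul_I_im]

theorem circlePt_eq_iff {s t : ℝ} : circlePt s = circlePt t ↔ ∃ m : ℤ, s = t + m := by
  unfold circlePt
  rw [Circle.exp_eq_exp]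
  have hpi := Real.pi_pos
  constructor
  · rintro ⟨m, hm⟩
    refine ⟨m, ?_⟩
    have : 2 * Real.pi * (s - (t + m)) = 0 := by linarith
    rcases mul_eq_zero.1 this with h | h
    · linarith
    · linarith
  · rintro ⟨m, hm⟩
    exact ⟨m, by rw [hm]; ring⟩

theorem exists_circlePt (z : Circle) (t : ℝ) : ∃ u, t < u ∧ u ≤ t + 1 ∧ circlePt u = z := by
  have hpi := Real.pi_pos
  let θ := Complex.arg z
  let r := θ / (2 * Real.pi)
  have hr : circlePt r = z := by
    unfold circlePt
    have : 2 * Real.pi * r = Complex.arg z := by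
      simp only [r, θ]; field_simp
    rw [this]
    exact Circle.exp_arg z
  refine ⟨r + (⌊t - r⌋ + 1 : ℤ), ?_, ?_, ?_⟩
  · have := Int.lt_floor_add_one (t - r)
    push_cast
    linarith
  · have := Int.floor_le (t - r)
    push_cast
    linarith
  · rw [← hr]
    exact circlePt_eq_iff.2 ⟨_, rfl⟩

theorem cross_circlePt (a b u : ℝ) :
    cross (circlePt b - circlePt a) (circlePt u - circlePt a) =
      4 * Real.sin (Real.pi * (b - a)) * Real.sin (Real.pi * (u - b)) *
        Real.sin (Real.pi * (u - a)) := by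
  unfold cross
  simp only [Complex.sub_re, Complex.sub_im, circlePt_re, circlePt_im]
  have hb : 2 * Real.pi * b = 2 * Real.pi * a + 2 * (Real.pi * (b - a)) := by ring
  have hu : 2 * Real.pi * u =
      2 * Real.pi * a + 2 * (Real.pi * (b - a) + Real.pi * (u - b)) := by ring
  have hua : Real.pi * (u - a) = Real.pi * (b - a) + Real.pi * (u - b) := by ring
  rw [hb, hu, hua]
  generalize Real.pi * (b - a) = Q
  generalize Real.pi * (u - b) = R
  generalize 2 * Real.pi * a = A
  have hA := Real.sin_sq_add_cos_sq A
  have hQ := Real.sin_sq_add_cos_sq Q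
  have hR := Real.sin_sq_add_cos_sq R
  have key : (Real.cos (A + 2 * Q) - Real.cos A) * (Real.sin (A + 2 * (Q + R)) - Real.sin A) -
      (Real.sin (A + 2 * Q) - Real.sin A) * (Real.cos (A + 2 * (Q + R)) - Real.cos A) =
      Real.sin (2 * R) + Real.sin (2 * Q) - Real.sin (2 * Q + 2 * R) := by
    have e1 : Real.sin (2 * R) = Real.sin ((A + 2 * (Q + R)) - (A + 2 * Q)) := by
      congr 1; ring
    have e2 : Real.sin (2 * Q) = Real.sin ((A + 2 * Q) - A) := by congr 1; ring
    have e3 : Real.sin (2 * Q + 2 * R) = Real.sin ((A + 2 * (Q + R)) - A) := by congr 1; ring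
    rw [e1, e2, e3, Real.sin_sub, Real.sin_sub, Real.sin_sub]
    ring
  rw [key, Real.sin_add, Real.sin_two_mul, Real.sin_two_mul, Real.cos_two_mul, Real.cos_two_mul,
    Real.sin_add]
  have hQ' : Real.cos Q ^ 2 = 1 - Real.sin Q ^ 2 := by linarith
  have hR' : Real.cos R ^ 2 = 1 - Real.sin R ^ 2 := by linarith
  rw [hQ', hR']
  ring

theorem cross_circlePt_neg {a u b : ℝ} (h1 : a < u) (h2 : u < b) (h3 : b < a + 1) :
    cross (circlePt b - circlePt a) (circlePt u - circlePt a) < 0 := by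
  have hpi := Real.pi_pos
  rw [cross_circlePt]
  have s1 : 0 < Real.sin (Real.pi * (b - a)) :=
    Real.sin_pos_of_pos_of_lt_pi (mul_pos hpi (by linarith)) (by nlinarith)
  have s2 : 0 < Real.sin (Real.pi * (u - a)) :=
    Real.sin_pos_of_pos_of_lt_pi (mul_pos hpi (by linarith)) (by nlinarith)
  have s3 : Real.sin (Real.pi * (u - b)) < 0 :=
    Real.sin_neg_of_neg_of_neg_pi_lt (by nlinarith) (by nlinarith)
  have := mul_pos s1 s2
  nlinarith

end KleinDisc

open KleinDisc

/-- A convex geodesic polygon with `p ≥ 3` vertices in the hyperbolic plane (Klein model). The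
vertices are listed counterclockwise: all other vertices lie strictly to the left of the line
through `vertex i` and `vertex (i + 1)` (indices are cyclic). -/
structure KleinPolygon (p : ℕ) [NeZero p] where
  vertex : Fin p → ℂ
  three_le : 3 ≤ p
  vertex_mem : ∀ i, vertex i ∈ Metric.ball (0 : ℂ) 1
  convex : ∀ i j, j ≠ i → j ≠ i + 1 →
    0 < cross (vertex (i + 1) - vertex i) (vertex j - vertex i)

namespace KleinPolygon

variable {p : ℕ} [NeZero p] (P : KleinPolygon p)

/-- The closed region bounded by the polygon. -/
def region : Set ℂ := convexHull ℝ (Set.range P.vertex)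

/-- The phase space of the outer billiard: the complement of the polygon in the hyperbolic plane. -/
def phaseSpace : Set ℂ := Metric.ball (0 : ℂ) 1 \ P.region

/-- The open face of the defining partition that belongs to the vertex `i`: the points `x` of the
phase space such that the polygon touches the geodesic from `x` to `vertex i` at this vertex only
and lies to the left of it. It is the open region between the two singular rays that extend the side
from `vertex i` to `vertex (i + 1)` beyond `vertex i` and the side from `vertex (i - 1)` to
`vertex i` beyond `vertex (i - 1)`. -/
def face (i : Fin p) : Set ℂ :=
  {x ∈ P.phaseSpace | ∀ j, j ≠ i → 0 < cross (P.vertex i - x) (P.vertex j - x)}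

/-- `x 0, x 1, x 2, …` is a regular orbit of the outer billiard with the code `s`: each point lies in
an open face, and the next point is its image under the geodesic symmetry about the vertex that
belongs to this face. -/
def IsRegularOrbit (x : ℕ → ℂ) (s : ℕ → Fin p) : Prop :=
  ∀ k, x k ∈ P.face (s k) ∧ x (k + 1) = pointSymm (P.vertex (s k)) (x k)

/-- The words of length `n` that occur in the codes of regular points. -/
def words (n : ℕ) : Set (Fin n → Fin p) :=
  {w | ∃ x s, P.IsRegularOrbit x s ∧ ∃ k : ℕ, ∀ m : Fin n, w m = s (k + m)}

/-- The complexity of the outer billiard about `P`: the number of words of length `n`. -/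
def complexity (n : ℕ) : ℕ := (P.words n).ncard

/-! ### The circle at infinity -/

/-- From every point `x` at infinity there is a supporting line, directed from `x` to a vertex, that
has the polygon on its left. -/
theorem exists_support (x : Circle) :
    ∃ i, ∀ j, 0 ≤ cross (P.vertex i - x) (P.vertex j - x) := by
  have hx := dot_coe_circle x
  have hq : ∀ j, 0 < 1 - dot x (P.vertex j) := fun j =>
    one_sub_dot_pos (dot_self_lt_one (P.vertex_mem j)) hx.le
  obtain ⟨i, hi⟩ := Finite.exists_max (fun j => cross x (P.vertex j) / (1 - dot x (P.vertex j)))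
  refine ⟨i, fun j => ?_⟩
  have h := hi j
  rw [div_le_div_iff₀ (hq j) (hq i)] at h
  have e : cross (P.vertex i - x) (P.vertex j - x) =
      cross x (P.vertex i) * (1 - dot x (P.vertex j)) -
        cross x (P.vertex j) * (1 - dot x (P.vertex i)) := by
    have hx' : (x : ℂ).re * (x : ℂ).re + (x : ℂ).im * (x : ℂ).im = 1 := hx
    simp only [cross, dot, Complex.sub_re, Complex.sub_im]
    linear_combination (-((P.vertex i).re * (P.vertex j).im - (P.vertex i).im * (P.vertex j).re)) *
      hx'
  rw [e]
  linarith

/-- A vertex on the supporting line from the point `x` at infinity. (There are two such vertices if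
the line contains a side; both define the same point `bdryMap x` below.) -/
def bdryVertex (x : Circle) : Fin p := (P.exists_support x).choose

theorem bdryVertex_spec (x : Circle) (j : Fin p) :
    0 ≤ cross (P.vertex (P.bdryVertex x) - x) (P.vertex j - x) :=
  (P.exists_support x).choose_spec j

/-- The extension `τ` of the outer billiard to the circle at infinity. -/
def bdryMap (x : Circle) : Circle :=
  ⟨pointSymm (P.vertex (P.bdryVertex x)) x,
    pointSymm_circle_mem (dot_self_lt_one (P.vertex_mem _)) x⟩

theorem coe_bdryMap (x : Circle) :
    (P.bdryMap x : ℂ) = pointSymm (P.vertex (P.bdryVertex x)) x := rfl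

theorem bdryMap_ne (x : Circle) : P.bdryMap x ≠ x := fun h =>
  pointSymm_circle_ne (dot_self_lt_one (P.vertex_mem _)) x (congrArg Subtype.val h)

theorem exists_lift (t : ℝ) : ∃ u, t < u ∧ u < t + 1 ∧ circlePt u = P.bdryMap (circlePt t) := by
  obtain ⟨u, h1, h2, h3⟩ := exists_circlePt (P.bdryMap (circlePt t)) t
  refine ⟨u, h1, lt_of_le_of_ne h2 ?_, h3⟩
  rintro rfl
  rw [circlePt_add_one] at h3
  exact P.bdryMap_ne _ h3.symm

/-- The unique `u` with `t < u < t + 1` that represents the image of the point `t`. -/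
def liftFun (t : ℝ) : ℝ := (P.exists_lift t).choose

theorem lt_liftFun (t : ℝ) : t < P.liftFun t := (P.exists_lift t).choose_spec.1

theorem liftFun_lt (t : ℝ) : P.liftFun t < t + 1 := (P.exists_lift t).choose_spec.2.1

theorem circlePt_liftFun (t : ℝ) : circlePt (P.liftFun t) = P.bdryMap (circlePt t) :=
  (P.exists_lift t).choose_spec.2.2

theorem liftFun_add_one (t : ℝ) : P.liftFun (t + 1) = P.liftFun t + 1 := by
  have h : circlePt (P.liftFun (t + 1)) = circlePt (P.liftFun t + 1) := by
    rw [circlePt_liftFun, circlePt_add_one, circlePt_add_one, circlePt_liftFun]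
  obtain ⟨m, hm⟩ := circlePt_eq_iff.1 h
  have h1 := P.lt_liftFun t
  have h2 := P.liftFun_lt t
  have h3 := P.lt_liftFun (t + 1)
  have h4 := P.liftFun_lt (t + 1)
  have h5 : (m : ℝ) < 1 := by linarith
  have h6 : (-1 : ℝ) < m := by linarith
  have h7 : m < 1 := by exact_mod_cast h5
  have h8 : -1 < m := by exact_mod_cast h6
  have h9 : m = 0 := by omega
  rw [hm, h9, Int.cast_zero, add_zero]

theorem cross_bdryMap_nonneg (x : Circle) (j : Fin p) :
    0 ≤ cross (P.bdryMap x - x) (P.vertex j - x) := by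
  have ha := dot_self_lt_one (P.vertex_mem (P.bdryVertex x))
  have hx := (dot_coe_circle x).le
  have h1 := one_sub_dot_pos ha hx
  have h2 := denom_pos ha hx
  rw [coe_bdryMap, pointSymm_sub ha hx]
  have e : ∀ (c : ℝ) (u w : ℂ), cross (c • u) w = c * cross u w := by
    intro c u w
    simp [cross]
    ring
  rw [e]
  exact mul_nonneg (by positivity) (P.bdryVertex_spec x j)

theorem monotone_liftFun : Monotone P.liftFun := by
  intro t s hts
  rcases hts.eq_or_lt with rfl | hts
  · exact le_rfl
  by_contra! h
  have h1 := P.lt_liftFun s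
  have h2 := P.liftFun_lt t
  have c1 := cross_circlePt_neg hts (h1.trans h) h2
  have c2 := cross_circlePt_neg (hts.trans h1) h h2
  rw [circlePt_liftFun] at c1
  rw [circlePt_liftFun, circlePt_liftFun] at c2
  have c3 := P.cross_bdryMap_nonneg (circlePt t) (P.bdryVertex (circlePt s))
  obtain ⟨a, b, ha, hb, hab, hv⟩ := mem_segment_pointSymm
    (dot_self_lt_one (P.vertex_mem (P.bdryVertex (circlePt s)))) (dot_coe_circle (circlePt s)).le
  rw [← coe_bdryMap] at hv
  have e : cross (P.bdryMap (circlePt t) - circlePt t)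
      (P.vertex (P.bdryVertex (circlePt s)) - circlePt t) =
      a * cross (P.bdryMap (circlePt t) - circlePt t) (circlePt s - circlePt t) +
      b * cross (P.bdryMap (circlePt t) - circlePt t)
        (P.bdryMap (circlePt s) - circlePt t) := by
    rw [← hv]
    have hb' : b = 1 - a := by linarith
    rw [hb']
    simp [cross]
    ring
  rw [e] at c3
  rcases ha.eq_or_lt with rfl | ha
  · have : b = 1 := by linarith
    rw [this] at c3
    linarith
  · have := mul_neg_of_pos_of_neg ha c1
    have := mul_nonpos_of_nonneg_of_nonpos hb c2.le
    linarith

/-- The lift `F` of `τ` to the real line with `t < F t < t + 1` (one full turn has length `1`). -/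
def lift : CircleDeg1Lift where
  toFun := P.liftFun
  monotone' := P.monotone_liftFun
  map_add_one' := P.liftFun_add_one

/-- The rotation number `ρ(P)` of the map at infinity. -/
def rotationNumber : ℝ := P.lift.translationNumber

/-- `τ` has a hyperbolic `p`-periodic orbit: a point of exact period `p` at which `τ^p` is
differentiable (with respect to the angle) with a derivative of modulus different from `1`. -/
def HasHyperbolicOrbit : Prop :=
  ∃ t μ : ℝ, Function.minimalPeriod P.bdryMap (circlePt t) = p ∧
    HasDerivAt (P.lift)^[p] μ t ∧ |μ| ≠ 1

/-- A `p`-gon is large if `ρ(P) = 1 / p` and `τ` has a hyperbolic `p`-periodic orbit. -/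
def IsLarge : Prop := P.rotationNumber = 1 / p ∧ P.HasHyperbolicOrbit

end KleinPolygon

end

open KleinDisc

/-! ### Cross products and geodesic symmetries in the Klein disc -/

noncomputable section

namespace KleinDisc

/-! Lower bound: f is strictly increasing, hence f(n) ≥ n (`complexity_lt_succ`). If f(n+1) = f(n),
every word of length n has a single continuation, so a code is determined by its first n letters.
Then generic points, those that no sequence of symmetries moves onto a line through two vertices,
have only finitely many codes. The shift maps this finite set onto itself because the billiard can
be run backwards, so all these codes have a common period M (`exists_period`).

Let x be the endpoint at infinity of the ray extending the first side beyond its first vertex.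
Boundary points slightly before x have orbits touching P at the nearer vertex of each supporting
line in the orbit of x; for points slightly after x it is the farther vertex. Both itineraries are
codes of generic points (`mem_genericCodes_of_boundary`), hence M-periodic, and this forces τ^M x =
x. For either itinerary the first M symmetries compose to an isometry that fixes x and preserves the
cell of generic points with this code, which finitely many lines cut out. If x were a hyperbolic
fixed point, the cell would be a half-plane bounded by a line through two vertices, or a preimage of
one, up to non-generic points (`exists_side_of_invariant`); but no face contains such a half-plane
(`exists_side_pos_side_neg`). So both isometries have multiplier 1 at x (`eigenvalue_eq_one`). By
the chain rule the multipliers are products of derivatives of symmetries, and these are larger for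
nearer centres, strictly so at x itself: a contradiction.

Upper bound: if P is large, some orbit at infinity closes up after p steps and one turn. Its
supporting lines touch P at p different vertices, in cyclic order (`orbitVertex_succ`). Behind each
line lies a wedge; the inverse billiard maps each wedge into the preceding one, and every singular
point of the phase space is in a wedge (`wedge_succ`, `exists_mem_wedge`). When a nonempty word has
two continuations, a segment joining two orbits meets a singular point, and pulling it back through
the wedges shows that the word runs cyclically through the vertices (`word_eq_of_branch`). There are
at most p such words of each length, so f(n+1) ≤ f(n) + p². -/

theorem cross_swap (u w : ℂ) : cross w u = -cross u w := by
  unfold cross; ring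

theorem cross_self (u : ℂ) : cross u u = 0 := by
  unfold cross; ring

theorem cross_smul_left (c : ℝ) (u w : ℂ) : cross (c • u) w = c * cross u w := by
  simp [cross]; ring

theorem cross_smul_right (c : ℝ) (u w : ℂ) : cross u (c • w) = c * cross u w := by
  simp [cross]; ring

/-- The orientation of a triangle does not depend on the base point. -/
theorem cross_sub_sub_rotate (a b c : ℂ) : cross (b - a) (c - a) = cross (c - b) (a - b) := by
  simp only [cross, Complex.sub_re, Complex.sub_im]; ring

theorem cross_sub_combo (u o x y : ℂ) {s t : ℝ} (h : s + t = 1) :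
    cross u (s • x + t • y - o) = s * cross u (x - o) + t * cross u (y - o) := by
  obtain rfl : s = 1 - t := by linarith
  simp [cross]; ring

/-- The Plücker relation of four vectors in the plane. -/
theorem cross_plucker (a b c d : ℂ) :
    cross a c * cross b d = cross a b * cross c d + cross a d * cross b c := by
  unfold cross; ring

theorem mem_ball_iff_dot {x : ℂ} : x ∈ Metric.ball (0 : ℂ) 1 ↔ dot x x < 1 := by
  refine ⟨dot_self_lt_one, fun h => ?_⟩
  rw [mem_ball_zero_iff]
  rw [dot_self_eq] at h
  nlinarith [norm_nonneg x]

/-- The derivative at `x` of the geodesic symmetry about `a`, up to sign; at a point at infinity it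
is the conformal factor of the symmetry of the circle. -/
def symmFactor (a x : ℂ) : ℝ := (1 - dot a a) / (1 - 2 * dot x a + dot a a)

theorem symmFactor_pos {a x : ℂ} (ha : dot a a < 1) (hx : dot x x ≤ 1) : 0 < symmFactor a x :=
  div_pos (by linarith) (denom_pos ha hx)

theorem pointSymm_sub_center {a x : ℂ} (ha : dot a a < 1) (hx : dot x x ≤ 1) :
    pointSymm a x - a = symmFactor a x • (a - x) := by
  have h1 := (denom_pos ha hx).ne'
  apply Complex.ext
  · rw [Complex.sub_re, pointSymm_re, Complex.smul_re, Complex.sub_re, symmFactor, smul_eq_mul]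
    field_simp
    unfold dot
    ring
  · rw [Complex.sub_im, pointSymm_im, Complex.smul_im, Complex.sub_im, symmFactor, smul_eq_mul]
    field_simp
    unfold dot
    ring

theorem dot_pointSymm_lt_one {a x : ℂ} (ha : dot a a < 1) (hx : dot x x < 1) :
    dot (pointSymm a x) (pointSymm a x) < 1 := by
  have h := one_sub_dot_pointSymm ha hx.le hx.le
  have h1 := denom_pos ha hx.le
  have h2 : 0 < (1 - dot a a) ^ 2 * (1 - dot x x) /
      ((1 - 2 * dot x a + dot a a) * (1 - 2 * dot x a + dot a a)) :=
    div_pos (mul_pos (pow_pos (by linarith) 2) (by linarith)) (mul_pos h1 h1)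
  linarith

theorem dot_pointSymm_le_one {a x : ℂ} (ha : dot a a < 1) (hx : dot x x ≤ 1) :
    dot (pointSymm a x) (pointSymm a x) ≤ 1 := by
  have h := one_sub_dot_pointSymm ha hx hx
  have h1 := denom_pos ha hx
  have h2 : 0 ≤ (1 - dot a a) ^ 2 * (1 - dot x x) /
      ((1 - 2 * dot x a + dot a a) * (1 - 2 * dot x a + dot a a)) :=
    div_nonneg (mul_nonneg (sq_nonneg _) (by linarith)) (mul_pos h1 h1).le
  linarith

theorem denom_pointSymm {a x : ℂ} (ha : dot a a < 1) (hx : dot x x ≤ 1) :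
    1 - 2 * dot (pointSymm a x) a + dot a a =
      (1 - dot a a) ^ 2 / (1 - 2 * dot x a + dot a a) := by
  have h1 := (denom_pos ha hx).ne'
  rw [dot, pointSymm_re, pointSymm_im]
  field_simp
  unfold dot
  ring

theorem symmFactor_pointSymm {a x : ℂ} (ha : dot a a < 1) (hx : dot x x ≤ 1) :
    symmFactor a (pointSymm a x) * symmFactor a x = 1 := by
  have h1 := (denom_pos ha hx).ne'
  have h2 : 1 - dot a a ≠ 0 := by linarith
  rw [symmFactor, denom_pointSymm ha hx, symmFactor]
  field_simp

theorem pointSymm_pointSymm {a x : ℂ} (ha : dot a a < 1) (hx : dot x x ≤ 1) :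
    pointSymm a (pointSymm a x) = x := by
  have h1 := pointSymm_sub_center ha (dot_pointSymm_le_one ha hx)
  have h2 := pointSymm_sub_center ha hx
  have h3 : a - pointSymm a x = symmFactor a x • (x - a) := by
    rw [← neg_sub, h2, ← smul_neg, neg_sub]
  rw [h3, smul_smul, symmFactor_pointSymm ha hx, one_smul] at h1
  exact sub_left_injective h1

/-- The symmetry about `a` reverses the order of directions as seen along the line through `a`. -/
theorem cross_pointSymm {a x : ℂ} (ha : dot a a < 1) (hx : dot x x ≤ 1) (b : ℂ) :
    cross (a - pointSymm a x) (b - pointSymm a x) =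
      -(symmFactor a x * cross (a - x) (b - x)) := by
  have h : a - pointSymm a x = symmFactor a x • (x - a) := by
    rw [← neg_sub, pointSymm_sub_center ha hx, ← smul_neg, neg_sub]
  have e : cross (a - pointSymm a x) (b - pointSymm a x) = cross (a - pointSymm a x) (b - a) := by
    simp only [cross, Complex.sub_re, Complex.sub_im]; ring
  rw [e, h, cross_smul_left, ← mul_neg]
  congr 1
  simp only [cross, Complex.sub_re, Complex.sub_im]; ring

/-- The geodesic symmetry maps segments to segments. -/
theorem pointSymm_mem_segment {a x y z : ℂ} (ha : dot a a < 1) (hx : dot x x ≤ 1)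
    (hy : dot y y ≤ 1) (hz : z ∈ segment ℝ x y) :
    pointSymm a z ∈ segment ℝ (pointSymm a x) (pointSymm a y) := by
  obtain ⟨s, t, hs, ht, hst, rfl⟩ := hz
  have h1 := denom_pos ha hx
  have h2 := denom_pos ha hy
  have h3 : 1 - 2 * dot (s • x + t • y) a + dot a a =
      s * (1 - 2 * dot x a + dot a a) + t * (1 - 2 * dot y a + dot a a) := by
    obtain rfl : s = 1 - t := by linarith
    simp [dot]; ring
  have h4 : 0 < s * (1 - 2 * dot x a + dot a a) + t * (1 - 2 * dot y a + dot a a) := by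
    rcases hs.eq_or_lt with rfl | hs
    · have : t = 1 := by linarith
      rw [this]; linarith
    · have := mul_pos hs h1
      have := mul_nonneg ht h2.le
      linarith
  -- The symmetry is a projective map, so the weights of the image are the old ones rescaled by the
  -- denominators at the endpoints.
  refine ⟨s * (1 - 2 * dot x a + dot a a) /
      (s * (1 - 2 * dot x a + dot a a) + t * (1 - 2 * dot y a + dot a a)),
    t * (1 - 2 * dot y a + dot a a) /
      (s * (1 - 2 * dot x a + dot a a) + t * (1 - 2 * dot y a + dot a a)),
    by positivity, by positivity, by rw [← add_div, div_self h4.ne'], ?_⟩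
  have h5 := h1.ne'
  have h6 := h2.ne'
  apply Complex.ext
  · rw [Complex.add_re, Complex.smul_re, Complex.smul_re, pointSymm_re, pointSymm_re, pointSymm_re,
      h3]
    generalize hD : s * (1 - 2 * dot x a + dot a a) + t * (1 - 2 * dot y a + dot a a) = D at *
    have h7 := h4.ne'
    generalize hDx : 1 - 2 * dot x a + dot a a = Dx at *
    generalize hDy : 1 - 2 * dot y a + dot a a = Dy at *
    obtain rfl : s = 1 - t := by linarith
    simp only [smul_eq_mul]
    field_simp
    simp [dot]
    ring
  · rw [Complex.add_im, Complex.smul_im, Complex.smul_im, pointSymm_im, pointSymm_im, pointSymm_im,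
      h3]
    generalize hD : s * (1 - 2 * dot x a + dot a a) + t * (1 - 2 * dot y a + dot a a) = D at *
    have h7 := h4.ne'
    generalize hDx : 1 - 2 * dot x a + dot a a = Dx at *
    generalize hDy : 1 - 2 * dot y a + dot a a = Dy at *
    obtain rfl : s = 1 - t := by linarith
    simp only [smul_eq_mul]
    field_simp
    simp [dot]
    ring

theorem dot_self_pos_of_dot_ne_zero {e u : ℂ} (h : dot e u ≠ 0) : 0 < dot e e := by
  refine lt_of_le_of_ne (dot_self_nonneg e) fun h0 => h ?_
  rw [dot_self_eq, eq_comm, sq_eq_zero_iff, norm_eq_zero] at h0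
  simp [h0, dot]

/-- Within an open half-plane, the order of directions is the order of their slopes. -/
theorem cross_nonneg_of_slope_le {e u w : ℂ} (hu : 0 < dot e u) (hw : 0 < dot e w)
    (h : cross e u / dot e u ≤ cross e w / dot e w) : 0 ≤ cross u w := by
  rw [div_le_div_iff₀ hu hw] at h
  have h0 := dot_self_pos_of_dot_ne_zero hu.ne'
  have key : dot e e * cross u w = cross e w * dot e u - cross e u * dot e w := by
    unfold cross dot; ring
  exact nonneg_of_mul_nonneg_right (by linarith) h0

end KleinDisc


/-! ### Faces of the outer billiard and the view of the polygon from outside -/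

namespace KleinPolygon

variable {p : ℕ} [NeZero p] (P : KleinPolygon p)

theorem dot_vertex_lt_one (i : Fin p) : dot (P.vertex i) (P.vertex i) < 1 :=
  dot_self_lt_one (P.vertex_mem i)

theorem exists_ne_ne (P : KleinPolygon p) (i j : Fin p) : ∃ m, m ≠ i ∧ m ≠ j := by
  have h : ({i, j} : Finset (Fin p)).card < (Finset.univ : Finset (Fin p)).card := by
    have h1 := Finset.card_le_two (a := i) (b := j)
    have h2 := P.three_le
    rw [Finset.card_univ, Fintype.card_fin]
    omega
  obtain ⟨m, -, hm⟩ := Finset.exists_mem_notMem_of_card_lt_card h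
  simp only [Finset.mem_insert, Finset.mem_singleton, not_or] at hm
  exact ⟨m, hm⟩

theorem succ_ne (P : KleinPolygon p) (i : Fin p) : i + 1 ≠ i := by
  intro h
  have h1 : (1 : Fin p) = 0 := by simpa using h
  have h2 := P.three_le
  have h3 := congrArg Fin.val h1
  rw [Fin.val_one', Fin.val_zero, Nat.mod_eq_of_lt (by omega)] at h3
  exact one_ne_zero h3

theorem vertex_injective : Function.Injective P.vertex := by
  intro i j hij
  by_contra h
  by_cases h1 : j = i + 1
  · obtain ⟨m, hm1, hm2⟩ := P.exists_ne_ne i (i + 1)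
    have := P.convex i m hm1 hm2
    rw [← h1, ← hij, sub_self] at this
    simp [cross] at this
  · have := P.convex i j (Ne.symm h) h1
    rw [← hij, sub_self] at this
    simp [cross] at this

/-- A point from which a vertex is strictly extreme among all vertices is outside the polygon. -/
theorem notMem_region_of_extreme {i : Fin p} {x : ℂ} (σ : ℝ)
    (h : ∀ j, j ≠ i → 0 < σ * cross (P.vertex i - x) (P.vertex j - x)) : x ∉ P.region := by
  intro hx
  have hne : x ≠ P.vertex i := by
    rintro rfl
    obtain ⟨m, hm, -⟩ := P.exists_ne_ne i i
    have := h m hm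
    simp [cross] at this
  -- An open half-plane together with one point of its boundary line is convex. This one contains
  -- all vertices, while `x` is on the boundary line and differs from the added vertex.
  have hconv : Convex ℝ {z : ℂ | 0 < σ * cross (P.vertex i - x) (z - x) ∨ z = P.vertex i} := by
    rw [convex_iff_forall_pos]
    have key : ∀ z, (0 < σ * cross (P.vertex i - x) (z - x) ∨ z = P.vertex i) →
        0 ≤ σ * cross (P.vertex i - x) (z - x) := by
      rintro z (hz | rfl)
      · exact hz.le
      · simp [cross_self]
    intro y hy z hz s t hs ht hst
    simp only [Set.mem_ofPred_eq] at hy hz ⊢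
    rw [cross_sub_combo _ _ _ _ hst]
    have h1 := key y hy
    have h2 := key z hz
    rcases hy with hy | hy
    · left
      nlinarith [mul_pos hs hy, mul_nonneg ht.le h2]
    · rcases hz with hz | hz
      · left
        nlinarith [mul_pos ht hz, mul_nonneg hs.le h1]
      · right
        rw [hy, hz, ← add_smul, hst, one_smul]
  have hsub : Set.range P.vertex ⊆
      {z : ℂ | 0 < σ * cross (P.vertex i - x) (z - x) ∨ z = P.vertex i} := by
    rintro _ ⟨j, rfl⟩
    by_cases hj : j = i
    · right; rw [hj]
    · left; exact h j hj
  rcases convexHull_min hsub hconv hx with h1 | h1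
  · simp [cross] at h1
  · exact hne h1

/-- Strict extremality of a vertex already puts the point outside the polygon, so a face is cut out
of the disc by strict inequalities alone. -/
theorem mem_face_iff {i : Fin p} {x : ℂ} :
    x ∈ P.face i ↔ dot x x < 1 ∧ ∀ j, j ≠ i → 0 < cross (P.vertex i - x) (P.vertex j - x) := by
  constructor
  · rintro ⟨⟨h1, -⟩, h2⟩
    exact ⟨dot_self_lt_one h1, h2⟩
  · rintro ⟨h1, h2⟩
    exact ⟨⟨mem_ball_iff_dot.2 h1, P.notMem_region_of_extreme 1 (by simpa using h2)⟩, h2⟩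

theorem face_eq_of_mem {i j : Fin p} {x : ℂ} (hi : x ∈ P.face i) (hj : x ∈ P.face j) : i = j := by
  by_contra h
  have h1 := hi.2 j (Ne.symm h)
  have h2 := hj.2 i h
  rw [cross_swap] at h2
  linarith

/-- The cross product defining a face is affine in `x`, because its quadratic part `cross x x`
vanishes. -/
theorem convex_face (i : Fin p) : Convex ℝ (P.face i) := by
  intro x hx y hy s t hs ht hst
  rw [mem_face_iff] at *
  constructor
  · rw [← mem_ball_iff_dot]
    exact convex_ball (0 : ℂ) 1 (mem_ball_iff_dot.2 hx.1) (mem_ball_iff_dot.2 hy.1) hs ht hst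
  · intro j hj
    have e : cross (P.vertex i - (s • x + t • y)) (P.vertex j - (s • x + t • y)) =
        s * cross (P.vertex i - x) (P.vertex j - x) +
          t * cross (P.vertex i - y) (P.vertex j - y) := by
      obtain rfl : s = 1 - t := by linarith
      simp [cross]; ring
    rw [e]
    have h1 := hx.2 j hj
    have h2 := hy.2 j hj
    rcases hs.eq_or_lt with rfl | hs
    · obtain rfl : t = 1 := by linarith
      linarith
    · have := mul_pos hs h1
      have := mul_nonneg ht h2.le
      linarith

theorem isOpen_face (i : Fin p) : IsOpen (P.face i) := by
  have e : P.face i = Metric.ball (0 : ℂ) 1 ∩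
      ⋂ j : Fin p, {x | j ≠ i → 0 < cross (P.vertex i - x) (P.vertex j - x)} := by
    ext x
    rw [mem_face_iff, Set.mem_inter_iff, mem_ball_iff_dot, Set.mem_iInter]
    rfl
  rw [e]
  refine Metric.isOpen_ball.inter (isOpen_iInter_of_finite fun j => ?_)
  by_cases hj : j = i
  · simp [hj]
  · simp only [ne_eq, hj, not_false_eq_true, forall_const]
    apply isOpen_lt continuous_const
    unfold cross
    fun_prop

/-- The image of a face consists of the points for which its vertex is extreme on the other side. -/
theorem cross_pointSymm_neg {i : Fin p} {x : ℂ} (hx : x ∈ P.face i) {j : Fin p} (hj : j ≠ i) :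
    cross (P.vertex i - pointSymm (P.vertex i) x) (P.vertex j - pointSymm (P.vertex i) x) < 0 := by
  rw [mem_face_iff] at hx
  rw [cross_pointSymm (P.dot_vertex_lt_one i) hx.1.le, neg_lt_zero]
  exact mul_pos (symmFactor_pos (P.dot_vertex_lt_one i) hx.1.le) (hx.2 j hj)

theorem pointSymm_mem_phaseSpace {i : Fin p} {x : ℂ} (hx : x ∈ P.face i) :
    pointSymm (P.vertex i) x ∈ P.phaseSpace := by
  refine ⟨mem_ball_iff_dot.2 (dot_pointSymm_lt_one (P.dot_vertex_lt_one i)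
    (P.mem_face_iff.1 hx).1), P.notMem_region_of_extreme (i := i) (-1) fun j hj => ?_⟩
  have := P.cross_pointSymm_neg hx hj
  linarith

/-- From a point outside the polygon all vertices are seen within an open half-plane. -/
theorem exists_dot_pos {x : ℂ} (hx : x ∉ P.region) : ∃ e : ℂ, ∀ j, 0 < dot e (P.vertex j - x) := by
  have hc : IsClosed P.region := (Set.finite_range P.vertex).isClosed_convexHull ℝ
  obtain ⟨f, u, h1, h2⟩ := geometric_hahn_banach_point_closed (convex_convexHull ℝ _) hc hx
  have hf : ∀ z, f z = dot ⟨f 1, f Complex.I⟩ z := by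
    intro z
    have : z = z.re • (1 : ℂ) + z.im • Complex.I := by
      apply Complex.ext <;> simp
    conv_lhs => rw [this]
    rw [map_add, map_smul, map_smul, dot]
    simp only [smul_eq_mul]
    ring
  refine ⟨⟨f 1, f Complex.I⟩, fun j => ?_⟩
  rw [← hf, map_sub]
  have := h2 _ (subset_convexHull ℝ _ (Set.mem_range_self j))
  linarith

/-- The vertices are seen within an open half-plane, where slopes order the directions linearly. A
unique rightmost vertex is the centre of the billiard map at `x`; a unique leftmost one, found in
the same way, is the centre of its inverse. -/
theorem exists_rightmost {x : ℂ} (hx : x ∉ P.region) :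
    ∃ i, ∀ j, 0 ≤ cross (P.vertex i - x) (P.vertex j - x) := by
  obtain ⟨e, he⟩ := P.exists_dot_pos hx
  obtain ⟨i, hi⟩ := Finite.exists_min
    (fun j => cross e (P.vertex j - x) / dot e (P.vertex j - x))
  refine ⟨i, fun j => ?_⟩
  exact cross_nonneg_of_slope_le (he i) (he j) (hi j)

theorem exists_leftmost {x : ℂ} (hx : x ∉ P.region) :
    ∃ i, ∀ j, cross (P.vertex i - x) (P.vertex j - x) ≤ 0 := by
  obtain ⟨e, he⟩ := P.exists_dot_pos hx
  obtain ⟨i, hi⟩ := Finite.exists_max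
    (fun j => cross e (P.vertex j - x) / dot e (P.vertex j - x))
  refine ⟨i, fun j => ?_⟩
  rw [cross_swap, neg_nonpos]
  exact cross_nonneg_of_slope_le (he j) (he i) (hi j)

theorem words_finite (n : ℕ) : (P.words n).Finite := Set.toFinite _

/-- A word that occurs is the initial word of the code of a regular point. -/
theorem mem_words_iff {n : ℕ} {w : Fin n → Fin p} :
    w ∈ P.words n ↔ ∃ x s, P.IsRegularOrbit x s ∧ ∀ m : Fin n, w m = s m := by
  constructor
  · rintro ⟨x, s, h, k, hk⟩
    refine ⟨fun m => x (k + m), fun m => s (k + m), fun m => ?_, hk⟩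
    exact h (k + m)
  · rintro ⟨x, s, h, hk⟩
    exact ⟨x, s, h, 0, by simpa using hk⟩

theorem init_mem_words {n : ℕ} {w : Fin (n + 1) → Fin p} (hw : w ∈ P.words (n + 1)) :
    (fun m : Fin n => w m.castSucc) ∈ P.words n := by
  obtain ⟨x, s, h, hk⟩ := P.mem_words_iff.1 hw
  exact P.mem_words_iff.2 ⟨x, s, h, fun m => hk m.castSucc⟩

end KleinPolygon

end

/-! ### An orbit at infinity that closes up after `p` steps and one turn -/

noncomputable section

namespace KleinDisc

/-- The position of a third point of the circle relative to a chord. -/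
theorem cross_circlePt_nonneg {a u b : ℝ} (h1 : a ≤ b) (h2 : b ≤ u) (h3 : u ≤ a + 1) :
    0 ≤ cross (circlePt b - circlePt a) (circlePt u - circlePt a) := by
  have hpi := Real.pi_pos
  rw [cross_circlePt]
  have s1 : 0 ≤ Real.sin (Real.pi * (b - a)) :=
    Real.sin_nonneg_of_nonneg_of_le_pi (mul_nonneg hpi.le (by linarith)) (by nlinarith)
  have s2 : 0 ≤ Real.sin (Real.pi * (u - a)) :=
    Real.sin_nonneg_of_nonneg_of_le_pi (mul_nonneg hpi.le (by linarith)) (by nlinarith)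
  have s3 : 0 ≤ Real.sin (Real.pi * (u - b)) :=
    Real.sin_nonneg_of_nonneg_of_le_pi (mul_nonneg hpi.le (by linarith)) (by nlinarith)
  positivity

theorem cross_circlePt_pos {a u b : ℝ} (h1 : a < b) (h2 : b < u) (h3 : u < a + 1) :
    0 < cross (circlePt b - circlePt a) (circlePt u - circlePt a) := by
  have hpi := Real.pi_pos
  rw [cross_circlePt]
  have s1 : 0 < Real.sin (Real.pi * (b - a)) :=
    Real.sin_pos_of_pos_of_lt_pi (mul_pos hpi (by linarith)) (by nlinarith)
  have s2 : 0 < Real.sin (Real.pi * (u - a)) :=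
    Real.sin_pos_of_pos_of_lt_pi (mul_pos hpi (by linarith)) (by nlinarith)
  have s3 : 0 < Real.sin (Real.pi * (u - b)) :=
    Real.sin_pos_of_pos_of_lt_pi (mul_pos hpi (by linarith)) (by nlinarith)
  positivity

/-- A chord of the circle meets the closed disc only between its endpoints: a point of the open disc
before a second point as seen from a boundary point is before every point after the second one. -/
theorem cross_pos_of_boundary {x u v z : ℂ} (hx : dot x x = 1) (hu : dot u u < 1) (hv : dot v v < 1)
    (hz : dot z z < 1) (h1 : cross (u - x) (z - x) < 0) (h2 : 0 < cross (u - x) (v - x)) :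
    0 < cross (z - x) (v - x) := by
  -- The tangent direction at `x` has the open disc on its left, so all directions involved lie in
  -- one half-plane and the Plücker relation makes their order transitive.
  have tangent : ∀ w : ℂ, dot w w < 1 → 0 < cross (Complex.I * x) (w - x) := by
    intro w hw
    have e : cross (Complex.I * x) (w - x) = 1 - dot w x := by
      rw [← hx]
      simp [cross, dot]; ring
    rw [e, show dot w x = dot x w by unfold dot; ring]
    exact one_sub_dot_pos hw hx.le
  have h3 := tangent u hu
  have h4 := tangent v hv
  have h5 := tangent z hz
  have h6 := cross_plucker (Complex.I * x) (z - x) (u - x) (v - x)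
  have h7 : 0 < cross (z - x) (u - x) := by rw [cross_swap]; linarith
  have : 0 < cross (Complex.I * x) (u - x) * cross (z - x) (v - x) := by
    rw [h6]
    have := mul_pos h5 h2
    have := mul_pos h4 h7
    linarith
  exact pos_of_mul_pos_right this h3.le

end KleinDisc

namespace KleinPolygon

variable {p : ℕ} [NeZero p] (P : KleinPolygon p)

/-- The points of the orbit of `t` under the lift of the map at infinity. -/
def orbitParam (t : ℝ) (k : ℕ) : ℝ := P.liftFun^[k] t

theorem orbitParam_succ (t : ℝ) (k : ℕ) :
    P.orbitParam t (k + 1) = P.liftFun (P.orbitParam t k) :=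
  Function.iterate_succ_apply' _ _ _

theorem orbitParam_strictMono (t : ℝ) : StrictMono (P.orbitParam t) :=
  strictMono_nat_of_lt_succ fun k => by
    rw [orbitParam_succ]; exact P.lt_liftFun _

theorem circlePt_orbitParam (t : ℝ) (k : ℕ) :
    circlePt (P.orbitParam t k) = P.bdryMap^[k] (circlePt t) := by
  induction k with
  | zero => rfl
  | succ k ih =>
    rw [orbitParam_succ, circlePt_liftFun, ih, Function.iterate_succ_apply']

theorem orbitParam_add (t : ℝ) {n : ℕ} (h : P.orbitParam t n = t + 1) (k : ℕ) :
    P.orbitParam t (k + n) = P.orbitParam t k + 1 := by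
  induction k with
  | zero => rw [zero_add, h]; rfl
  | succ k ih => rw [add_right_comm, orbitParam_succ, ih, liftFun_add_one, orbitParam_succ]

/-- If the rotation number is `1 / n`, then a lift of an `n`-periodic point advances by one turn. -/
theorem orbitParam_eq_add_one {t : ℝ} {n : ℕ} (hn : 0 < n) (hrot : P.rotationNumber = 1 / n)
    (hper : P.bdryMap^[n] (circlePt t) = circlePt t) : P.orbitParam t n = t + 1 := by
  rw [← circlePt_orbitParam, circlePt_eq_iff] at hper
  obtain ⟨m, hm⟩ := hper
  have hpow : (P.lift ^ n) t = t + m := by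
    rw [CircleDeg1Lift.coe_pow]; exact hm
  have h := CircleDeg1Lift.translationNumber_of_map_pow_eq_add_int P.lift hpow hn
  change P.rotationNumber = _ at h
  have hn' : (n : ℝ) ≠ 0 := by positivity
  rw [h, div_left_inj' hn'] at hrot
  rw [hm, hrot]

/-- The vertex at which the `k`-th line of the orbit at infinity of `t` supports the polygon. -/
def orbitVertex (t : ℝ) (k : ℕ) : Fin p := P.bdryVertex (circlePt (P.orbitParam t k))

theorem coe_circlePt_orbitParam_succ (t : ℝ) (k : ℕ) :
    (circlePt (P.orbitParam t (k + 1)) : ℂ) =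
      pointSymm (P.vertex (P.orbitVertex t k)) (circlePt (P.orbitParam t k)) := by
  rw [orbitParam_succ, circlePt_liftFun, coe_bdryMap]; rfl

/-- The vertex is in the open disc, so it cannot be an endpoint of the chord; hence both weights are
positive. -/
theorem exists_orbitVertex_combo (t : ℝ) (k : ℕ) : ∃ r s : ℝ, 0 < r ∧ 0 < s ∧ r + s = 1 ∧
    r • (circlePt (P.orbitParam t k) : ℂ) + s • (circlePt (P.orbitParam t (k + 1)) : ℂ) =
      P.vertex (P.orbitVertex t k) := by
  have ha := P.dot_vertex_lt_one (P.orbitVertex t k)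
  obtain ⟨r, s, hr, hs, hrs, h⟩ := mem_segment_pointSymm ha
    (dot_coe_circle (circlePt (P.orbitParam t k))).le
  rw [← coe_circlePt_orbitParam_succ] at h
  refine ⟨r, s, lt_of_le_of_ne hr ?_, lt_of_le_of_ne hs ?_, hrs, h⟩
  · rintro rfl
    rw [zero_add] at hrs
    rw [hrs, zero_smul, one_smul, zero_add] at h
    rw [← h, dot_coe_circle] at ha
    exact lt_irrefl _ ha
  · rintro rfl
    rw [add_zero] at hrs
    rw [hrs, zero_smul, one_smul, add_zero] at h
    rw [← h, dot_coe_circle] at ha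
    exact lt_irrefl _ ha

theorem orbitParam_le_add_one {t : ℝ} (ht : P.orbitParam t p = t + 1)
    {j k : ℕ} (h : j ≤ k + p) :
    P.orbitParam t j ≤ P.orbitParam t k + 1 := by
  rw [← P.orbitParam_add t ht]
  exact (P.orbitParam_strictMono t).monotone h

theorem orbitParam_lt_add_one {t : ℝ} (ht : P.orbitParam t p = t + 1)
    {j k : ℕ} (h : j < k + p) :
    P.orbitParam t j < P.orbitParam t k + 1 := by
  rw [← P.orbitParam_add t ht]
  exact P.orbitParam_strictMono t h

/-- In the given range of `j`, both endpoints of the `j`-th chord lie on the closed arc to the left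
of the `k`-th chord. As `p ≥ 3`, they are not both endpoints of the `k`-th chord, and the vertex is
an interior point of the `j`-th one. -/
theorem cross_orbitVertex_pos {t : ℝ} (ht : P.orbitParam t p = t + 1)
    {j k : ℕ} (h1 : k < j) (h2 : j < k + p) :
    0 < cross (circlePt (P.orbitParam t (k + 1)) - circlePt (P.orbitParam t k))
      (P.vertex (P.orbitVertex t j) - circlePt (P.orbitParam t k)) := by
  have hp := P.three_le
  have hm := P.orbitParam_strictMono t
  obtain ⟨r, s, hr, hs, hrs, e⟩ := P.exists_orbitVertex_combo t j
  rw [← e, cross_sub_combo _ _ _ _ hrs]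
  have h3 := cross_circlePt_nonneg (hm (Nat.lt_succ_self k)).le (hm.monotone h1)
    (P.orbitParam_le_add_one ht h2.le)
  have h4 := cross_circlePt_nonneg (hm (Nat.lt_succ_self k)).le
    (hm.monotone (show k + 1 ≤ j + 1 by omega))
    (P.orbitParam_le_add_one ht (show j + 1 ≤ k + p by omega))
  rcases (show k + 1 < j ∨ j + 1 < k + p by omega) with h | h
  · have := cross_circlePt_pos (hm (Nat.lt_succ_self k)) (hm h)
      (P.orbitParam_lt_add_one ht h2)
    have := mul_pos hr this
    have := mul_nonneg hs.le h4
    linarith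
  · have := cross_circlePt_pos (hm (Nat.lt_succ_self k))
      (hm (show k + 1 < j + 1 by omega)) (P.orbitParam_lt_add_one ht h)
    have := mul_pos hs this
    have := mul_nonneg hr.le h3
    linarith

theorem cross_orbitVertex_self (t : ℝ) (k : ℕ) :
    cross (circlePt (P.orbitParam t (k + 1)) - circlePt (P.orbitParam t k))
      (P.vertex (P.orbitVertex t k) - circlePt (P.orbitParam t k)) = 0 := by
  obtain ⟨r, s, hr, hs, hrs, e⟩ := P.exists_orbitVertex_combo t k
  rw [← e, cross_sub_combo _ _ _ _ hrs, sub_self, cross_self]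
  simp [cross]

theorem orbitVertex_ne {t : ℝ} (ht : P.orbitParam t p = t + 1)
    {j k : ℕ} (h1 : k < j) (h2 : j < k + p) :
    P.orbitVertex t j ≠ P.orbitVertex t k := by
  intro h
  have h3 := P.cross_orbitVertex_pos ht h1 h2
  rw [h, P.cross_orbitVertex_self] at h3
  exact lt_irrefl _ h3

/-- By `orbitVertex_ne`, `p` consecutive chords touch pairwise different vertices; counting shows
that they touch all. -/
theorem exists_orbitVertex_eq {t : ℝ} (ht : P.orbitParam t p = t + 1)
    (k : ℕ) (i : Fin p) :
    ∃ j, k ≤ j ∧ j < k + p ∧ P.orbitVertex t j = i := by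
  have hinj : Function.Injective fun m : Fin p => P.orbitVertex t (k + m) := by
    intro m m' h
    rcases lt_trichotomy m m' with h1 | h1 | h1
    · exact absurd h.symm (P.orbitVertex_ne ht (show k + m < k + m' by omega) (by omega))
    · exact h1
    · exact absurd h (P.orbitVertex_ne ht (show k + m' < k + m by omega) (by omega))
  obtain ⟨m, hm⟩ := (Finite.injective_iff_surjective.1 hinj) i
  exact ⟨k + m, by omega, by omega, hm⟩

/-- No line of the orbit contains a side of the polygon. -/
theorem cross_vertex_pos_of_ne {t : ℝ} (ht : P.orbitParam t p = t + 1)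
    (k : ℕ) {i : Fin p} (hi : i ≠ P.orbitVertex t k) :
    0 < cross (circlePt (P.orbitParam t (k + 1)) - circlePt (P.orbitParam t k))
      (P.vertex i - circlePt (P.orbitParam t k)) := by
  obtain ⟨j, h1, h2, rfl⟩ := P.exists_orbitVertex_eq ht k i
  rcases h1.eq_or_lt with rfl | h1
  · exact absurd rfl hi
  · exact P.cross_orbitVertex_pos ht h1 h2

theorem exists_orbitVertex_sub (t : ℝ) (k : ℕ) : ∃ s : ℝ, 0 < s ∧
    P.vertex (P.orbitVertex t k) - circlePt (P.orbitParam t k) =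
      s • ((circlePt (P.orbitParam t (k + 1)) : ℂ) - circlePt (P.orbitParam t k)) := by
  obtain ⟨r, s, hr, hs, hrs, e⟩ := P.exists_orbitVertex_combo t k
  refine ⟨s, hs, ?_⟩
  obtain rfl : r = 1 - s := by linarith
  rw [← e]
  module

theorem exists_orbitVertex_sub' (t : ℝ) (k : ℕ) : ∃ s : ℝ, 0 < s ∧
    (circlePt (P.orbitParam t (k + 1)) : ℂ) - P.vertex (P.orbitVertex t k) =
      s • ((circlePt (P.orbitParam t (k + 1)) : ℂ) - circlePt (P.orbitParam t k)) := by
  obtain ⟨r, s, hr, hs, hrs, e⟩ := P.exists_orbitVertex_combo t k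
  refine ⟨r, hr, ?_⟩
  obtain rfl : s = 1 - r := by linarith
  rw [← e]
  module

/-- The orbit visits the vertices in their cyclic order. -/
theorem orbitVertex_succ {t : ℝ} (ht : P.orbitParam t p = t + 1)
    (k : ℕ) : P.orbitVertex t (k + 1) = P.orbitVertex t k + 1 := by
  by_contra hne
  have hp := P.three_le
  have hm := P.orbitParam_strictMono t
  have hik : P.orbitVertex t (k + 1) ≠ P.orbitVertex t k :=
    P.orbitVertex_ne ht (Nat.lt_succ_self k) (by omega)
  obtain ⟨j, hj1, hj2, hj⟩ := P.exists_orbitVertex_eq ht k (P.orbitVertex t k + 1)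
  have hj3 : j ≠ k := by
    rintro rfl
    exact P.succ_ne _ hj.symm
  have hj4 : j ≠ k + 1 := by
    rintro rfl
    exact hne hj
  have hZ : P.orbitVertex t k + 1 ≠ P.orbitVertex t k := P.succ_ne _
  have c1 := P.cross_vertex_pos_of_ne ht k hZ
  have c2 := P.cross_vertex_pos_of_ne ht (k + 1) (Ne.symm hne)
  have c3 := P.convex (P.orbitVertex t k) (P.orbitVertex t (k + 1)) hik hne
  have hx1 := cross_circlePt_neg (hm (Nat.lt_succ_self k)) (hm (Nat.lt_succ_self (k + 1)))
    (P.orbitParam_lt_add_one ht (show k + 1 + 1 < k + p by omega))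
  have hA : cross (circlePt (P.orbitParam t (k + 1 + 1)) - circlePt (P.orbitParam t k))
      (P.vertex (P.orbitVertex t k) - circlePt (P.orbitParam t k)) < 0 := by
    obtain ⟨s, hs, e⟩ := P.exists_orbitVertex_sub t k
    rw [e, cross_smul_right]
    exact mul_neg_of_pos_of_neg hs hx1
  have hC : cross (circlePt (P.orbitParam t (k + 1 + 1)) - circlePt (P.orbitParam t k))
      (P.vertex (P.orbitVertex t (k + 1)) - circlePt (P.orbitParam t k)) < 0 := by
    obtain ⟨r, s, hr, hs, hrs, e⟩ := P.exists_orbitVertex_combo t (k + 1)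
    rw [← e, cross_sub_combo _ _ _ _ hrs, cross_self, mul_zero, add_zero]
    exact mul_neg_of_pos_of_neg hr hx1
  have hZ2 : 0 ≤ cross (circlePt (P.orbitParam t (k + 1 + 1)) - circlePt (P.orbitParam t k))
      (P.vertex (P.orbitVertex t k + 1) - circlePt (P.orbitParam t k)) := by
    obtain ⟨r, s, hr, hs, hrs, e⟩ := P.exists_orbitVertex_combo t j
    rw [← hj, ← e, cross_sub_combo _ _ _ _ hrs]
    have h3 := cross_circlePt_nonneg (hm (show k < k + 1 + 1 by omega)).le
      (hm.monotone (show k + 1 + 1 ≤ j by omega)) (P.orbitParam_le_add_one ht hj2.le)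
    have h4 := cross_circlePt_nonneg (hm (show k < k + 1 + 1 by omega)).le
      (hm.monotone (show k + 1 + 1 ≤ j + 1 by omega))
      (P.orbitParam_le_add_one ht (show j + 1 ≤ k + p by omega))
    positivity
  have o1 : 0 < cross (circlePt (P.orbitParam t (k + 1)) - P.vertex (P.orbitVertex t k))
      (P.vertex (P.orbitVertex t k + 1) - P.vertex (P.orbitVertex t k)) := by
    obtain ⟨s, hs, e⟩ := P.exists_orbitVertex_sub' t k
    rw [e, cross_smul_left]
    refine mul_pos hs ?_
    have h0 := P.cross_orbitVertex_self t k
    have e2 : cross (circlePt (P.orbitParam t (k + 1)) - circlePt (P.orbitParam t k))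
        (P.vertex (P.orbitVertex t k + 1) - P.vertex (P.orbitVertex t k)) =
      cross (circlePt (P.orbitParam t (k + 1)) - circlePt (P.orbitParam t k))
        (P.vertex (P.orbitVertex t k + 1) - circlePt (P.orbitParam t k)) -
      cross (circlePt (P.orbitParam t (k + 1)) - circlePt (P.orbitParam t k))
        (P.vertex (P.orbitVertex t k) - circlePt (P.orbitParam t k)) := by
      simp only [cross, Complex.sub_re, Complex.sub_im]; ring
    rw [e2, h0, sub_zero]
    exact c1
  have o2 : 0 < cross (P.vertex (P.orbitVertex t (k + 1)) - circlePt (P.orbitParam t (k + 1)))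
      (P.vertex (P.orbitVertex t k + 1) - circlePt (P.orbitParam t (k + 1))) := by
    obtain ⟨s, hs, e⟩ := P.exists_orbitVertex_sub t (k + 1)
    rw [e, cross_smul_left]
    exact mul_pos hs c2
  generalize P.vertex (P.orbitVertex t k + 1) = Z at *
  generalize P.vertex (P.orbitVertex t k) = A at *
  generalize P.vertex (P.orbitVertex t (k + 1)) = C at *
  generalize (circlePt (P.orbitParam t (k + 1)) : ℂ) = B at *
  generalize (circlePt (P.orbitParam t k) : ℂ) = O at *
  generalize (circlePt (P.orbitParam t (k + 1 + 1)) : ℂ) - O = u at *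
  -- If the successor `Z` of the vertex `A` were not `C`, then it would lie inside the triangle `A B
  -- C`: the three areas are its barycentric weights, up to a common factor. But `A`, `B`, `C` are
  -- strictly to the right of the chord with direction `u` from `O`, whereas `Z`, on a later chord
  -- of the orbit, is not.
  have key : (cross (C - B) (Z - B) + cross (Z - A) (C - A) + cross (B - A) (Z - A)) *
      cross u (Z - O) = cross (C - B) (Z - B) * cross u (A - O) +
        cross (Z - A) (C - A) * cross u (B - O) + cross (B - A) (Z - A) * cross u (C - O) := by
    simp only [cross, Complex.sub_re, Complex.sub_im]; ring
  have k1 := mul_neg_of_pos_of_neg o2 hA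
  have k2 := mul_neg_of_pos_of_neg c3 hx1
  have k3 := mul_neg_of_pos_of_neg o1 hC
  have k4 : 0 ≤ (cross (C - B) (Z - B) + cross (Z - A) (C - A) + cross (B - A) (Z - A)) *
      cross u (Z - O) := mul_nonneg (by positivity) hZ2
  linarith

end KleinPolygon

end

/-! ### Wedges, branching words and the linear upper bound -/

noncomputable section

namespace KleinDisc

theorem cross_sub_swap (u a b : ℂ) : cross u (a - b) = -cross u (b - a) := by
  simp only [cross, Complex.sub_re, Complex.sub_im]; ring

theorem eq_smul_of_cross_eq_zero {e u w : ℂ} (h : cross u w = 0) (hu : dot e u ≠ 0) :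
    w = (dot e w / dot e u) • u := by
  have h1 : dot e u * w.re = dot e w * u.re := by
    unfold cross at h
    unfold dot
    linear_combination -e.im * h
  have h2 : dot e u * w.im = dot e w * u.im := by
    unfold cross at h
    unfold dot
    linear_combination e.re * h
  apply Complex.ext
  · rw [Complex.smul_re, smul_eq_mul]
    field_simp
    linarith
  · rw [Complex.smul_im, smul_eq_mul]
    field_simp
    linarith

theorem dot_smul_smul (c : ℝ) (u w : ℂ) : dot (c • u) (c • w) = c ^ 2 * dot u w := by
  simp [dot]; ring

end KleinDisc

namespace KleinPolygon

variable {p : ℕ} [NeZero p] (P : KleinPolygon p)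

theorem succ_succ_ne (P : KleinPolygon p) (i : Fin p) : i + 1 + 1 ≠ i := by
  intro h
  have h1 : (1 + 1 : Fin p) = 0 := by rwa [add_assoc, add_eq_left] at h
  have h2 := P.three_le
  have h3 := congrArg Fin.val h1
  rw [Fin.val_add, Fin.val_one', Fin.val_zero, Nat.mod_eq_of_lt (show 1 < p by omega),
    Nat.mod_eq_of_lt (by omega)] at h3
  omega

/-- The region beyond the `k`-th line of the orbit at infinity that is bounded by this line and the
singular ray at the vertex that supports it. -/
def wedge (t : ℝ) (k : ℕ) : Set ℂ :=
  {z | dot z z < 1 ∧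
    cross (P.vertex (P.orbitVertex t k) - circlePt (P.orbitParam t k))
      (z - circlePt (P.orbitParam t k)) < 0 ∧
    0 ≤ cross (P.vertex (P.orbitVertex t k + 1) - P.vertex (P.orbitVertex t k))
      (z - P.vertex (P.orbitVertex t k))}

theorem cross_support_pos {t : ℝ} (ht : P.orbitParam t p = t + 1) (k : ℕ) {i : Fin p}
    (hi : i ≠ P.orbitVertex t k) :
    0 < cross (P.vertex (P.orbitVertex t k) - circlePt (P.orbitParam t k))
      (P.vertex i - circlePt (P.orbitParam t k)) := by
  obtain ⟨s, hs, e⟩ := P.exists_orbitVertex_sub t k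
  rw [e, cross_smul_left]
  exact mul_pos hs (P.cross_vertex_pos_of_ne ht k hi)

/-- On a wedge the inverse of the outer billiard is the symmetry about the preceding vertex, and it
maps the wedge into the preceding one. -/
theorem wedge_succ {t : ℝ} (ht : P.orbitParam t p = t + 1) {k : ℕ} {z : ℂ}
    (hz : z ∈ P.wedge t (k + 1)) :
    (∀ l, l ≠ P.orbitVertex t k →
      cross (P.vertex (P.orbitVertex t k) - z) (P.vertex l - z) < 0) ∧
    pointSymm (P.vertex (P.orbitVertex t k)) z ∈ P.wedge t k := by
  obtain ⟨hz1, hz2, hz3⟩ := hz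
  have hsup : ∀ l, l ≠ P.orbitVertex t k + 1 → 0 < cross
      (P.vertex (P.orbitVertex t k + 1) - circlePt (P.orbitParam t (k + 1)))
      (P.vertex l - circlePt (P.orbitParam t (k + 1))) := by
    intro l hl
    have := P.cross_support_pos ht (k + 1) (i := l) (by rwa [P.orbitVertex_succ ht])
    rwa [P.orbitVertex_succ ht] at this
  rw [P.orbitVertex_succ ht] at hz2 hz3
  obtain ⟨r, hr, her⟩ := P.exists_orbitVertex_sub t k
  obtain ⟨s, hs, hes⟩ := P.exists_orbitVertex_sub' t k
  have hall : ∀ l, l ≠ P.orbitVertex t k →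
      0 < cross (circlePt (P.orbitParam t (k + 1)) - P.vertex (P.orbitVertex t k))
        (P.vertex l - P.vertex (P.orbitVertex t k)) := by
    intro l hl
    have h1 := P.cross_vertex_pos_of_ne ht k hl
    have h2 := P.cross_orbitVertex_self t k
    rw [hes, cross_smul_left]
    refine mul_pos hs ?_
    have e2 : cross (circlePt (P.orbitParam t (k + 1)) - circlePt (P.orbitParam t k))
        (P.vertex l - P.vertex (P.orbitVertex t k)) =
      cross (circlePt (P.orbitParam t (k + 1)) - circlePt (P.orbitParam t k))
        (P.vertex l - circlePt (P.orbitParam t k)) -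
      cross (circlePt (P.orbitParam t (k + 1)) - circlePt (P.orbitParam t k))
        (P.vertex (P.orbitVertex t k) - circlePt (P.orbitParam t k)) := by
      simp only [cross, Complex.sub_re, Complex.sub_im]; ring
    linarith
  have hconv := P.convex (P.orbitVertex t k)
  have hconv' := P.convex (P.orbitVertex t k + 1) (P.orbitVertex t k) (P.succ_ne _).symm
    (P.succ_succ_ne _).symm
  have hsup1 := hsup (P.orbitVertex t k) (P.succ_ne _).symm
  have hsup2 := hsup (P.orbitVertex t k + 1 + 1) (P.succ_ne _)
  have ha := P.dot_vertex_lt_one (P.orbitVertex t k)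
  -- As seen from the boundary point `k + 1` of the orbit, the order from right to left is `z`, the
  -- next vertex, the present vertex. Hence `z` is on the polygon's side of the `k`-th chord.
  have hz4 := cross_pos_of_boundary (dot_coe_circle _) (P.dot_vertex_lt_one _)
    ha hz1 hz2 hsup1
  unfold wedge
  simp only [Set.mem_ofPred_eq]
  have hside := hall _ (P.succ_ne (P.orbitVertex t k))
  generalize hc : P.orbitVertex t k = c at *
  generalize P.vertex (c + 1 + 1) = n at *
  generalize (circlePt (P.orbitParam t (k + 1)) : ℂ) = x at *
  -- Comparing directions around the vertex `c + 1` puts `z` strictly to the right of the side from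
  -- `c` to `c + 1`.
  have h1 : cross (P.vertex (c + 1) - P.vertex c) (z - P.vertex c) < 0 := by
    have hnd : 0 < cross (n - P.vertex (c + 1)) (x - P.vertex (c + 1)) := by
      rwa [← cross_sub_sub_rotate]
    have hmd : 0 < cross (P.vertex c - P.vertex (c + 1)) (x - P.vertex (c + 1)) := by
      rwa [← cross_sub_sub_rotate]
    have hdu : 0 < cross (x - P.vertex (c + 1)) (z - P.vertex (c + 1)) := by
      rw [cross_sub_sub_rotate, cross_swap] at hz2
      linarith
    have hp := cross_plucker (n - P.vertex (c + 1)) (P.vertex c - P.vertex (c + 1))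
      (x - P.vertex (c + 1)) (z - P.vertex (c + 1))
    have h2 := mul_pos hconv' hdu
    have h3 := mul_nonneg hz3 hmd.le
    have h4 : 0 < cross (P.vertex c - P.vertex (c + 1)) (z - P.vertex (c + 1)) :=
      pos_of_mul_pos_right (by rw [hp]; linarith) hnd.le
    rw [cross_sub_sub_rotate, cross_swap]
    linarith
  have h2 : 0 < cross (x - P.vertex c) (z - P.vertex c) := by
    rwa [cross_sub_sub_rotate, cross_sub_sub_rotate] at hz4
  refine ⟨fun l hl => ?_, dot_pointSymm_lt_one ha hz1, ?_, ?_⟩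
  · have e : cross (P.vertex c - z) (P.vertex l - z) =
        cross (P.vertex l - P.vertex c) (z - P.vertex c) := cross_sub_sub_rotate _ _ _
    rw [e]
    by_cases hl' : l = c + 1
    · rw [hl']; exact h1
    -- The same comparison around the vertex `c` handles the remaining vertices, which makes `c` the
    -- leftmost vertex seen from `z`.
    · have hp := cross_plucker (x - P.vertex c) (z - P.vertex c) (P.vertex (c + 1) - P.vertex c)
        (P.vertex l - P.vertex c)
      have h3 := mul_pos h2 (hconv l hl hl')
      have h4 : 0 < cross (z - P.vertex c) (P.vertex (c + 1) - P.vertex c) := by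
        rw [cross_swap]; linarith
      have h5 := mul_pos (hall l hl) h4
      have h6 : 0 < cross (z - P.vertex c) (P.vertex l - P.vertex c) :=
        pos_of_mul_pos_right (by rw [hp]; linarith) hside.le
      rw [cross_swap]
      linarith
  · have e1 : cross (P.vertex c - circlePt (P.orbitParam t k))
        (pointSymm (P.vertex c) z - circlePt (P.orbitParam t k)) =
        cross (P.vertex c - circlePt (P.orbitParam t k))
          (pointSymm (P.vertex c) z - P.vertex c) := by
      simp only [cross, Complex.sub_re, Complex.sub_im]; ring
    rw [e1, pointSymm_sub_center ha hz1.le, cross_smul_right, her, cross_smul_left]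
    rw [hes, cross_smul_left] at h2
    have h3 : 0 < cross (x - circlePt (P.orbitParam t k)) (z - P.vertex c) :=
      pos_of_mul_pos_right h2 hs.le
    have h4 : cross (x - circlePt (P.orbitParam t k)) (P.vertex c - z) < 0 := by
      rw [cross_sub_swap]; linarith
    exact mul_neg_of_pos_of_neg (symmFactor_pos ha hz1.le) (mul_neg_of_pos_of_neg hr h4)
  · rw [pointSymm_sub_center ha hz1.le, cross_smul_right]
    have h4 : 0 < cross (P.vertex (c + 1) - P.vertex c) (P.vertex c - z) := by
      rw [cross_sub_swap]; linarith
    exact (mul_pos (symmFactor_pos ha hz1.le) h4).le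

/-- A singular point lies in a wedge. -/
theorem exists_mem_wedge {t : ℝ} (ht : P.orbitParam t p = t + 1) {z : ℂ} (hz : z ∈ P.phaseSpace)
    (hface : ∀ i, z ∉ P.face i) : ∃ i, ∀ k, P.orbitVertex t k = i → z ∈ P.wedge t k := by
  classical
  have hz1 := dot_self_lt_one hz.1
  obtain ⟨e, he⟩ := P.exists_dot_pos hz.2
  obtain ⟨i₀, hi₀⟩ := P.exists_rightmost hz.2
  -- At a singular point several vertices tie for rightmost; the nearest of them is the one from
  -- which the singular ray starts.
  obtain ⟨i, hi, hmin⟩ := Finset.exists_min_image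
    (Finset.univ.filter fun i => ∀ j, 0 ≤ cross (P.vertex i - z) (P.vertex j - z))
    (fun i => dot (P.vertex i - z) (P.vertex i - z)) ⟨i₀, by simpa using hi₀⟩
  simp only [Finset.mem_filter, Finset.mem_univ, true_and] at hi hmin
  have hj : ∃ j, j ≠ i ∧ cross (P.vertex i - z) (P.vertex j - z) = 0 := by
    by_contra! hcon
    exact hface i (P.mem_face_iff.2 ⟨hz1, fun j hj => lt_of_le_of_ne (hi j) (hcon j hj).symm⟩)
  obtain ⟨j, hji, hj⟩ := hj
  obtain ⟨ρ, hρ, hej⟩ : ∃ ρ : ℝ, 0 < ρ ∧ P.vertex j - z = ρ • (P.vertex i - z) :=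
    ⟨_, div_pos (he j) (he i), eq_smul_of_cross_eq_zero hj (he i).ne'⟩
  have hρ1 : 1 < ρ := by
    have h1 := hmin j fun l => by
      rw [hej, cross_smul_left]; exact mul_nonneg hρ.le (hi l)
    have h2 := dot_self_pos_of_dot_ne_zero (e := P.vertex i - z) (u := e)
      (by have := (he i).ne'; rwa [show dot e (P.vertex i - z) = dot (P.vertex i - z) e by
            unfold dot; ring] at this)
    rw [hej, dot_smul_smul] at h1
    have h3 : 1 ≤ ρ ^ 2 := by
      by_contra! h
      nlinarith
    have h4 : 1 ≤ ρ := by nlinarith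
    refine lt_of_le_of_ne h4 ?_
    rintro rfl
    rw [one_smul] at hej
    exact hji (P.vertex_injective (sub_left_injective hej))
  refine ⟨i, fun k hk => ?_⟩
  subst hk
  refine ⟨hz1, ?_, ?_⟩
  · have h1 := P.cross_support_pos ht k hji
    generalize P.vertex (P.orbitVertex t k) = a at *
    generalize (circlePt (P.orbitParam t k) : ℂ) = x at *
    -- Since `1 < ρ`, the vertex `a` lies between `z` and the vertex `j`, so these are on opposite
    -- sides of the supporting line through `a`.
    have h2 : cross (a - x) (P.vertex j - x) = (1 - ρ) * cross (a - x) (z - x) := by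
      rw [← sub_add_cancel (P.vertex j) z, hej]
      simp [cross]
      ring
    rw [h2] at h1
    by_contra! h
    nlinarith
  · rw [← cross_sub_sub_rotate]
    exact hi _

theorem orbitVertex_add {t : ℝ} (ht : P.orbitParam t p = t + 1) (k m : ℕ) :
    P.orbitVertex t (k + m) = P.orbitVertex t k + m • (1 : Fin p) := by
  induction m with
  | zero => simp
  | succ m ih => rw [← add_assoc, P.orbitVertex_succ ht, ih, succ_nsmul, add_assoc]

/-- A segment between points of different faces that avoids the polygon has a singular point. -/
theorem exists_singular_mem_segment {i j : Fin p} (hij : i ≠ j) {x y : ℂ} (hx : x ∈ P.face i)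
    (hy : y ∈ P.face j) : ∃ z ∈ segment ℝ x y, ∀ l, z ∉ P.face l := by
  by_contra! hcon
  -- Faces are open and pairwise disjoint, so a connected segment that meets two of them is not
  -- covered by faces.
  have hc : IsPreconnected (segment ℝ x y) := (convex_segment x y).isPreconnected
  have hopen : IsOpen (⋃ l ∈ {l | l ≠ i}, P.face l) :=
    isOpen_biUnion fun l _ => P.isOpen_face l
  obtain ⟨z, -, hz1, hz2⟩ := hc _ _ (P.isOpen_face i) hopen
    (fun z hz => by
      obtain ⟨l, hl⟩ := hcon z hz
      by_cases hli : l = i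
      · left; rwa [← hli]
      · right; exact Set.mem_biUnion hli hl)
    ⟨x, left_mem_segment ℝ x y, hx⟩
    ⟨y, right_mem_segment ℝ x y, Set.mem_biUnion (Ne.symm hij) hy⟩
  simp only [Set.mem_iUnion] at hz2
  obtain ⟨l, hl, hz2⟩ := hz2
  exact hl (P.face_eq_of_mem hz2 hz1)

/-- If the map at infinity has a periodic orbit that goes once around in `p` steps, then a word with
several extensions runs through the vertices in their cyclic order. -/
theorem word_eq_of_branch {t : ℝ} (ht : P.orbitParam t p = t + 1) {n : ℕ} (hn : 0 < n)
    {v w : Fin (n + 1) → Fin p} (hv : v ∈ P.words (n + 1)) (hw : w ∈ P.words (n + 1))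
    (hinit : ∀ m : Fin n, v m.castSucc = w m.castSucc) (hlast : v (Fin.last n) ≠ w (Fin.last n)) :
    ∃ i : Fin p, (fun m : Fin n => v m.castSucc) = fun m : Fin n => i + (m : ℕ) • (1 : Fin p) := by
  obtain ⟨x, s, hx, hvs⟩ := P.mem_words_iff.1 hv
  obtain ⟨y, s', hy, hws⟩ := P.mem_words_iff.1 hw
  have hs : ∀ m, m < n → s' m = s m := by
    intro m hm
    have h1 := hvs (Fin.castSucc ⟨m, hm⟩)
    have h2 := hws (Fin.castSucc ⟨m, hm⟩)
    rw [← hinit, h1] at h2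
    exact h2.symm
  have hne : s n ≠ s' n := by
    have h1 := hvs (Fin.last n)
    have h2 := hws (Fin.last n)
    rw [h1, h2] at hlast
    exact hlast
  obtain ⟨z, hz, hsing⟩ := P.exists_singular_mem_segment hne (hx n).1 (hy n).1
  -- Before time `n` both orbits use the same symmetries, and faces are convex. So every point of a
  -- later segment has a backward orbit in the earlier segments, with the common letters as code.
  have pull : ∀ m, m < n → ∀ u ∈ segment ℝ (x (m + 1)) (y (m + 1)),
      pointSymm (P.vertex (s m)) u ∈ segment ℝ (x m) (y m) ∧
      pointSymm (P.vertex (s m)) u ∈ P.face (s m) ∧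
      pointSymm (P.vertex (s m)) (pointSymm (P.vertex (s m)) u) = u := by
    intro m hm u hu
    have ha := P.dot_vertex_lt_one (s m)
    have h1 := (P.mem_face_iff.1 (hx (m + 1)).1).1
    have h2 := (P.mem_face_iff.1 (hy (m + 1)).1).1
    have h3 := (P.mem_face_iff.1 (hx m).1).1
    have h4 := (P.mem_face_iff.1 (hy m).1).1
    have hu1 : dot u u < 1 := mem_ball_iff_dot.1
      ((convex_ball (0 : ℂ) 1).segment_subset (mem_ball_iff_dot.2 h1) (mem_ball_iff_dot.2 h2) hu)
    have h5 := pointSymm_mem_segment ha h1.le h2.le hu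
    rw [(hx m).2, (hy m).2, hs m hm, pointSymm_pointSymm ha h3.le,
      pointSymm_pointSymm ha h4.le] at h5
    have h6 := (hy m).1
    rw [hs m hm] at h6
    exact ⟨h5, (P.convex_face _).segment_subset (hx m).1 h6 h5, pointSymm_pointSymm ha hu1.le⟩
  have hzp : z ∈ P.phaseSpace := by
    obtain ⟨m, rfl⟩ := Nat.exists_eq_add_of_le' hn
    obtain ⟨-, h2, h3⟩ := pull m (Nat.lt_succ_self m) z hz
    rw [← h3]
    exact P.pointSymm_mem_phaseSpace h2
  obtain ⟨i, hi⟩ := P.exists_mem_wedge ht hzp hsing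
  -- The index is taken at least `n` to leave room for `n` backward steps.
  obtain ⟨j, hj1, -, hj⟩ := P.exists_orbitVertex_eq ht n i
  obtain ⟨K, rfl⟩ := Nat.exists_eq_add_of_le' hj1
  have main : ∀ m, m ≤ n → (∃ u ∈ segment ℝ (x m) (y m), u ∈ P.wedge t (K + m)) ∧
      ∀ m', m ≤ m' → m' < n → s m' = P.orbitVertex t (K + m') := by
    intro m hm
    induction hm using Nat.decreasingInduction with
    | self => exact ⟨⟨z, hz, hi _ hj⟩, fun m' h1 h2 => absurd h2 (by omega)⟩
    | of_succ m hm ih =>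
      obtain ⟨⟨u, hu, huw⟩, hcode⟩ := ih
      obtain ⟨h1, h2, h3⟩ := pull m hm u hu
      obtain ⟨h4, h5⟩ := P.wedge_succ ht (k := K + m) huw
      -- Both vertices are strictly leftmost as seen from `u`: one because of the wedge, the other
      -- because `u` is the image of a point of the face of `s m`.
      have h6 : s m = P.orbitVertex t (K + m) := by
        by_contra hcon
        have h7 := h4 _ hcon
        have h8 := P.cross_pointSymm_neg h2 (Ne.symm hcon)
        rw [h3, cross_swap] at h8
        linarith
      refine ⟨⟨_, h1, by rw [h6]; exact h5⟩, fun m' hm1 hm2 => ?_⟩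
      rcases hm1.eq_or_lt with rfl | hm1
      · exact h6
      · exact hcode m' hm1 hm2
  refine ⟨P.orbitVertex t K, funext fun m => ?_⟩
  rw [hvs m.castSucc, Fin.val_castSucc, (main 0 (Nat.zero_le n)).2 m (Nat.zero_le _) m.2,
    P.orbitVertex_add ht]

/-- Deleting the last letter is injective on words whose truncation is not cyclic, by
`word_eq_of_branch`. An exceptional word is given by the first letter of its cyclic part and its
last letter, whence `p * p`. -/
theorem complexity_succ_le {t : ℝ} (ht : P.orbitParam t p = t + 1) {n : ℕ} (hn : 0 < n) :
    P.complexity (n + 1) ≤ P.complexity n + p * p := by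
  let init : (Fin (n + 1) → Fin p) → Fin n → Fin p := fun w m => w m.castSucc
  let cyc : Fin p → Fin n → Fin p := fun i m => i + (m : ℕ) • (1 : Fin p)
  have h1 : P.words (n + 1) ⊆ (P.words (n + 1) ∩ {w | init w ∉ Set.range cyc}) ∪
      Set.range fun q : Fin p × Fin p => (Fin.snoc (cyc q.1) q.2 : Fin (n + 1) → Fin p) := by
    intro w hw
    by_cases h : init w ∈ Set.range cyc
    · right
      obtain ⟨i, hi⟩ := h
      refine ⟨(i, w (Fin.last n)), ?_⟩
      change Fin.snoc (cyc i) (w (Fin.last n)) = w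
      rw [hi]
      exact Fin.snoc_init_self w
    · exact Or.inl ⟨hw, h⟩
  have h2 : (P.words (n + 1) ∩ {w | init w ∉ Set.range cyc}).ncard ≤ P.complexity n := by
    refine Set.ncard_le_ncard_of_injOn init (fun w hw => P.init_mem_words hw.1) ?_
      (P.words_finite n)
    intro v hv w hw hvw
    by_contra hne
    have hinit : ∀ m : Fin n, v m.castSucc = w m.castSucc := fun m => congrFun hvw m
    have hlast : v (Fin.last n) ≠ w (Fin.last n) := by
      intro hl
      apply hne
      funext m
      induction m using Fin.lastCases with
      | last => exact hl
      | cast m => exact hinit m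
    obtain ⟨i, hi⟩ := P.word_eq_of_branch ht hn hv.1 hw.1 hinit hlast
    exact hv.2 ⟨i, hi.symm⟩
  have h3 : (Set.range fun q : Fin p × Fin p =>
      (Fin.snoc (cyc q.1) q.2 : Fin (n + 1) → Fin p)).ncard ≤ p * p := by
    rw [← Set.image_univ]
    refine (Set.ncard_image_le Set.finite_univ).trans ?_
    rw [Set.ncard_univ, Nat.card_prod, Nat.card_fin]
  calc P.complexity (n + 1) ≤ _ := Set.ncard_le_ncard h1 (Set.toFinite _)
    _ ≤ _ := Set.ncard_union_le _ _
    _ ≤ _ := Nat.add_le_add h2 h3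

theorem complexity_isBigO {t : ℝ} (ht : P.orbitParam t p = t + 1) :
    (fun n : ℕ => (P.complexity n : ℝ)) =O[atTop] fun n : ℕ => (n : ℝ) := by
  have h : ∀ n, P.complexity (n + 1) ≤ P.complexity 1 + n * (p * p) := by
    intro n
    induction n with
    | zero => simp
    | succ n ih =>
      have := P.complexity_succ_le ht (Nat.succ_pos n)
      linarith
  refine IsBigO.of_bound (P.complexity 1 + p * p : ℕ) ?_
  filter_upwards [eventually_ge_atTop 1] with n hn
  obtain ⟨m, rfl⟩ := Nat.exists_eq_add_of_le' hn
  rw [Real.norm_natCast, Real.norm_natCast]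
  have h1 := h m
  have h2 : P.complexity (m + 1) ≤ (P.complexity 1 + p * p) * (m + 1) := by nlinarith
  exact_mod_cast h2

/-- A lift of a `p`-periodic point advances by an integer in `p` steps; the rotation number
identifies this integer as one. -/
theorem IsLarge.exists_orbitParam_eq {P : KleinPolygon p} (h : P.IsLarge) :
    ∃ t, P.orbitParam t p = t + 1 := by
  obtain ⟨hrot, t, -, hper, -⟩ := h
  refine ⟨t, P.orbitParam_eq_add_one (NeZero.pos p) hrot ?_⟩
  have := Function.iterate_minimalPeriod (f := P.bdryMap) (x := circlePt t)
  rwa [hper] at this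

end KleinPolygon

end

noncomputable section

namespace KleinDisc

/-! ### Homogeneous coordinates

A point `x` of the plane has the homogeneous coordinates `(1, x)`. The geodesic symmetries are induced
by isometries of the Minkowski form. -/

/-- The Minkowski form. -/
def form (X Y : ℝ × ℂ) : ℝ := X.1 * Y.1 - dot X.2 Y.2

/-- The isometry of Minkowski space that induces the geodesic symmetry about `a`. -/
def refl (a : ℂ) : (ℝ × ℂ) →ₗ[ℝ] (ℝ × ℂ) where
  toFun X := (2 * form X (1, a) / (1 - dot a a)) • (1, a) - X
  map_add' X Y := by
    have : form (X + Y) (1, a) = form X (1, a) + form Y (1, a) := by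
      simp [form, dot]; ring
    rw [this]
    module
  map_smul' c X := by
    have : form (c • X) (1, a) = c * form X (1, a) := by
      simp [form, dot]; ring
    rw [this, RingHom.id_apply]
    module

theorem refl_apply (a : ℂ) (X : ℝ × ℂ) :
    refl a X = (2 * form X (1, a) / (1 - dot a a)) • (1, a) - X := rfl

theorem form_comm (X Y : ℝ × ℂ) : form X Y = form Y X := by
  simp [form, dot]; ring

theorem form_add_left (X Y Z : ℝ × ℂ) : form (X + Y) Z = form X Z + form Y Z := by
  simp [form, dot]; ring

theorem form_smul_left (c : ℝ) (X Y : ℝ × ℂ) : form (c • X) Y = c * form X Y := by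
  simp [form, dot]; ring

theorem form_sub_left (X Y Z : ℝ × ℂ) : form (X - Y) Z = form X Z - form Y Z := by
  simp [form, dot]; ring

theorem form_sub_right (X Y Z : ℝ × ℂ) : form X (Y - Z) = form X Y - form X Z := by
  simp [form, dot]; ring

theorem form_add_right (X Y Z : ℝ × ℂ) : form X (Y + Z) = form X Y + form X Z := by
  simp [form, dot]; ring

theorem form_smul_right (c : ℝ) (X Y : ℝ × ℂ) : form X (c • Y) = c * form X Y := by
  simp [form, dot]; ring

theorem form_hat_self (a : ℂ) : form (1, a) (1, a) = 1 - dot a a := by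
  simp [form]

theorem form_refl {a : ℂ} (ha : dot a a < 1) (X Y : ℝ × ℂ) :
    form (refl a X) (refl a Y) = form X Y := by
  have h : 1 - dot a a ≠ 0 := by linarith
  rw [refl_apply, refl_apply, form_sub_left, form_sub_right, form_sub_right, form_smul_left,
    form_smul_right, form_smul_right, form_smul_left, form_hat_self, form_comm (1, a) Y]
  field_simp
  ring

theorem refl_refl {a : ℂ} (ha : dot a a < 1) (X : ℝ × ℂ) : refl a (refl a X) = X := by
  have h : 1 - dot a a ≠ 0 := by linarith
  have e : 2 * form (refl a X) (1, a) / (1 - dot a a) = 2 * form X (1, a) / (1 - dot a a) := by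
    rw [refl_apply, form_sub_left, form_smul_left, form_hat_self]
    field_simp
    ring
  rw [refl_apply a (refl a X), e, refl_apply]
  abel

/-- The scale is the point of the linear model: at infinity it is the inverse of the derivative of
the symmetry. A boundary point fixed by a product of symmetries thus becomes a null eigenvector
whose eigenvalue is the inverse of the multiplier. -/
theorem refl_hat {a x : ℂ} (ha : dot a a < 1) (hx : dot x x ≤ 1) :
    refl a (1, x) = (symmFactor a x)⁻¹ • ((1 : ℝ), pointSymm a x) := by
  have h : 1 - dot a a ≠ 0 := by linarith
  have h1 := (denom_pos ha hx).ne'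
  have hf : form (1, x) (1, a) = 1 - dot x a := by simp [form]
  rw [refl_apply, hf, symmFactor, inv_div]
  refine Prod.ext ?_ ?_
  · simp only [Prod.fst_sub, Prod.smul_fst, smul_eq_mul]
    field_simp
    ring
  · apply Complex.ext
    · simp only [Prod.snd_sub, Prod.smul_snd, Complex.sub_re, Complex.smul_re, smul_eq_mul,
        pointSymm_re]
      field_simp
    · simp only [Prod.snd_sub, Prod.smul_snd, Complex.sub_im, Complex.smul_im, smul_eq_mul,
        pointSymm_im]
      field_simp

/-- The cone of the positive multiples of the homogeneous coordinates of points of the disc. -/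
def cone : Set (ℝ × ℂ) := {X | 0 < X.1 ∧ 0 < form X X}

/-- The point of the plane with given homogeneous coordinates. -/
def proj (X : ℝ × ℂ) : ℂ := X.1⁻¹ • X.2

theorem smul_hat_proj {X : ℝ × ℂ} (hX : X ∈ cone) : X.1 • ((1 : ℝ), proj X) = X := by
  refine Prod.ext ?_ ?_
  · simp
  · simp only [Prod.smul_mk, proj, smul_smul, mul_inv_cancel₀ hX.1.ne', one_smul]

theorem proj_smul_hat {c : ℝ} (hc : 0 < c) (x : ℂ) : proj (c • ((1 : ℝ), x)) = x := by
  simp only [proj, Prod.smul_mk, smul_eq_mul, mul_one, smul_smul, inv_mul_cancel₀ hc.ne', one_smul]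

theorem smul_hat_mem_cone {c : ℝ} (hc : 0 < c) {x : ℂ} (hx : dot x x < 1) :
    c • ((1 : ℝ), x) ∈ cone := by
  refine ⟨by simpa using hc, ?_⟩
  rw [form_smul_left, form_smul_right, form_hat_self]
  have : 0 < 1 - dot x x := by linarith
  positivity

theorem dot_proj_lt_one {X : ℝ × ℂ} (hX : X ∈ cone) : dot (proj X) (proj X) < 1 := by
  have h := hX.2
  rw [← smul_hat_proj hX, form_smul_left, form_smul_right, form_hat_self] at h
  have h1 := pos_of_mul_pos_right (pos_of_mul_pos_right h hX.1.le) hX.1.le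
  linarith

theorem refl_smul_hat {a x : ℂ} (ha : dot a a < 1) (hx : dot x x ≤ 1) (c : ℝ) :
    refl a (c • ((1 : ℝ), x)) = (c * (symmFactor a x)⁻¹) • ((1 : ℝ), pointSymm a x) := by
  rw [map_smul, refl_hat ha hx, smul_smul]

theorem refl_mem_cone {a : ℂ} (ha : dot a a < 1) {X : ℝ × ℂ} (hX : X ∈ cone) :
    refl a X ∈ cone := by
  have hx := dot_proj_lt_one hX
  rw [← smul_hat_proj hX, refl_smul_hat ha hx.le]
  exact smul_hat_mem_cone (mul_pos hX.1 (inv_pos.2 (symmFactor_pos ha hx.le)))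
    (dot_pointSymm_lt_one ha hx)

theorem proj_refl {a : ℂ} (ha : dot a a < 1) {X : ℝ × ℂ} (hX : X ∈ cone) :
    proj (refl a X) = pointSymm a (proj X) := by
  have hx := dot_proj_lt_one hX
  conv_lhs => rw [← smul_hat_proj hX]
  rw [refl_smul_hat ha hx.le, proj_smul_hat (mul_pos hX.1 (inv_pos.2 (symmFactor_pos ha hx.le)))]

theorem isOpen_cone : IsOpen cone := by
  have h : Continuous fun X : ℝ × ℂ => form X X := by
    unfold form dot
    fun_prop
  have e : cone = {X : ℝ × ℂ | 0 < X.1} ∩ {X | 0 < form X X} := rfl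
  rw [e]
  exact (isOpen_lt continuous_const continuous_fst).inter (isOpen_lt continuous_const h)

theorem continuous_of_linear {F : Type*} [AddCommGroup F] [Module ℝ F] [TopologicalSpace F]
    [IsTopologicalAddGroup F] [ContinuousSMul ℝ F] (f : (ℝ × ℂ) →ₗ[ℝ] F) : Continuous f :=
  f.continuous_of_finiteDimensional

theorem dense_ne_zero {f : (ℝ × ℂ) →ₗ[ℝ] ℝ} (hf : f ≠ 0) : Dense {X | f X ≠ 0} := by
  have h1 : interior ((LinearMap.ker f : Submodule ℝ (ℝ × ℂ)) : Set (ℝ × ℂ)) = ∅ := by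
    by_contra h
    exact hf (LinearMap.ker_eq_top.1
      (Submodule.eq_top_of_nonempty_interior' _ (Set.nonempty_iff_ne_empty.2 h)))
  rw [interior_eq_empty_iff_dense_compl] at h1
  exact h1

end KleinDisc

/-! ### Products of symmetries, generic points and their codes -/

namespace KleinPolygon

variable {p : ℕ} [NeZero p] (P : KleinPolygon p)

/-- The homogeneous linear functional that is `cross (vertex i - x) (vertex l - x)` at the point with
the coordinates `(1, x)`. -/
def side (i l : Fin p) : (ℝ × ℂ) →ₗ[ℝ] ℝ where
  toFun X := X.1 * cross (P.vertex i) (P.vertex l) - cross X.2 (P.vertex l) - cross (P.vertex i) X.2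
  map_add' X Y := by simp [cross]; ring
  map_smul' c X := by simp [cross]; ring

theorem side_apply (i l : Fin p) (X : ℝ × ℂ) : P.side i l X =
    X.1 * cross (P.vertex i) (P.vertex l) - cross X.2 (P.vertex l) - cross (P.vertex i) X.2 := rfl

theorem side_hat (i l : Fin p) (x : ℂ) :
    P.side i l (1, x) = cross (P.vertex i - x) (P.vertex l - x) := by
  simp [side_apply, cross]; ring

theorem side_swap (i l : Fin p) (X : ℝ × ℂ) : P.side l i X = -P.side i l X := by
  simp [side_apply, cross]; ring

theorem side_eq_proj {X : ℝ × ℂ} (hX : X ∈ cone) (i l : Fin p) :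
    P.side i l X = X.1 * cross (P.vertex i - proj X) (P.vertex l - proj X) := by
  conv_lhs => rw [← smul_hat_proj hX]
  rw [map_smul, side_hat, smul_eq_mul]

theorem side_ne_zero {i l : Fin p} (h : i ≠ l) : P.side i l ≠ 0 := by
  intro h0
  have hne : P.vertex l - P.vertex i ≠ 0 := sub_ne_zero.2 fun h1 => h (P.vertex_injective h1).symm
  have h1 : P.side i l (0, Complex.I * (P.vertex l - P.vertex i)) = 0 := by rw [h0]; rfl
  have h2 : P.side i l (0, Complex.I * (P.vertex l - P.vertex i)) =
      dot (P.vertex l - P.vertex i) (P.vertex l - P.vertex i) := by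
    simp [side_apply, cross, dot]; ring
  rw [h1, dot_self_eq, eq_comm, sq_eq_zero_iff, norm_eq_zero] at h2
  exact hne h2

theorem side_refl (i l : Fin p) (X : ℝ × ℂ) : P.side i l (refl (P.vertex i) X) = -P.side i l X := by
  rw [refl_apply, map_sub, map_smul, side_hat, sub_self]
  simp [cross]

/-- The composition of the symmetries about the first `k` vertices of a sequence. -/
def reflWord (s : ℕ → Fin p) : ℕ → (ℝ × ℂ) →ₗ[ℝ] (ℝ × ℂ)
  | 0 => LinearMap.id
  | k + 1 => refl (P.vertex (s k)) ∘ₗ reflWord s k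

theorem reflWord_zero (s : ℕ → Fin p) (X : ℝ × ℂ) : P.reflWord s 0 X = X := rfl

theorem reflWord_succ (s : ℕ → Fin p) (k : ℕ) (X : ℝ × ℂ) :
    P.reflWord s (k + 1) X = refl (P.vertex (s k)) (P.reflWord s k X) := rfl

theorem reflWord_add (s : ℕ → Fin p) (k j : ℕ) (X : ℝ × ℂ) :
    P.reflWord (fun m => s (m + j)) k (P.reflWord s j X) = P.reflWord s (k + j) X := by
  induction k with
  | zero => rw [reflWord_zero, zero_add]
  | succ k ih => rw [reflWord_succ, ih, add_right_comm, reflWord_succ]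

theorem reflWord_congr {s s' : ℕ → Fin p} {k : ℕ} (h : ∀ m, m < k → s m = s' m) :
    P.reflWord s k = P.reflWord s' k := by
  induction k with
  | zero => rfl
  | succ k ih =>
    rw [reflWord, ih fun m hm => h m (hm.trans (Nat.lt_succ_self k)), h k (Nat.lt_succ_self k)]
    rfl

theorem reflWord_mem_cone (s : ℕ → Fin p) (k : ℕ) {X : ℝ × ℂ} (hX : X ∈ cone) :
    P.reflWord s k X ∈ cone := by
  induction k with
  | zero => exact hX
  | succ k ih => exact refl_mem_cone (P.dot_vertex_lt_one _) ih

theorem mem_cone_of_reflWord {s : ℕ → Fin p} {k : ℕ} {X : ℝ × ℂ}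
    (hX : P.reflWord s k X ∈ cone) : X ∈ cone := by
  induction k with
  | zero => exact hX
  | succ k ih =>
    refine ih ?_
    rw [← refl_refl (P.dot_vertex_lt_one (s k)) (P.reflWord s k X)]
    exact refl_mem_cone (P.dot_vertex_lt_one _) hX

theorem form_reflWord (s : ℕ → Fin p) (k : ℕ) (X Y : ℝ × ℂ) :
    form (P.reflWord s k X) (P.reflWord s k Y) = form X Y := by
  induction k with
  | zero => rfl
  | succ k ih => rw [reflWord_succ, reflWord_succ, form_refl (P.dot_vertex_lt_one _), ih]

theorem reflWord_injective (s : ℕ → Fin p) (k : ℕ) : Function.Injective (P.reflWord s k) := by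
  induction k with
  | zero => exact fun _ _ h => h
  | succ k ih =>
    exact (Function.LeftInverse.injective (refl_refl (P.dot_vertex_lt_one (s k)))).comp ih

theorem reflWord_surjective (s : ℕ → Fin p) (k : ℕ) : Function.Surjective (P.reflWord s k) :=
  LinearMap.injective_iff_surjective.1 (P.reflWord_injective s k)

/-- A point is generic if no sequence of symmetries moves it onto a line through two vertices. -/
def IsGeneric (X : ℝ × ℂ) : Prop :=
  ∀ (w : List (Fin p)) (i l : Fin p), i ≠ l →
    P.side i l (w.foldl (fun Y j => refl (P.vertex j) Y) X) ≠ 0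

variable {P} in
theorem IsGeneric.side_ne_zero {X : ℝ × ℂ} (hX : P.IsGeneric X) {i l : Fin p} (h : i ≠ l) :
    P.side i l X ≠ 0 := hX [] i l h

variable {P} in
theorem IsGeneric.refl {X : ℝ × ℂ} (hX : P.IsGeneric X) (j : Fin p) :
    P.IsGeneric (refl (P.vertex j) X) := fun w => hX (j :: w)

variable {P} in
theorem IsGeneric.reflWord {X : ℝ × ℂ} (hX : P.IsGeneric X) (s : ℕ → Fin p) (k : ℕ) :
    P.IsGeneric (P.reflWord s k X) := by
  induction k with
  | zero => exact hX
  | succ k ih => exact ih.refl _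

theorem isGeneric_of_reflWord {s : ℕ → Fin p} {k : ℕ} {X : ℝ × ℂ}
    (hX : P.IsGeneric (P.reflWord s k X)) : P.IsGeneric X := by
  induction k with
  | zero => exact hX
  | succ k ih =>
    refine ih ?_
    rw [← refl_refl (P.dot_vertex_lt_one (s k)) (P.reflWord s k X)]
    exact hX.refl _

theorem exists_foldl_eq (w : List (Fin p)) :
    ∃ f : (ℝ × ℂ) →ₗ[ℝ] (ℝ × ℂ), Function.Surjective f ∧
      ∀ X, f X = w.foldl (fun Y j => refl (P.vertex j) Y) X := by
  induction w with
  | nil => exact ⟨LinearMap.id, fun X => ⟨X, rfl⟩, fun _ => rfl⟩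
  | cons j w ih =>
    obtain ⟨f, hf, h⟩ := ih
    refine ⟨f ∘ₗ refl (P.vertex j), ?_, fun X => h _⟩
    exact hf.comp (Function.RightInverse.surjective (refl_refl (P.dot_vertex_lt_one j)))

/-- Only countably many kernels of nonzero linear functionals are removed, so the Baire category
theorem applies. -/
theorem dense_isGeneric : Dense {X | P.IsGeneric X} := by
  have e : {X | P.IsGeneric X} = ⋂ q : List (Fin p) × {q : Fin p × Fin p // q.1 ≠ q.2},
      {X | P.side q.2.1.1 q.2.1.2 (q.1.foldl (fun Y j => KleinDisc.refl (P.vertex j) Y) X) ≠ 0} := by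
    ext X
    simp only [Set.mem_iInter, Set.mem_ofPred_eq]
    exact ⟨fun h q => h q.1 _ _ q.2.2, fun h w i l hil => h (w, ⟨(i, l), hil⟩)⟩
  have key : ∀ q : List (Fin p) × {q : Fin p × Fin p // q.1 ≠ q.2},
      ∃ f : (ℝ × ℂ) →ₗ[ℝ] ℝ, f ≠ 0 ∧ ∀ X, f X =
        P.side q.2.1.1 q.2.1.2 (q.1.foldl (fun Y j => KleinDisc.refl (P.vertex j) Y) X) := by
    intro q
    obtain ⟨f, hf, h⟩ := P.exists_foldl_eq q.1
    refine ⟨P.side q.2.1.1 q.2.1.2 ∘ₗ f, fun h0 => P.side_ne_zero q.2.2 ?_, fun X => ?_⟩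
    · ext1 <;> ext1 <;>
      · obtain ⟨X, hX⟩ := hf _
        have := LinearMap.congr_fun h0 X
        rw [LinearMap.comp_apply, hX] at this
        exact this
    · rw [LinearMap.comp_apply, h]
  rw [e]
  choose f hf h using key
  simp only [← h]
  exact dense_iInter_of_isOpen
    (fun q => isOpen_ne_fun (continuous_of_linear (f q)) continuous_const)
    fun q => dense_ne_zero (hf q)

theorem exists_isGeneric {U : Set (ℝ × ℂ)} (hU : IsOpen U) (hne : U.Nonempty) :
    ∃ X ∈ U, P.IsGeneric X := by
  obtain ⟨X, hX⟩ := P.dense_isGeneric.inter_open_nonempty U hU hne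
  exact ⟨X, hX⟩

/-- The point with homogeneous coordinates `X` has the code `s`. -/
def HasCode (X : ℝ × ℂ) (s : ℕ → Fin p) : Prop :=
  ∀ k l, l ≠ s k → 0 < P.side (s k) l (P.reflWord s k X)

variable {P} in
theorem HasCode.isRegularOrbit {X : ℝ × ℂ} {s : ℕ → Fin p} (hX : X ∈ cone) (h : P.HasCode X s) :
    P.IsRegularOrbit (fun k => proj (P.reflWord s k X)) s := by
  intro k
  have hk := P.reflWord_mem_cone s k hX
  refine ⟨P.mem_face_iff.2 ⟨dot_proj_lt_one hk, fun l hl => ?_⟩, ?_⟩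
  · have := h k l hl
    rw [P.side_eq_proj hk] at this
    exact pos_of_mul_pos_right this hk.1.le
  · exact proj_refl (P.dot_vertex_lt_one _) hk

variable {P} in
-- At the first disagreement each of the two vertices would be strictly to the left of the other,
-- seen from the same point. Since `h'` concerns only times before `n`, this recognizes a prefix of
-- a code from finitely many inequalities.
theorem HasCode.eq_of_side_pos {X : ℝ × ℂ} {s s' : ℕ → Fin p} (h : P.HasCode X s) {n : ℕ}
    (h' : ∀ k, k < n → ∀ l, l ≠ s' k → 0 < P.side (s' k) l (P.reflWord s' k X)) (k : ℕ)
    (hk : k < n) : s k = s' k := by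
  induction k using Nat.strong_induction_on with
  | _ k ih =>
    by_contra hne
    have h1 := h k _ (Ne.symm hne)
    have h2 := h' k hk _ hne
    rw [← P.reflWord_congr fun m hm => ih m hm (hm.trans hk), side_swap] at h2
    linarith

variable {P} in
theorem HasCode.shift {X : ℝ × ℂ} {s : ℕ → Fin p} (h : P.HasCode X s) (j : ℕ) :
    P.HasCode (P.reflWord s j X) fun k => s (k + j) := by
  intro k l hl
  rw [reflWord_add]
  exact h (k + j) l hl

/-- A generic point outside the polygon lies in an open face, and its image is again generic and
outside the polygon. So the orbit never meets a singular ray. -/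
theorem exists_hasCode {X : ℝ × ℂ} (hX : X ∈ cone) (hgen : P.IsGeneric X)
    (hreg : proj X ∉ P.region) : ∃ s, P.HasCode X s := by
  let G := {X : ℝ × ℂ // X ∈ cone ∧ P.IsGeneric X ∧ proj X ∉ P.region}
  have hface : ∀ X : G, ∃ i, ∀ l, l ≠ i → 0 < P.side i l X.1 := by
    rintro ⟨X, hX, hgen, hreg⟩
    obtain ⟨i, hi⟩ := P.exists_rightmost hreg
    refine ⟨i, fun l hl => lt_of_le_of_ne ?_ (hgen.side_ne_zero (Ne.symm hl)).symm⟩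
    rw [P.side_eq_proj hX]
    exact mul_nonneg hX.1.le (hi l)
  choose f hf using hface
  have hstep : ∀ X : G, ∃ Y : G, Y.1 = KleinDisc.refl (P.vertex (f X)) X.1 := by
    intro X
    obtain ⟨X', hX, hgen, hreg⟩ := id X
    have ha := P.dot_vertex_lt_one (f X)
    refine ⟨⟨_, refl_mem_cone ha X.2.1, X.2.2.1.refl _, ?_⟩, rfl⟩
    rw [proj_refl ha X.2.1]
    refine (P.pointSymm_mem_phaseSpace (P.mem_face_iff.2
      ⟨dot_proj_lt_one X.2.1, fun l hl => ?_⟩)).2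
    have := hf X l hl
    rw [P.side_eq_proj X.2.1] at this
    exact pos_of_mul_pos_right this X.2.1.1.le
  choose g hg using hstep
  have hiter : ∀ k, P.reflWord (fun k => f (g^[k] ⟨X, hX, hgen, hreg⟩)) k X =
      (g^[k] ⟨X, hX, hgen, hreg⟩).1 := by
    intro k
    induction k with
    | zero => rfl
    | succ k ih => rw [reflWord_succ, ih, Function.iterate_succ_apply', hg]
  refine ⟨fun k => f (g^[k] ⟨X, hX, hgen, hreg⟩), fun k l hl => ?_⟩
  rw [hiter]
  exact hf _ l hl

variable {P} in
theorem HasCode.proj_notMem_region {X : ℝ × ℂ} {s : ℕ → Fin p} (hX : X ∈ cone)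
    (h : P.HasCode X s) : proj X ∉ P.region :=
  (h.isRegularOrbit hX 0).1.1.2

/-- A positive side condition at one vertex guarantees a code. -/
theorem exists_hasCode_of_side_pos {X : ℝ × ℂ} (hX : X ∈ cone) (hgen : P.IsGeneric X) {i : Fin p}
    (h : ∀ l, l ≠ i → 0 < P.side i l X) : ∃ s, P.HasCode X s := by
  refine P.exists_hasCode hX hgen (P.notMem_region_of_extreme 1 (i := i) fun l hl => ?_)
  have := h l hl
  rw [P.side_eq_proj hX] at this
  rw [one_mul]
  exact pos_of_mul_pos_right this hX.1.le

/-- A generic point with a code has a preimage. -/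
theorem exists_preimage {X : ℝ × ℂ} {s : ℕ → Fin p} (hX : X ∈ cone) (hgen : P.IsGeneric X)
    (h : P.HasCode X s) : ∃ Y s', Y ∈ cone ∧ P.IsGeneric Y ∧ P.HasCode Y s' ∧
      (∀ k, s' (k + 1) = s k) ∧ P.reflWord s' 1 Y = X := by
  -- The symmetry about the leftmost vertex inverts the billiard map.
  obtain ⟨i, hi⟩ := P.exists_leftmost (h.proj_notMem_region hX)
  have hneg : ∀ l, l ≠ i → P.side i l X < 0 := by
    intro l hl
    refine lt_of_le_of_ne ?_ (hgen.side_ne_zero (Ne.symm hl))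
    rw [P.side_eq_proj hX]
    exact mul_nonpos_of_nonneg_of_nonpos hX.1.le (hi l)
  have ha := P.dot_vertex_lt_one i
  let s' : ℕ → Fin p := fun k => Nat.casesOn k i s
  have h1 : P.reflWord s' 1 (KleinDisc.refl (P.vertex i) X) = X := refl_refl ha X
  refine ⟨KleinDisc.refl (P.vertex i) X, s', refl_mem_cone ha hX, hgen.refl i, ?_, fun _ => rfl, h1⟩
  intro k l hl
  cases k with
  | zero =>
    have := hneg l hl
    change 0 < P.side i l (KleinDisc.refl (P.vertex i) X)
    rw [side_refl]
    linarith
  | succ k =>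
    rw [← reflWord_add, h1]
    exact h k l hl

end KleinPolygon

end

noncomputable section

namespace KleinDisc

open Topology

/-! ### Cells that are invariant under a hyperbolic isometry -/

/-- The dominant term decides the sign: `A` after division by `r ^ k`, and `C` if `A` vanishes.
Infinitely many `k` suffice, which is all that a pigeonhole choice among finitely many sides
provides. -/
theorem nonneg_of_frequently_geometric {r A B C : ℝ} (hr : 1 < r)
    (h : ∃ᶠ k : ℕ in atTop, 0 ≤ r ^ k * A + (r⁻¹) ^ k * B + C) : 0 ≤ A ∧ (A = 0 → 0 ≤ C) := by
  have h0 : 0 < r := by linarith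
  have hlim : Tendsto (fun k : ℕ => (r⁻¹) ^ k) atTop (𝓝 0) :=
    tendsto_pow_atTop_nhds_zero_of_lt_one (inv_nonneg.2 h0.le) (inv_lt_one_of_one_lt₀ hr)
  constructor
  · have h1 : Tendsto (fun k : ℕ => A + (r⁻¹) ^ k * ((r⁻¹) ^ k * B + C)) atTop (𝓝 A) := by
      have := (hlim.mul ((hlim.mul_const B).add_const C)).const_add A
      simpa using this
    refine ge_of_tendsto_of_frequently h1 (h.mono fun k hk => ?_)
    have e : A + (r⁻¹) ^ k * ((r⁻¹) ^ k * B + C) =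
        (r⁻¹) ^ k * (r ^ k * A + (r⁻¹) ^ k * B + C) := by
      have : (r⁻¹) ^ k * r ^ k = 1 := by rw [← mul_pow, inv_mul_cancel₀ h0.ne', one_pow]
      linear_combination -A * this
    rw [e]
    exact mul_nonneg (pow_nonneg (inv_nonneg.2 h0.le) k) hk
  · rintro rfl
    have h1 : Tendsto (fun k : ℕ => (r⁻¹) ^ k * B + C) atTop (𝓝 C) := by
      simpa using (hlim.mul_const B).add_const C
    refine ge_of_tendsto_of_frequently h1 (h.mono fun k hk => ?_)
    simpa using hk

/-- A null vector with positive time coordinate is in the closure of the cone. -/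
theorem form_pos_of_null {X Q : ℝ × ℂ} (hX : X ∈ cone) (hQ : form Q Q = 0) (hQ1 : 0 < Q.1) :
    0 < form X Q := by
  obtain ⟨hX1, hX2⟩ := hX
  unfold form at *
  have h1 : dot X.2 Q.2 ^ 2 ≤ dot X.2 X.2 * dot Q.2 Q.2 := by
    unfold dot
    nlinarith [sq_nonneg (X.2.re * Q.2.im - X.2.im * Q.2.re)]
  have h3 : dot Q.2 Q.2 = Q.1 * Q.1 := by linarith
  have h2 : dot X.2 Q.2 ^ 2 < (X.1 * Q.1) ^ 2 := by
    rw [h3] at h1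
    nlinarith [mul_pos hQ1 hQ1]
  have h4 := abs_lt_of_sq_lt_sq h2 (mul_pos hX1 hQ1).le
  linarith [(abs_lt.1 h4).2]

/-- Otherwise the negative of `X` would be in the cone, and would pair positively with `Q`. -/
theorem mem_cone_of_form_pos {X Q : ℝ × ℂ} (hQ : form Q Q = 0) (hQ1 : 0 < Q.1)
    (h1 : 0 < form X X) (h2 : 0 < form X Q) : X ∈ cone := by
  refine ⟨?_, h1⟩
  by_contra! hneg
  have h3 : X.1 ≠ 0 := by
    intro h0
    unfold form at h1
    rw [h0] at h1
    have := dot_self_nonneg X.2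
    linarith
  have h4 : (-1 : ℝ) • X ∈ cone := by
    refine ⟨?_, ?_⟩
    · simp only [Prod.smul_fst, smul_eq_mul]
      have := lt_of_le_of_ne hneg h3
      linarith
    · rw [form_smul_left, form_smul_right]; linarith
  have h5 := form_pos_of_null h4 hQ hQ1
  rw [form_smul_left] at h5
  linarith

/-- Two null vectors are completed to a basis of Minkowski space by a unit vector. -/
theorem exists_null_decomposition {Q R : ℝ × ℂ} (hQ : form Q Q = 0) (hR : form R R = 0)
    (hQR : form Q R = 1) : ∃ N : ℝ × ℂ, form N Q = 0 ∧ form N R = 0 ∧ form N N = -1 ∧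
      ∀ X, X = form X R • Q + form X Q • R - form X N • N := by
  -- The Minkowski cross product of `Q` and `R`; up to sign, its norm is minus their Gram
  -- determinant.
  let N : ℝ × ℂ := (Q.2.re * R.2.im - Q.2.im * R.2.re,
    ⟨-(Q.2.im * R.1 - Q.1 * R.2.im), -(Q.1 * R.2.re - Q.2.re * R.1)⟩)
  have hNQ : form N Q = 0 := by simp only [N, form, dot]; ring
  have hNR : form N R = 0 := by simp only [N, form, dot]; ring
  have hNN : form N N = -1 := by
    have e : form N N = form Q Q * form R R - form Q R ^ 2 := by simp only [N, form, dot]; ring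
    rw [e, hQ, hR, hQR]; norm_num
  refine ⟨N, hNQ, hNR, hNN, fun X => ?_⟩
  obtain ⟨a, b, c, h⟩ : ∃ a b c : ℝ, X = a • Q + b • R + c • N := by
    let D : (ℝ × ℂ) → (ℝ × ℂ) → (ℝ × ℂ) → ℝ := fun U V W =>
      U.1 * (V.2.re * W.2.im - V.2.im * W.2.re) - U.2.re * (V.1 * W.2.im - V.2.im * W.1) +
        U.2.im * (V.1 * W.2.re - V.2.re * W.1)
    have hD : D Q R N = -1 := by
      rw [← hNN]; simp only [D, N, form, dot]; ring
    have hcramer : D Q R N • X = D X R N • Q + D Q X N • R + D Q R X • N := by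
      generalize N = N'
      refine Prod.ext ?_ (Complex.ext ?_ ?_)
      · simp [D]; ring
      · simp [D]; ring
      · simp [D]; ring
    refine ⟨-D X R N, -D Q X N, -D Q R X, ?_⟩
    rw [hD] at hcramer
    calc X = -((-1 : ℝ) • X) := by module
      _ = _ := by rw [hcramer]; module
  have hRQ : form R Q = 1 := by rw [form_comm, hQR]
  have hQN : form Q N = 0 := by rw [form_comm, hNQ]
  have hRN : form R N = 0 := by rw [form_comm, hNR]
  have e1 : form X R = a := by
    rw [h]; simp only [form_add_left, form_smul_left, hQR, hR, hNR]; ring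
  have e2 : form X Q = b := by
    rw [h]; simp only [form_add_left, form_smul_left, hRQ, hQ, hNQ]; ring
  have e3 : form X N = -c := by
    rw [h]; simp only [form_add_left, form_smul_left, hQN, hRN, hNN]; ring
  rw [e1, e2, e3]
  conv_lhs => rw [h]
  module

/-- The combination `R.1 • Q - Q.1 • R` is orthogonal to itself and has no time component, and the
form is definite on such vectors. -/
theorem eq_smul_of_null {Q R : ℝ × ℂ} (hQ : form Q Q = 0) (hR : form R R = 0) (hQR : form Q R = 0)
    (hQ1 : Q.1 ≠ 0) : R = (R.1 / Q.1) • Q := by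
  unfold form at *
  have h : dot (R.1 • Q.2 - Q.1 • R.2) (R.1 • Q.2 - Q.1 • R.2) = 0 := by
    have e : dot (R.1 • Q.2 - Q.1 • R.2) (R.1 • Q.2 - Q.1 • R.2) =
        R.1 ^ 2 * dot Q.2 Q.2 - 2 * R.1 * Q.1 * dot Q.2 R.2 + Q.1 ^ 2 * dot R.2 R.2 := by
      simp [dot]; ring
    rw [e]
    linear_combination -R.1 ^ 2 * hQ - Q.1 ^ 2 * hR + 2 * R.1 * Q.1 * hQR
  rw [dot_self_eq, sq_eq_zero_iff, norm_eq_zero, sub_eq_zero] at h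
  refine Prod.ext ?_ ?_
  · simp [hQ1]
  · rw [Prod.smul_snd, div_eq_inv_mul, mul_smul, h, smul_smul, inv_mul_cancel₀ hQ1, one_smul]

/-- An isometry with a null eigenvector for an eigenvalue of modulus different from `1` has a second
null eigenvector. -/
theorem exists_second_null {g : (ℝ × ℂ) →ₗ[ℝ] (ℝ × ℂ)}
    (hform : ∀ X Y, form (g X) (g Y) = form X Y) {Q : ℝ × ℂ} (hQ : form Q Q = 0) (hQ1 : 0 < Q.1)
    {c : ℝ} (hc : 1 < c) (hgQ : g Q = c • Q) :
    ∃ R, form R R = 0 ∧ form Q R = 1 ∧ g R = c⁻¹ • R := by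
  have hc0 : c ≠ 0 := by linarith
  -- For an isometry with `g Q = c • Q`, the image of `g - c⁻¹` is orthogonal to `Q`. So this map is
  -- not onto, and in finite dimension it has a kernel, which contains the second eigenvector.
  have hns : ¬ Function.Surjective (g - c⁻¹ • (LinearMap.id : (ℝ × ℂ) →ₗ[ℝ] (ℝ × ℂ))) := by
    intro hs
    obtain ⟨X, hX⟩ := hs (1, 0)
    have h1 : form Q ((g - c⁻¹ • (LinearMap.id : (ℝ × ℂ) →ₗ[ℝ] (ℝ × ℂ))) X) = 0 := by
      have h2 := hform Q X
      rw [hgQ, form_smul_left] at h2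
      simp only [LinearMap.sub_apply, LinearMap.smul_apply, LinearMap.id_apply, form_sub_right,
        form_smul_right]
      rw [← h2]
      field_simp
      ring
    rw [hX] at h1
    simp [form, dot] at h1
    exact hQ1.ne' h1
  rw [← LinearMap.injective_iff_surjective, ← LinearMap.ker_eq_bot] at hns
  obtain ⟨R, hR, hR0⟩ := Submodule.exists_mem_ne_zero_of_ne_bot hns
  have hgR : g R = c⁻¹ • R := by
    simpa [sub_eq_zero] using hR
  have hRR : form R R = 0 := by
    have h1 := hform R R
    rw [hgR, form_smul_left, form_smul_right, ← mul_assoc] at h1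
    have h2 : c⁻¹ * c⁻¹ < 1 := by
      have := inv_lt_one_of_one_lt₀ hc
      have : 0 < c⁻¹ := inv_pos.2 (by linarith)
      nlinarith
    have h3 : (1 - c⁻¹ * c⁻¹) * form R R = 0 := by linarith
    rcases mul_eq_zero.1 h3 with h | h
    · linarith
    · exact h
  have hQR : form Q R ≠ 0 := by
    intro h0
    have h1 := eq_smul_of_null hQ hRR h0 hQ1.ne'
    have h2 : g R = c • R := by
      rw [h1, map_smul, hgQ, smul_comm]
    rw [hgR, ← sub_eq_zero, ← sub_smul, smul_eq_zero] at h2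
    rcases h2 with h2 | h2
    · have : c⁻¹ < 1 := inv_lt_one_of_one_lt₀ hc
      linarith
    · exact hR0 h2
  refine ⟨(form Q R)⁻¹ • R, ?_, ?_, ?_⟩
  · rw [form_smul_left, form_smul_right, hRR]; ring
  · rw [form_smul_right, inv_mul_cancel₀ hQR]
  · rw [map_smul, hgR, smul_comm]

/-- If a polygonal cell is invariant under a hyperbolic isometry, then, up to a set with dense
complement, it is a half-plane bounded by a line that is one of its sides. -/
theorem exists_side_of_invariant {J : Type*} [Finite J] (U : J → (ℝ × ℂ) →ₗ[ℝ] ℝ)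
    {G : Set (ℝ × ℂ)} (hG : Dense G) {g : (ℝ × ℂ) →ₗ[ℝ] (ℝ × ℂ)}
    (hform : ∀ X Y, form (g X) (g Y) = form X Y) (hcone : ∀ X ∈ cone, g X ∈ cone)
    (hgG : ∀ X ∈ G, g X ∈ G)
    (hinv : ∀ X ∈ cone, X ∈ G → ((∀ j, 0 < U j (g X)) ↔ ∀ j, 0 < U j X))
    {Q : ℝ × ℂ} (hQ : form Q Q = 0) (hQ1 : 0 < Q.1) {c : ℝ} (hc : 1 < c) (hgQ : g Q = c • Q)
    (hin : ∃ X ∈ cone, ∀ j, 0 < U j X) (hout : ∃ X ∈ cone, ∃ j, U j X < 0) :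
    ∃ j, ∀ X ∈ cone, X ∈ G → 0 < U j X → ∀ i, 0 < U i X := by
  obtain ⟨R, hR, hQR, hgR⟩ := exists_second_null hform hQ hQ1 hc hgQ
  obtain ⟨N, hNQ, hNR, hNN, hdec⟩ := exists_null_decomposition hQ hR hQR
  have hRQ : form R Q = 1 := by rw [form_comm, hQR]
  have hc0 : c ≠ 0 := by linarith
  -- The orthogonal complement of `Q` and `R` is an invariant line, so `N` is an eigenvector for an
  -- eigenvalue `±1`. Iterating `g ∘ₗ g` removes the sign.
  obtain ⟨m, hm, hgN⟩ : ∃ m : ℝ, m * m = 1 ∧ g N = m • N := by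
    have h1 : form (g N) Q = 0 := by
      have := hform N Q
      rw [hgQ, form_smul_right, hNQ] at this
      exact (mul_eq_zero.1 this).resolve_left hc0
    have h2 : form (g N) R = 0 := by
      have := hform N R
      rw [hgR, form_smul_right, hNR] at this
      exact (mul_eq_zero.1 this).resolve_left (inv_ne_zero hc0)
    have h3 : g N = (-form (g N) N) • N := by
      conv_lhs => rw [hdec (g N), h1, h2]
      module
    refine ⟨_, ?_, h3⟩
    have h4 := hform N N
    rw [h3, form_smul_left, form_smul_right, hNN] at h4
    linarith
  have hiter : ∀ (k : ℕ) (X : ℝ × ℂ), (g ∘ₗ g)^[k] X =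
      ((c * c) ^ k * form X R) • Q + (((c * c)⁻¹) ^ k * form X Q) • R - form X N • N := by
    intro k X
    induction k with
    | zero => simpa using hdec X
    | succ k ih =>
      rw [Function.iterate_succ_apply', ih]
      simp only [LinearMap.comp_apply, map_add, map_sub, map_smul, hgQ, hgR, hgN, smul_smul]
      rw [mul_assoc, hm, mul_one]
      congr 3
      · ring
      · rw [pow_succ, mul_inv]; ring
  have hU : ∀ (j : J) (k : ℕ) (X : ℝ × ℂ), U j ((g ∘ₗ g)^[k] X) =
      (c * c) ^ k * (form X R * U j Q) + ((c * c)⁻¹) ^ k * (form X Q * U j R) +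
        -(form X N * U j N) := by
    intro j k X
    rw [hiter]
    simp only [map_add, map_sub, map_smul, smul_eq_mul]
    ring
  have hcc : 1 < c * c := by nlinarith
  have hpres : ∀ X ∈ cone, X ∈ G → ∀ k : ℕ, (g ∘ₗ g)^[k] X ∈ cone ∧ (g ∘ₗ g)^[k] X ∈ G ∧
      ((∀ j, 0 < U j ((g ∘ₗ g)^[k] X)) ↔ ∀ j, 0 < U j X) := by
    intro X hX hXG k
    induction k with
    | zero => exact ⟨hX, hXG, Iff.rfl⟩
    | succ k ih =>
      obtain ⟨h1, h2, h3⟩ := ih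
      rw [Function.iterate_succ_apply', LinearMap.comp_apply]
      exact ⟨hcone _ (hcone _ h1), hgG _ (hgG _ h2),
        (hinv _ (hcone _ h1) (hgG _ h2)).trans ((hinv _ h1 h2).trans h3)⟩
  have hpos : ∀ X ∈ cone, 0 < form X Q ∧ 0 < form X R := by
    intro X hX
    have h1 := form_pos_of_null hX hQ hQ1
    refine ⟨h1, ?_⟩
    have h2 := hX.2
    have h3 : form X X = 2 * form X R * form X Q - form X N ^ 2 := by
      conv_lhs => rw [hdec X]
      rw [form_sub_left, form_add_left, form_smul_left, form_smul_left, form_smul_left]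
      simp only [form_sub_right, form_add_right, form_smul_right, hQ, hR, hQR, hRQ, hNN, hNQ, hNR,
        form_comm Q N, form_comm R N]
      ring
    rw [h3] at h2
    have h4 : 0 < form X R * form X Q := by nlinarith [sq_nonneg (form X N)]
    exact pos_of_mul_pos_left h4 h1.le
  have hUc : ∀ j, Continuous (U j) := fun j => continuous_of_linear (U j)
  have hNc : Continuous fun X : ℝ × ℂ => form X N := by
    unfold form dot
    fun_prop
  have hCopen : IsOpen {X : ℝ × ℂ | X ∈ cone ∧ ∀ j, 0 < U j X} := by
    have e : {X : ℝ × ℂ | X ∈ cone ∧ ∀ j, 0 < U j X} = cone ∩ ⋂ j, {X | 0 < U j X} := by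
      ext X; simp
    rw [e]
    exact isOpen_cone.inter (isOpen_iInter_of_finite fun j => isOpen_lt continuous_const (hUc j))
  have hdense : ∀ O : Set (ℝ × ℂ), IsOpen O → O.Nonempty → ∃ X ∈ O, X ∈ G := fun O hO hne =>
    hG.inter_open_nonempty O hO hne
  -- a generic point of the cell off the axis, and a generic point outside the cell
  obtain ⟨X₀, ⟨⟨hX₀, hX₀C⟩, hX₀N⟩, hX₀G⟩ : ∃ X ∈ {X : ℝ × ℂ | X ∈ cone ∧ ∀ j, 0 < U j X} ∩
      {X | form X N ≠ 0}, X ∈ G := by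
    refine hdense _ (hCopen.inter (isOpen_ne_fun hNc continuous_const)) ?_
    obtain ⟨X, hX, hXC⟩ := hin
    have hpath : Continuous fun e : ℝ => X + e • N := by fun_prop
    have h1 : ∀ᶠ e : ℝ in 𝓝 0, X + e • N ∈ {X : ℝ × ℂ | X ∈ cone ∧ ∀ j, 0 < U j X} :=
      hpath.continuousAt.eventually_mem (hCopen.mem_nhds (by simpa using ⟨hX, hXC⟩))
    have h2 : ∀ᶠ e : ℝ in 𝓝[≠] 0, e ≠ form X N → form X N - e ≠ 0 :=
      Eventually.of_forall fun e he => sub_ne_zero.2 he.symm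
    have h3 : ∀ᶠ e : ℝ in 𝓝[≠] 0, e ≠ form X N := by
      by_cases h0 : form X N = 0
      · rw [h0]; exact eventually_mem_nhdsWithin
      · exact (eventually_ne_nhds (Ne.symm h0)).filter_mono nhdsWithin_le_nhds
    obtain ⟨e, h4, h5, h6⟩ := ((h1.filter_mono nhdsWithin_le_nhds).and (h2.and h3)).exists
    refine ⟨_, h4, ?_⟩
    simp only [Set.mem_ofPred_eq, form_add_left, form_smul_left, hNN]
    have := h5 h6
    intro h7
    apply this
    linarith
  obtain ⟨X₁, ⟨hX₁, hX₁C⟩, hX₁G⟩ : ∃ X ∈ {X : ℝ × ℂ | X ∈ cone ∧ ∃ j, U j X < 0}, X ∈ G := by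
    refine hdense _ ?_ hout
    have e : {X : ℝ × ℂ | X ∈ cone ∧ ∃ j, U j X < 0} = cone ∩ ⋃ j, {X | U j X < 0} := by
      ext X; simp
    rw [e]
    exact isOpen_cone.inter (isOpen_iUnion fun j => isOpen_lt (hUc j) continuous_const)
  have hinC : ∀ X ∈ cone, X ∈ G → (∀ j, 0 < U j X) → ∀ j,
      0 ≤ U j Q ∧ (U j Q = 0 → form X N * U j N ≤ 0) := by
    intro X hX hXG hXC j
    obtain ⟨h1, h2⟩ := nonneg_of_frequently_geometric hcc (Eventually.of_forall fun k => by
      rw [← hU j k X]; exact (((hpres X hX hXG k).2.2.2 hXC) j).le).frequently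
    refine ⟨nonneg_of_mul_nonneg_right h1 (hpos X hX).2, fun h0 => ?_⟩
    have := h2 (by rw [h0, mul_zero])
    linarith
  -- All iterates of an outside point stay outside, so by finiteness one side is nonpositive
  -- infinitely often. Comparison with the growth along the orbit of `X₀` shows that this side
  -- passes through `Q`, and that its limiting sign depends on the position of `X` relative to the
  -- axis `form X N = 0`.
  have houtC : ∀ X ∈ cone, X ∈ G → (¬ ∀ j, 0 < U j X) →
      ∃ j, U j Q = 0 ∧ U j N ≠ 0 ∧ 0 ≤ form X N * U j N := by
    intro X hX hXG hXC
    obtain ⟨j, hj⟩ : ∃ j, ∃ᶠ k : ℕ in atTop, U j ((g ∘ₗ g)^[k] X) ≤ 0 := by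
      by_contra! hcon
      obtain ⟨k, hk⟩ := (eventually_all.2 hcon).exists
      exact hXC ((hpres X hX hXG k).2.2.1 hk)
    have hfreq : ∃ᶠ k : ℕ in atTop, 0 ≤ (c * c) ^ k * -(form X R * U j Q) +
        ((c * c)⁻¹) ^ k * -(form X Q * U j R) + form X N * U j N := hj.mono fun k hk => by
      rw [hU] at hk
      linarith
    obtain ⟨h1, h2⟩ := nonneg_of_frequently_geometric hcc hfreq
    have h3 := (hinC X₀ hX₀ hX₀G hX₀C j).1
    have h4 : U j Q = 0 := by
      have : form X R * U j Q ≤ 0 := by linarith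
      exact le_antisymm (nonpos_of_mul_nonpos_right this (hpos X hX).2) h3
    refine ⟨j, h4, fun h0 => ?_, h2 (by rw [h4]; ring)⟩
    obtain ⟨k, hk⟩ := hj.exists
    have h5 := hX₀C j
    have h6 := hU j 0 X₀
    rw [Function.iterate_zero, id] at h6
    rw [h6, h4, h0] at h5
    rw [hU, h4, h0] at hk
    simp only [mul_zero, neg_zero, add_zero, zero_add, pow_zero, one_mul] at h5 hk
    have h7 : 0 < U j R := pos_of_mul_pos_right h5 (hpos X₀ hX₀).1.le
    have h8 : 0 < ((c * c)⁻¹) ^ k := pow_pos (inv_pos.2 (by linarith)) k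
    have := mul_pos h8 (mul_pos (hpos X hX).1 h7)
    linarith
  have hhalf : ∀ X ∈ cone, X ∈ G → 0 < form X₀ N * form X N → ∀ j, 0 < U j X := by
    intro X hX hXG hsign
    by_contra hXC
    obtain ⟨j, h1, h2, h3⟩ := houtC X hX hXG hXC
    have h4 := (hinC X₀ hX₀ hX₀G hX₀C j).2 h1
    have h5 : 0 < U j N * U j N := mul_self_pos.2 h2
    have h6 := mul_pos hsign h5
    have h7 := mul_nonneg h3 (neg_nonneg.2 h4)
    nlinarith
  obtain ⟨i, hi1, hi2, -⟩ := houtC X₁ hX₁ hX₁G fun h => by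
    obtain ⟨j, hj⟩ := hX₁C
    exact absurd (h j) (not_lt.2 hj.le)
  have hhalf' : ∀ X ∈ cone, X ∈ G → (∀ j, 0 < U j X) → 0 ≤ form X₀ N * form X N := by
    intro X hX hXG hXC
    have h1 := (hinC X hX hXG hXC i).2 hi1
    have h2 := (hinC X₀ hX₀ hX₀G hX₀C i).2 hi1
    have h3 : 0 < U i N * U i N := mul_self_pos.2 hi2
    have h4 := mul_nonneg_of_nonpos_of_nonpos h1 h2
    by_contra! h5
    have := mul_neg_of_neg_of_pos h5 h3
    nlinarith
  -- some side contains the axis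
  have haxis : Q + R ∈ cone := by
    refine mem_cone_of_form_pos hQ hQ1 ?_ ?_
    · rw [form_add_left, form_add_right, form_add_right, hQ, hR, hQR, hRQ]; norm_num
    · rw [form_add_left, hQ, hRQ]; norm_num
  -- If the axis point `Q + R` were inside the cell, generic points of the cell would exist across
  -- the axis from `X₀`, against `hhalf'`.
  obtain ⟨j, hj⟩ : ∃ j, U j (Q + R) ≤ 0 := by
    by_contra! hcon
    have hpath : Continuous fun e : ℝ => Q + R + (e * form X₀ N) • N := by fun_prop
    have h1 : ∀ᶠ e : ℝ in 𝓝 0, Q + R + (e * form X₀ N) • N ∈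
        {X : ℝ × ℂ | X ∈ cone ∧ ∀ j, 0 < U j X} :=
      hpath.continuousAt.eventually_mem (hCopen.mem_nhds (by
        simp only [zero_mul, zero_smul, add_zero]; exact ⟨haxis, hcon⟩))
    obtain ⟨e, h2, h3⟩ := ((h1.filter_mono nhdsWithin_le_nhds).and
      (eventually_mem_nhdsWithin (a := (0 : ℝ)) (s := Set.Ioi 0))).exists
    obtain ⟨X, ⟨⟨hX, hXC⟩, hXN⟩, hXG⟩ := hdense
      ({X : ℝ × ℂ | X ∈ cone ∧ ∀ j, 0 < U j X} ∩ {X | form X₀ N * form X N < 0})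
      (hCopen.inter (isOpen_lt (continuous_const.mul hNc) continuous_const)) ⟨_, h2, by
        simp only [Set.mem_ofPred_eq, form_add_left, form_smul_left, hNN, form_comm Q N,
          form_comm R N, hNQ, hNR]
        have h4 : 0 < form X₀ N * form X₀ N := mul_self_pos.2 hX₀N
        have h5 : 0 < e := h3
        nlinarith [mul_pos h5 h4]⟩
    exact absurd (hhalf' X hX hXG hXC) (not_le.2 hXN)
  have hjQ := (hinC X₀ hX₀ hX₀G hX₀C j).1
  have hjR : 0 ≤ U j R := by
    by_contra! hneg
    -- `B` is so large that `Q + B • R - form X₀ N • N` is in the cone and the negative value `U j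
    -- R` outweighs the other terms. This point is on the same side of the axis as `X₀`, so `hhalf`
    -- is contradicted near it.
    let B : ℝ := form X₀ N ^ 2 + 1 + |U j Q - form X₀ N * U j N| / (-U j R)
    have hB : 0 ≤ |U j Q - form X₀ N * U j N| / (-U j R) :=
      div_nonneg (abs_nonneg _) (by linarith)
    have hB2 : B * U j R =
        (form X₀ N ^ 2 + 1) * U j R - |U j Q - form X₀ N * U j N| := by
      have : U j R ≠ 0 := hneg.ne
      simp only [B]
      field_simp
      ring
    have hB1 : form X₀ N ^ 2 + 1 ≤ B := by simp only [B]; linarith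
    have hNR' : form R N = 0 := by rw [form_comm, hNR]
    have hNQ' : form Q N = 0 := by rw [form_comm, hNQ]
    have hZ : Q + B • R - form X₀ N • N ∈ cone := by
      refine mem_cone_of_form_pos hQ hQ1 ?_ ?_
      · simp only [form_add_left, form_sub_left, form_smul_left, form_add_right, form_sub_right,
          form_smul_right, hQ, hR, hQR, hRQ, hNN, hNQ, hNR, hNR', hNQ']
        nlinarith
      · simp only [form_add_left, form_sub_left, form_smul_left, hQ, hRQ, hNQ]
        nlinarith [sq_nonneg (form X₀ N)]
    obtain ⟨X, ⟨⟨hX, hXN⟩, hXU⟩, hXG⟩ := hdense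
      ((cone ∩ {X | 0 < form X₀ N * form X N}) ∩ {X | U j X < 0})
      ((isOpen_cone.inter (isOpen_lt continuous_const (continuous_const.mul hNc))).inter
        (isOpen_lt (hUc j) continuous_const)) ⟨Q + B • R - form X₀ N • N, ⟨hZ, by
          simp only [Set.mem_ofPred_eq, form_add_left, form_sub_left, form_smul_left, hNQ', hNR',
            hNN]
          have : 0 < form X₀ N * form X₀ N := mul_self_pos.2 hX₀N
          linarith⟩, by
          simp only [Set.mem_ofPred_eq, map_add, map_sub, map_smul, smul_eq_mul]
          rw [hB2]
          have h1 := le_abs_self (U j Q - form X₀ N * U j N)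
          have h2 : (form X₀ N ^ 2 + 1) * U j R < 0 := mul_neg_of_pos_of_neg (by positivity) hneg
          linarith⟩
    exact absurd (hhalf X hX hXG hXN j) (not_lt.2 (le_of_lt hXU))
  rw [map_add] at hj
  have hjQ0 : U j Q = 0 := by linarith
  have hjR0 : U j R = 0 := by linarith
  have hUj : ∀ X, U j X = -(form X N * U j N) := by
    intro X
    have := hU j 0 X
    rw [Function.iterate_zero, id, hjQ0, hjR0] at this
    rw [this]
    ring
  refine ⟨j, fun X hX hXG hXj => hhalf X hX hXG ?_⟩
  have h1 := hX₀C j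
  rw [hUj] at hXj h1
  have h2 := mul_pos hXj h1
  by_contra! h3
  nlinarith [mul_nonpos_of_nonpos_of_nonneg h3 (mul_self_nonneg (U j N))]

end KleinDisc

end

/-! ### A step without growth: periodic codes and return maps of cells -/

noncomputable section

namespace KleinPolygon

open Topology

variable {p : ℕ} [NeZero p] (P : KleinPolygon p)

/-- If the complexity does not grow at `n`, then a code is determined by its first `n` letters. -/
theorem code_eq_of_complexity_succ_eq {n : ℕ} (hn : P.complexity (n + 1) = P.complexity n)
    {x x' : ℕ → ℂ} {s s' : ℕ → Fin p} (h : P.IsRegularOrbit x s) (h' : P.IsRegularOrbit x' s')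
    (hss : ∀ m, m < n → s m = s' m) : s = s' := by
  let init : (Fin (n + 1) → Fin p) → Fin n → Fin p := fun w m => w m.castSucc
  have himage : init '' P.words (n + 1) = P.words n := by
    apply Set.Subset.antisymm
    · rintro _ ⟨w, hw, rfl⟩
      exact P.init_mem_words hw
    · intro w hw
      obtain ⟨y, u, hy, hu⟩ := P.mem_words_iff.1 hw
      exact ⟨fun m => u m, P.mem_words_iff.2 ⟨y, u, hy, fun _ => rfl⟩, funext fun m => (hu m).symm⟩
  -- Truncation is onto the words of length `n`, so equal cardinalities make it injective: every
  -- window of `n` letters determines the next letter.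
  have hinj : Set.InjOn init (P.words (n + 1)) := by
    apply Set.injOn_of_ncard_image_eq
    · rw [himage]; exact hn.symm
    · exact P.words_finite _
  funext m
  induction m using Nat.strong_induction_on with
  | _ m ih =>
    by_cases hm : m < n
    · exact hss m hm
    obtain ⟨k, rfl⟩ := Nat.exists_eq_add_of_le' (not_lt.1 hm)
    have h1 : (fun j : Fin (n + 1) => s (k + j)) ∈ P.words (n + 1) := ⟨x, s, h, k, fun _ => rfl⟩
    have h2 : (fun j : Fin (n + 1) => s' (k + j)) ∈ P.words (n + 1) := ⟨x', s', h', k, fun _ => rfl⟩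
    have h3 := hinj h1 h2 (funext fun j => ih _ (by simp))
    exact congrFun h3 (Fin.last n)

/-- The codes of the generic points. -/
def genericCodes : Set (ℕ → Fin p) := {s | ∃ X ∈ cone, P.IsGeneric X ∧ P.HasCode X s}

theorem exists_preimage_iterate (M : ℕ) {X : ℝ × ℂ} {s : ℕ → Fin p} (hX : X ∈ cone)
    (hgen : P.IsGeneric X) (h : P.HasCode X s) : ∃ Y s', Y ∈ cone ∧ P.IsGeneric Y ∧ P.HasCode Y s' ∧
      (∀ k, s' (k + M) = s k) ∧ P.reflWord s' M Y = X := by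
  induction M with
  | zero => exact ⟨X, s, hX, hgen, h, fun _ => rfl, rfl⟩
  | succ M ih =>
    obtain ⟨Y, s', hY, hYgen, hYs, hs', e⟩ := ih
    obtain ⟨Z, u, hZ, hZgen, hZu, hu, e'⟩ := P.exists_preimage hY hYgen hYs
    refine ⟨Z, u, hZ, hZgen, hZu, fun k => ?_, ?_⟩
    · rw [← hs', ← add_assoc, hu]
    · rw [← reflWord_add, e', ← e]
      exact LinearMap.congr_fun (P.reflWord_congr fun m _ => hu m) Y

/-- Every generic point with a code has a preimage, so the shift is a surjection of a finite set,
hence a permutation of finite order. -/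
theorem exists_period (hfin : P.genericCodes.Finite) :
    ∃ M, 0 < M ∧ ∀ s ∈ P.genericCodes, ∀ k, s (k + M) = s k := by
  have hshift : ∀ s : P.genericCodes, (fun k => s.1 (k + 1)) ∈ P.genericCodes := by
    rintro ⟨s, X, hX, hgen, h⟩
    exact ⟨P.reflWord s 1 X, P.reflWord_mem_cone s 1 hX, hgen.reflWord s 1, h.shift 1⟩
  let σ : P.genericCodes → P.genericCodes := fun s => ⟨_, hshift s⟩
  have hsurj : Function.Surjective σ := by
    rintro ⟨s, X, hX, hgen, h⟩
    obtain ⟨Y, s', hY, hYgen, hYs, hs', -⟩ := P.exists_preimage hX hgen h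
    exact ⟨⟨s', Y, hY, hYgen, hYs⟩, Subtype.ext (funext hs')⟩
  have : Finite P.genericCodes := hfin
  let e : Equiv.Perm P.genericCodes :=
    Equiv.ofBijective σ ⟨Finite.injective_iff_surjective.2 hsurj, hsurj⟩
  obtain ⟨M, hM, hpow⟩ := isOfFinOrder_iff_pow_eq_one.1 (isOfFinOrder_of_finite e)
  refine ⟨M, hM, fun s hs k => ?_⟩
  have hiter : ∀ (j : ℕ) (k : ℕ), ((e ^ j) ⟨s, hs⟩).1 k = s (k + j) := by
    intro j
    induction j with
    | zero => intro k; rfl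
    | succ j ih =>
      intro k
      rw [pow_succ', Equiv.Perm.mul_apply]
      change ((e ^ j) ⟨s, hs⟩).1 (k + 1) = _
      rw [ih]
      congr 1
      omega
  rw [← hiter, hpow]
  rfl

theorem isOpen_cell (s : ℕ → Fin p) (n : ℕ) : IsOpen {X : ℝ × ℂ | X ∈ cone ∧
    ∀ k, k < n → ∀ l, l ≠ s k → 0 < P.side (s k) l (P.reflWord s k X)} := by
  have e : {X : ℝ × ℂ | X ∈ cone ∧
      ∀ k, k < n → ∀ l, l ≠ s k → 0 < P.side (s k) l (P.reflWord s k X)} = cone ∩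
      ⋂ q : {q : Fin n × Fin p // q.2 ≠ s q.1},
        {X | 0 < P.side (s q.1.1) q.1.2 (P.reflWord s q.1.1 X)} := by
    ext X
    simp only [Set.mem_inter_iff, Set.mem_iInter, Set.mem_ofPred_eq]
    exact and_congr_right fun _ => ⟨fun h q => h _ q.1.1.2 _ q.2,
      fun h k hk l hl => h ⟨(⟨k, hk⟩, l), hl⟩⟩
  rw [e]
  exact isOpen_cone.inter (isOpen_iInter_of_finite fun q => isOpen_lt continuous_const
    (continuous_of_linear (P.side _ _ ∘ₗ P.reflWord _ _)))

/-- A sequence whose initial cells contain points of the closed disc has generic approximations. -/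
theorem exists_genericCode_prefix (s : ℕ → Fin p) {n : ℕ} (hn : 0 < n) {x : ℂ} (hx : dot x x ≤ 1)
    (h : ∀ k, k < n → ∀ l, l ≠ s k → 0 < P.side (s k) l (P.reflWord s k (1, x))) :
    ∃ s' ∈ P.genericCodes, ∀ k, k < n → s' k = s k := by
  -- Increasing the time coordinate moves a vector over a point of the closed disc into the open
  -- cone; for a small increase the strict inequalities survive.
  have hpath : Continuous fun e : ℝ => ((1 : ℝ), x) + e • ((1 : ℝ), (0 : ℂ)) := by fun_prop
  have h1 : ∀ᶠ e : ℝ in 𝓝[>] 0, ∀ q : {q : Fin n × Fin p // q.2 ≠ s q.1},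
      0 < P.side (s q.1.1) q.1.2
        (P.reflWord s q.1.1 (((1 : ℝ), x) + e • ((1 : ℝ), (0 : ℂ)))) := by
    refine eventually_all.2 fun q => Eventually.filter_mono nhdsWithin_le_nhds ?_
    refine (((continuous_of_linear (P.side _ _ ∘ₗ P.reflWord _ _)).comp
      hpath).continuousAt.eventually (lt_mem_nhds ?_))
    simpa using h _ q.1.1.2 _ q.2
  obtain ⟨e, h2, h3⟩ := (h1.and self_mem_nhdsWithin).exists
  have h4 : ((1 : ℝ), x) + e • ((1 : ℝ), (0 : ℂ)) ∈ cone := by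
    have h5 : 0 < e := h3
    refine ⟨?_, ?_⟩
    · simp; linarith
    · simp [form]; nlinarith
  obtain ⟨X, ⟨hX, hXs⟩, hgen⟩ := P.exists_isGeneric (P.isOpen_cell s n)
    ⟨_, h4, fun k hk l hl => h2 ⟨(⟨k, hk⟩, l), hl⟩⟩
  obtain ⟨s', hs'⟩ := P.exists_hasCode_of_side_pos hX hgen (hXs 0 hn)
  exact ⟨s', ⟨X, hX, hgen, hs'⟩, hs'.eq_of_side_pos hXs⟩

/-- No half-plane bounded by a line through two vertices is contained in a face. -/
theorem exists_side_pos_side_neg {i l : Fin p} (hl : l ≠ i) :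
    ∃ m, m ≠ i ∧ ∃ X ∈ cone, 0 < P.side i l X ∧ P.side i m X < 0 := by
  obtain ⟨m, hmi, hD⟩ : ∃ m, m ≠ i ∧
      cross (P.vertex l - P.vertex i) (P.vertex m - P.vertex i) ≠ 0 := by
    by_cases h : l = i + 1
    · obtain ⟨m, h1, h2⟩ := P.exists_ne_ne i (i + 1)
      exact ⟨m, h1, by rw [h]; exact (P.convex i m h1 h2).ne'⟩
    · refine ⟨i + 1, P.succ_ne i, ?_⟩
      rw [cross_swap]
      exact neg_ne_zero.2 (P.convex i l hl h).ne'
  refine ⟨m, hmi, ?_⟩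
  let D := cross (P.vertex l - P.vertex i) (P.vertex m - P.vertex i)
  -- On the sum of the two edge vectors from the vertex `i`, the two functionals take opposite
  -- values; the factor `D` turns these into a positive and a negative multiple of `D * D`.
  let u := D • ((P.vertex l - P.vertex i) + (P.vertex m - P.vertex i))
  have hpath : Continuous fun e : ℝ => P.vertex i + e • u := by fun_prop
  have h1 : ∀ᶠ e : ℝ in 𝓝 0, P.vertex i + e • u ∈ Metric.ball (0 : ℂ) 1 :=
    hpath.continuousAt.eventually_mem (Metric.isOpen_ball.mem_nhds (by simpa using P.vertex_mem i))
  obtain ⟨e, h2, h3⟩ := ((h1.filter_mono nhdsWithin_le_nhds).and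
    (eventually_mem_nhdsWithin (a := (0 : ℝ)) (s := Set.Ioi 0))).exists
  have he : 0 < e := h3
  have hDD : 0 < D * D := mul_self_pos.2 hD
  refine ⟨(1, P.vertex i + e • u), ?_, ?_, ?_⟩
  · have := smul_hat_mem_cone one_pos (mem_ball_iff_dot.1 h2)
    rwa [one_smul] at this
  · have e1 : P.side i l (1, P.vertex i + e • u) = e * (D * D) := by
      rw [side_hat]
      simp [u, D, cross]; ring
    rw [e1]; positivity
  · have e1 : P.side i m (1, P.vertex i + e • u) = -(e * (D * D)) := by
      rw [side_hat]
      simp [u, D, cross]; ring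
    rw [e1, neg_lt_zero]; positivity

/-- If codes are determined by finitely many letters and are periodic, then the return maps of the
cells have no null eigenvector for an eigenvalue different from `1`. -/
theorem eigenvalue_eq_one {n M : ℕ}
    (hdet : ∀ s ∈ P.genericCodes, ∀ s' ∈ P.genericCodes, (∀ m, m < n → s m = s' m) → s = s')
    (hper : ∀ s ∈ P.genericCodes, ∀ k, s (k + M) = s k) {s : ℕ → Fin p} (hs : s ∈ P.genericCodes)
    {Q : ℝ × ℂ} (hQ : form Q Q = 0) (hQ1 : 0 < Q.1) {c : ℝ} (hc : 0 < c)
    (hgQ : P.reflWord s M Q = c • Q) : c = 1 := by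
  -- By determinacy finitely many linear conditions describe the cell of `s` among generic points.
  -- Using `n + 1` letters makes the first letter available even for `n = 0`.
  let U : {q : Fin (n + 1) × Fin p // q.2 ≠ s q.1} → (ℝ × ℂ) →ₗ[ℝ] ℝ :=
    fun q => P.side (s q.1.1) q.1.2 ∘ₗ P.reflWord s q.1.1
  have hU : ∀ X ∈ cone, P.IsGeneric X → ((∀ j, 0 < U j X) ↔ P.HasCode X s) := by
    intro X hX hgen
    constructor
    · intro h
      have h1 : ∀ k, k < n + 1 → ∀ l, l ≠ s k → 0 < P.side (s k) l (P.reflWord s k X) :=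
        fun k hk l hl => h ⟨(⟨k, hk⟩, l), hl⟩
      obtain ⟨s', hs'⟩ := P.exists_hasCode_of_side_pos hX hgen (h1 0 (Nat.succ_pos n))
      have h2 := hdet s' ⟨X, hX, hgen, hs'⟩ s hs fun m hm =>
        hs'.eq_of_side_pos h1 m (hm.trans (Nat.lt_succ_self n))
      rwa [h2] at hs'
    · intro h j
      exact h _ _ j.2
  have hinv : ∀ X ∈ cone, P.IsGeneric X →
      ((∀ j, 0 < U j (P.reflWord s M X)) ↔ ∀ j, 0 < U j X) := by
    intro X hX hgen
    rw [hU X hX hgen, hU _ (P.reflWord_mem_cone s M hX) (hgen.reflWord s M)]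
    constructor
    -- The code of the image is extended by `M` letters to the left. Periodicity identifies the
    -- extended code with `s`, and injectivity of the return map identifies the backward point with
    -- `X`.
    · intro h
      obtain ⟨Y, s', hY, hYgen, hYs, hs', e⟩ :=
        P.exists_preimage_iterate M (P.reflWord_mem_cone s M hX) (hgen.reflWord s M) h
      have h1 : s' = s := by
        funext k
        rw [← hs', hper s' ⟨Y, hY, hYgen, hYs⟩]
      subst h1
      rwa [← P.reflWord_injective s' M e]
    · intro h
      have h1 := h.shift M
      have h2 : (fun k => s (k + M)) = s := funext (hper s hs)
      rwa [h2] at h1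
  obtain ⟨X₀, hX₀, hX₀gen, hX₀s⟩ := hs
  have hin : ∃ X ∈ cone, ∀ j, 0 < U j X := ⟨X₀, hX₀, (hU X₀ hX₀ hX₀gen).2 hX₀s⟩
  have hout : ∃ X ∈ cone, ∃ j, U j X < 0 := by
    obtain ⟨l, hl, -⟩ := P.exists_ne_ne (s 0) (s 0)
    -- The symmetry about the first vertex reverses all inequalities of its face.
    refine ⟨refl (P.vertex (s 0)) X₀, refl_mem_cone (P.dot_vertex_lt_one _) hX₀,
      ⟨(⟨0, Nat.succ_pos n⟩, l), hl⟩, ?_⟩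
    change P.side (s 0) l (refl (P.vertex (s 0)) X₀) < 0
    rw [side_refl, neg_lt_zero]
    exact hX₀s 0 l hl
  have hside : ¬ ∃ j, ∀ X ∈ cone, P.IsGeneric X → 0 < U j X → ∀ i, 0 < U i X := by
    rintro ⟨⟨⟨k, l⟩, hl⟩, h⟩
    obtain ⟨m, hm, Z, hZ, hZ1, hZ2⟩ := P.exists_side_pos_side_neg hl
    obtain ⟨Y, rfl⟩ := P.reflWord_surjective s k Z
    have hopen : IsOpen {X : ℝ × ℂ | X ∈ cone ∧ 0 < P.side (s k) l (P.reflWord s k X) ∧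
        P.side (s k) m (P.reflWord s k X) < 0} :=
      isOpen_cone.inter ((isOpen_lt continuous_const
        (continuous_of_linear (P.side (s k) l ∘ₗ P.reflWord s k))).inter
        (isOpen_lt (continuous_of_linear (P.side (s k) m ∘ₗ P.reflWord s k)) continuous_const))
    obtain ⟨X, ⟨hX, hX1, hX2⟩, hgen⟩ := P.exists_isGeneric hopen
      ⟨Y, P.mem_cone_of_reflWord hZ, hZ1, hZ2⟩
    exact absurd (h X hX hgen hX1 ⟨(k, m), hm⟩) (not_lt.2 (le_of_lt hX2))
  rcases lt_trichotomy c 1 with h | h | h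
  · exfalso
    -- For a contracting eigenvalue the argument is applied to the inverse return map.
    let e := LinearEquiv.ofBijective (P.reflWord s M)
      ⟨P.reflWord_injective s M, P.reflWord_surjective s M⟩
    have he : ∀ X, P.reflWord s M (e.symm X) = X := fun X => e.apply_symm_apply X
    have hcone : ∀ X ∈ cone, e.symm X ∈ cone := fun X hX =>
      P.mem_cone_of_reflWord (s := s) (k := M) (by rwa [he])
    have hgen : ∀ X, P.IsGeneric X → P.IsGeneric (e.symm X) := fun X hX =>
      P.isGeneric_of_reflWord (s := s) (k := M) (by rwa [he])
    refine hside (exists_side_of_invariant U P.dense_isGeneric (g := e.symm.toLinearMap)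
      (fun X Y => ?_) hcone hgen (fun X hX hXg => ?_) hQ hQ1 (c := c⁻¹)
      ((one_lt_inv₀ hc).2 h) ?_ hin hout)
    · rw [← P.form_reflWord s M]
      change form (P.reflWord s M (e.symm X)) (P.reflWord s M (e.symm Y)) = _
      rw [he, he]
    · have := hinv _ (hcone X hX) (hgen X hXg)
      rw [he] at this
      exact this.symm
    · apply P.reflWord_injective s M
      change P.reflWord s M (e.symm Q) = _
      rw [he, map_smul, hgQ, smul_smul, inv_mul_cancel₀ hc.ne', one_smul]
  · exact h
  · exact absurd (exists_side_of_invariant U P.dense_isGeneric (P.form_reflWord s M)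
      (fun X hX => P.reflWord_mem_cone s M hX) (fun X hX => IsGeneric.reflWord hX s M) hinv hQ hQ1 h
      hgQ hin hout) hside

end KleinPolygon

end

/-! ### Itineraries at infinity and strict growth of the complexity -/

noncomputable section

namespace KleinDisc

open Topology

theorem continuous_circlePt : Continuous fun t => (circlePt t : ℂ) := by
  unfold circlePt
  fun_prop

theorem dot_sub_circle_neg {x a : ℂ} (hx : dot x x = 1) (ha : dot a a < 1) : dot x (a - x) < 0 := by
  have h := one_sub_dot_pos ha hx.le
  have e : dot x (a - x) = dot x a - dot x x := by simp [dot]; ring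
  rw [e, hx]; linarith

theorem dot_self_pos_of_circle {x a : ℂ} (hx : dot x x = 1) (ha : dot a a < 1) :
    0 < dot (a - x) (a - x) := by
  have h := (dot_sub_circle_neg hx ha).ne
  rw [show dot x (a - x) = dot (a - x) x by unfold dot; ring] at h
  exact dot_self_pos_of_dot_ne_zero h

/-- On the circle, the geodesic symmetry about a point depends only on the line to this point. -/
theorem pointSymm_circle_eq {x a : ℂ} (hx : dot x x = 1) (ha : dot a a < 1) :
    pointSymm a x = x + (-2 * dot x (a - x) / dot (a - x) (a - x)) • (a - x) := by
  have h1 := pointSymm_sub ha hx.le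
  have e1 : 1 - 2 * dot x a + dot a a = dot (a - x) (a - x) := by
    rw [← hx]; simp [dot]; ring
  have e2 : 1 - dot x a = -dot x (a - x) := by
    rw [← hx]; simp [dot]; ring
  rw [e1, e2] at h1
  rw [← sub_eq_iff_eq_add', h1]
  congr 1
  ring

theorem symmFactor_circle_eq {x a : ℂ} (hx : dot x x = 1) (ha : dot a a < 1) :
    symmFactor a x = -2 * dot x (a - x) / dot (a - x) (a - x) - 1 := by
  have e1 : 1 - 2 * dot x a + dot a a = dot (a - x) (a - x) := by
    rw [← hx]; simp [dot]; ring
  have e2 : 1 - dot a a = -2 * dot x (a - x) - dot (a - x) (a - x) := by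
    have : dot (a - x) (a - x) = dot a a - 2 * dot x a + dot x x := by simp [dot]; ring
    have e3 : dot x (a - x) = dot x a - dot x x := by simp [dot]; ring
    rw [this, e3, hx]; ring
  have h := (dot_self_pos_of_circle hx ha).ne'
  rw [symmFactor, e1, e2]
  field_simp

theorem exists_eq_smul_of_circle {x a b : ℂ} (hx : dot x x = 1) (ha : dot a a < 1) (hb : dot b b < 1)
    (h : cross (a - x) (b - x) = 0) : ∃ r : ℝ, 0 < r ∧ b - x = r • (a - x) :=
  ⟨_, div_pos_of_neg_of_neg (dot_sub_circle_neg hx hb) (dot_sub_circle_neg hx ha),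
    eq_smul_of_cross_eq_zero h (dot_sub_circle_neg hx ha).ne⟩

theorem pointSymm_eq_of_smul {x a b : ℂ} (hx : dot x x = 1) (ha : dot a a < 1) (hb : dot b b < 1)
    {r : ℝ} (hr : 0 < r) (h : b - x = r • (a - x)) : pointSymm b x = pointSymm a x := by
  have h0 := (dot_self_pos_of_circle hx ha).ne'
  rw [pointSymm_circle_eq hx ha, pointSymm_circle_eq hx hb, h, dot_smul_smul, smul_smul]
  have e : dot x (r • (a - x)) = r * dot x (a - x) := by simp [dot]; ring
  rw [e]
  congr 2
  field_simp

/-- By `symmFactor_circle_eq` the factor is the length of the chord divided by the distance from `x`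
to the centre, minus one. It decreases as the centre recedes along the chord. -/
theorem symmFactor_lt_of_smul {x a b : ℂ} (hx : dot x x = 1) (ha : dot a a < 1) (hb : dot b b < 1)
    {r : ℝ} (hr : 1 < r) (h : b - x = r • (a - x)) : symmFactor b x < symmFactor a x := by
  have h0 := dot_self_pos_of_circle hx ha
  have h1 := dot_sub_circle_neg hx ha
  rw [symmFactor_circle_eq hx ha, symmFactor_circle_eq hx hb, h, dot_smul_smul]
  have e : dot x (r • (a - x)) = r * dot x (a - x) := by simp [dot]; ring
  rw [e]
  have e2 : -2 * (r * dot x (a - x)) / (r ^ 2 * dot (a - x) (a - x)) =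
      r⁻¹ * (-2 * dot x (a - x) / dot (a - x) (a - x)) := by
    have : r ≠ 0 := by linarith
    field_simp
  rw [e2]
  have h2 : r⁻¹ < 1 := inv_lt_one_of_one_lt₀ hr
  have h3 : 0 < -2 * dot x (a - x) / dot (a - x) (a - x) := div_pos (by linarith) h0
  nlinarith

theorem cross_of_collinear {x a b z : ℂ} {r : ℝ} (h : b - x = r • (a - x)) :
    cross (a - z) (b - z) = (r - 1) * cross (a - x) (z - x) := by
  have e : b = x + r • (a - x) := by rw [← h]; abel
  rw [e]
  simp [cross]; ring

/-- A ray from a point inside the disc meets the circle only once. -/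
theorem eq_of_ray {a d x y : ℂ} (ha : dot a a < 1) (hx : dot x x = 1) (hy : dot y y = 1) {r s : ℝ}
    (hr : 0 < r) (hs : 0 < s) (h1 : a - x = r • d) (h2 : a - y = s • d) : x = y := by
  have e1 : x = a - r • d := by rw [← h1]; abel
  have e2 : y = a - s • d := by rw [← h2]; abel
  have e3 : dot a a - 2 * r * dot a d + r ^ 2 * dot d d = 1 := by
    rw [← hx, e1]; simp [dot]; ring
  have e4 : dot a a - 2 * s * dot a d + s ^ 2 * dot d d = 1 := by
    rw [← hy, e2]; simp [dot]; ring
  have h3 : (r - s) * ((r + s) * dot d d - 2 * dot a d) = 0 := by linear_combination e3 - e4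
  rcases mul_eq_zero.1 h3 with h | h
  · rw [e1, e2, sub_eq_zero.1 h]
  · exfalso
    have h4 : dot a a - r * s * dot d d = 1 := by linear_combination e3 - r * h
    have := mul_nonneg (mul_pos hr hs).le (dot_self_nonneg d)
    linarith

/-- A ray from a point inside the disc meets the circle. -/
theorem exists_circle_on_ray {a d : ℂ} (ha : dot a a < 1) (hd : d ≠ 0) :
    ∃ r : ℝ, 0 < r ∧ ∃ x : Circle, a - x = r • d := by
  have hc : Continuous fun r : ℝ => dot (a - r • d) (a - r • d) := by
    unfold dot; fun_prop
  have hdd : 0 < dot d d := by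
    rw [dot_self_eq]; exact pow_pos (norm_pos_iff.2 hd) 2
  -- At this parameter the ray has left the disc, so the intermediate value theorem gives a point of
  -- the circle.
  let T : ℝ := (2 * |dot a d| + 1) / dot d d + 1
  have hT0 : 0 < T := by positivity
  have hT : 1 ≤ dot (a - T • d) (a - T • d) := by
    have e : dot (a - T • d) (a - T • d) = dot a a + T * (T * dot d d - 2 * dot a d) := by
      simp [dot]; ring
    have e2 : T * dot d d = 2 * |dot a d| + 1 + dot d d := by
      simp only [T]; field_simp
    have h1 := le_abs_self (dot a d)
    have h2 : 1 ≤ T * dot d d := by rw [e2]; nlinarith [abs_nonneg (dot a d)]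
    have h3 := dot_self_nonneg a
    have h4 : 1 + dot d d ≤ T * dot d d - 2 * dot a d := by linarith
    have h5 : T * (1 + dot d d) ≤ T * (T * dot d d - 2 * dot a d) :=
      mul_le_mul_of_nonneg_left h4 hT0.le
    rw [e]
    nlinarith
  obtain ⟨r, ⟨hr0, -⟩, hr⟩ := intermediate_value_Icc hT0.le hc.continuousOn
    (show (1 : ℝ) ∈ Set.Icc _ _ from ⟨by simpa using ha.le, hT⟩)
  simp only at hr
  refine ⟨r, lt_of_le_of_ne hr0 ?_, ⟨a - r • d, ?_⟩, ?_⟩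
  · rintro rfl
    rw [zero_smul, sub_zero] at hr
    exact ha.ne hr
  · rw [dot_self_eq] at hr
    refine mem_sphere_zero_iff_norm.2 ?_
    nlinarith [norm_nonneg (a - r • d)]
  · change a - (a - r • d) = r • d
    abel

end KleinDisc

namespace KleinPolygon

open Topology

variable {p : ℕ} [NeZero p] (P : KleinPolygon p)

/-- The vertex `i` lies on the supporting line from the point `x`. -/
def Supports (x : ℂ) (i : Fin p) : Prop := ∀ j, 0 ≤ cross (P.vertex i - x) (P.vertex j - x)

variable {P} in
theorem Supports.cross_eq_zero {x : ℂ} {i j : Fin p} (hi : P.Supports x i) (hj : P.Supports x j) :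
    cross (P.vertex i - x) (P.vertex j - x) = 0 := by
  have h1 := hi j
  have h2 := hj i
  rw [cross_swap] at h2
  linarith

variable {P} in
theorem Supports.of_smul {x : ℂ} {i j : Fin p} (hi : P.Supports x i) {r : ℝ} (hr : 0 < r)
    (h : P.vertex j - x = r • (P.vertex i - x)) : P.Supports x j := by
  intro l
  rw [h, cross_smul_left]
  exact mul_nonneg hr.le (hi l)

variable {P} in
theorem Supports.coe_bdryMap {x : Circle} {i : Fin p} (hi : P.Supports x i) :
    (P.bdryMap x : ℂ) = pointSymm (P.vertex i) x := by
  have hx := dot_coe_circle x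
  obtain ⟨r, hr, h⟩ := exists_eq_smul_of_circle hx (P.dot_vertex_lt_one i)
    (P.dot_vertex_lt_one (P.bdryVertex x)) (hi.cross_eq_zero (P.bdryVertex_spec x))
  rw [KleinPolygon.coe_bdryMap, pointSymm_eq_of_smul hx (P.dot_vertex_lt_one i)
    (P.dot_vertex_lt_one _) hr h]

theorem circle_notMem_region (x : Circle) : (x : ℂ) ∉ P.region := by
  intro hx
  have h1 : P.region ⊆ Metric.ball (0 : ℂ) 1 := by
    refine convexHull_min ?_ (convex_ball 0 1)
    rintro _ ⟨i, rfl⟩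
    exact P.vertex_mem i
  have h2 := dot_self_lt_one (h1 hx)
  rw [dot_coe_circle] at h2
  exact lt_irrefl _ h2

/-- The symmetry about the leftmost vertex seen from `y` turns left extremality into right
extremality, so it yields a preimage. For the monotone lift, surjectivity gives continuity. -/
theorem bdryMap_surjective : Function.Surjective P.bdryMap := by
  intro y
  obtain ⟨i, hi⟩ := P.exists_leftmost (P.circle_notMem_region y)
  have ha := P.dot_vertex_lt_one i
  have hy := (dot_coe_circle y).le
  have hsup : P.Supports (⟨pointSymm (P.vertex i) y, pointSymm_circle_mem ha y⟩ : Circle) i := by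
    intro j
    change 0 ≤ cross (P.vertex i - pointSymm (P.vertex i) y) (P.vertex j - pointSymm (P.vertex i) y)
    rw [cross_pointSymm ha hy, neg_nonneg]
    exact mul_nonpos_of_nonneg_of_nonpos (symmFactor_pos ha hy).le (hi j)
  refine ⟨⟨pointSymm (P.vertex i) y, pointSymm_circle_mem ha y⟩, Circle.ext ?_⟩
  rw [hsup.coe_bdryMap]
  exact pointSymm_pointSymm ha hy

theorem liftFun_surjective : Function.Surjective P.liftFun := by
  intro u
  obtain ⟨x, hx⟩ := P.bdryMap_surjective (circlePt u)
  obtain ⟨t, h1, h2, rfl⟩ := exists_circlePt x (u - 1)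
  rw [← circlePt_liftFun, circlePt_eq_iff] at hx
  obtain ⟨m, hm⟩ := hx
  have h3 := P.lt_liftFun t
  have h4 := P.liftFun_lt t
  have h5 : (m : ℝ) < 1 + 1 := by linarith
  have h6 : (-1 : ℝ) < m := by linarith
  have h7 : m < 2 := by exact_mod_cast (by linarith : (m : ℝ) < 2)
  have h8 : -1 < m := by exact_mod_cast h6
  obtain rfl | rfl : m = 0 ∨ m = 1 := by omega
  · exact ⟨t, by simpa using hm⟩
  · refine ⟨t - 1, ?_⟩
    have := P.liftFun_add_one (t - 1)
    rw [sub_add_cancel] at this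
    push_cast at hm
    linarith

/-- If `s < t` had the same image, the vertex on the chord from `t` would be strictly to the right
of the supporting line from `s`. -/
theorem liftFun_injective : Function.Injective P.liftFun := by
  have key : ∀ s t, s < t → P.liftFun s ≠ P.liftFun t := by
    intro s t hst h
    have h1 := P.lt_liftFun t
    have h2 := P.liftFun_lt s
    have c1 := cross_circlePt_neg hst (h ▸ h1) h2
    obtain ⟨r, q, hr, hq, hrq, e⟩ := P.exists_orbitVertex_combo t 0
    have c2 := P.cross_bdryMap_nonneg (circlePt s) (P.orbitVertex t 0)
    rw [← circlePt_liftFun, ← e, cross_sub_combo _ _ _ _ hrq] at c2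
    change 0 ≤ r * cross _ (circlePt t - circlePt s) +
      q * cross _ (circlePt (P.liftFun t) - circlePt s) at c2
    rw [← h, cross_self] at c2
    have := mul_neg_of_pos_of_neg hr c1
    linarith
  intro s t h
  rcases lt_trichotomy s t with h1 | h1 | h1
  · exact absurd h (key s t h1)
  · exact h1
  · exact absurd h.symm (key t s h1)

theorem liftFun_strictMono : StrictMono P.liftFun :=
  P.monotone_liftFun.strictMono_of_injective P.liftFun_injective

theorem continuous_liftFun : Continuous P.liftFun :=
  P.monotone_liftFun.continuous_of_surjective P.liftFun_surjective

theorem orbitParam_strictMono_left (k : ℕ) : StrictMono fun t => P.orbitParam t k :=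
  P.liftFun_strictMono.iterate k

theorem continuous_orbitParam (k : ℕ) : Continuous fun t => P.orbitParam t k :=
  P.continuous_liftFun.iterate k

theorem tendsto_orbitParam_left (t : ℝ) (k : ℕ) :
    Tendsto (fun s => P.orbitParam s k) (𝓝[<] t) (𝓝[<] (P.orbitParam t k)) :=
  tendsto_nhdsWithin_of_tendsto_nhds_of_eventually_within _
    ((P.continuous_orbitParam k).continuousAt.mono_left nhdsWithin_le_nhds)
    (eventually_nhdsWithin_of_forall fun _ hs => P.orbitParam_strictMono_left k hs)

theorem tendsto_orbitParam_right (t : ℝ) (k : ℕ) :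
    Tendsto (fun s => P.orbitParam s k) (𝓝[>] t) (𝓝[>] (P.orbitParam t k)) :=
  tendsto_nhdsWithin_of_tendsto_nhds_of_eventually_within _
    ((P.continuous_orbitParam k).continuousAt.mono_left nhdsWithin_le_nhds)
    (eventually_nhdsWithin_of_forall fun _ hs => P.orbitParam_strictMono_left k hs)

/-- Along an orbit at infinity, the isometries act on null vectors by the derivatives. -/
theorem reflWord_circlePt {w : ℕ → Fin p} {t : ℝ} {k : ℕ}
    (h : ∀ m, m < k → P.Supports (circlePt (P.orbitParam t m)) (w m)) :
    P.reflWord w k (1, circlePt t) =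
      (∏ m ∈ Finset.range k, (symmFactor (P.vertex (w m)) (circlePt (P.orbitParam t m)))⁻¹) •
        ((1 : ℝ), (circlePt (P.orbitParam t k) : ℂ)) := by
  induction k with
  | zero => rw [Finset.prod_range_zero, one_smul]; rfl
  | succ k ih =>
    rw [reflWord_succ, ih fun m hm => h m (hm.trans (Nat.lt_succ_self k)),
      refl_smul_hat (P.dot_vertex_lt_one _) (dot_coe_circle _).le, Finset.prod_range_succ,
      orbitParam_succ, circlePt_liftFun, (h k (Nat.lt_succ_self k)).coe_bdryMap]

theorem prod_symmFactor_pos (w : ℕ → Fin p) (t : ℝ) (k : ℕ) :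
    0 < ∏ m ∈ Finset.range k, (symmFactor (P.vertex (w m)) (circlePt (P.orbitParam t m)))⁻¹ :=
  Finset.prod_pos fun _ _ =>
    inv_pos.2 (symmFactor_pos (P.dot_vertex_lt_one _) (dot_coe_circle _).le)

/-- The vertex `i` is the first vertex on the supporting line from `x`. -/
def IsNear (x : ℂ) (i : Fin p) : Prop := P.Supports x i ∧
  ∀ j, P.Supports x j → j ≠ i → ∃ r : ℝ, 1 < r ∧ P.vertex j - x = r • (P.vertex i - x)

/-- The vertex `i` is the last vertex on the supporting line from `x`. -/
def IsFar (x : ℂ) (i : Fin p) : Prop := P.Supports x i ∧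
  ∀ j, P.Supports x j → j ≠ i → ∃ r : ℝ, 0 < r ∧ r < 1 ∧ P.vertex j - x = r • (P.vertex i - x)

theorem exists_isNear (x : Circle) : ∃ i, P.IsNear x i := by
  classical
  have hx := dot_coe_circle x
  obtain ⟨i, hi, hmin⟩ := Finset.exists_min_image (Finset.univ.filter fun i => P.Supports x i)
    (fun i => dot (P.vertex i - x) (P.vertex i - x))
    ⟨P.bdryVertex x, Finset.mem_filter.2 ⟨Finset.mem_univ _, P.bdryVertex_spec x⟩⟩
  simp only [Finset.mem_filter, Finset.mem_univ, true_and] at hi hmin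
  refine ⟨i, hi, fun j hj hji => ?_⟩
  obtain ⟨r, hr, h⟩ := exists_eq_smul_of_circle hx (P.dot_vertex_lt_one i) (P.dot_vertex_lt_one j)
    (hi.cross_eq_zero hj)
  refine ⟨r, ?_, h⟩
  have h1 := hmin j hj
  rw [h, dot_smul_smul] at h1
  have h2 := dot_self_pos_of_circle hx (P.dot_vertex_lt_one i)
  have h3 : r ≠ 1 := by
    rintro rfl
    rw [one_smul] at h
    exact hji (P.vertex_injective (sub_left_injective h))
  by_contra! h4
  have h5 := lt_of_le_of_ne h4 h3
  have h6 : r ^ 2 < 1 := by nlinarith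
  nlinarith

theorem exists_isFar (x : Circle) : ∃ i, P.IsFar x i := by
  classical
  have hx := dot_coe_circle x
  obtain ⟨i, hi, hmax⟩ := Finset.exists_max_image (Finset.univ.filter fun i => P.Supports x i)
    (fun i => dot (P.vertex i - x) (P.vertex i - x))
    ⟨P.bdryVertex x, Finset.mem_filter.2 ⟨Finset.mem_univ _, P.bdryVertex_spec x⟩⟩
  simp only [Finset.mem_filter, Finset.mem_univ, true_and] at hi hmax
  refine ⟨i, hi, fun j hj hji => ?_⟩
  obtain ⟨r, hr, h⟩ := exists_eq_smul_of_circle hx (P.dot_vertex_lt_one i) (P.dot_vertex_lt_one j)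
    (hi.cross_eq_zero hj)
  refine ⟨r, hr, ?_, h⟩
  have h1 := hmax j hj
  rw [h, dot_smul_smul] at h1
  have h2 := dot_self_pos_of_circle hx (P.dot_vertex_lt_one i)
  have h3 : r ≠ 1 := by
    rintro rfl
    rw [one_smul] at h
    exact hji (P.vertex_injective (sub_left_injective h))
  by_contra! h4
  have h5 := lt_of_le_of_ne h4 h3.symm
  have h6 : 1 < r ^ 2 := by nlinarith
  nlinarith

theorem symmFactor_le_of_isNear {x : Circle} {i j : Fin p} (hi : P.IsNear x i) (hj : P.Supports x j) :
    symmFactor (P.vertex j) x ≤ symmFactor (P.vertex i) x := by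
  by_cases h : j = i
  · rw [h]
  · obtain ⟨r, hr, e⟩ := hi.2 j hj h
    exact (symmFactor_lt_of_smul (dot_coe_circle x) (P.dot_vertex_lt_one _) (P.dot_vertex_lt_one _)
      hr e).le

theorem symmFactor_lt_of_isNear {x : Circle} {i j : Fin p} (hi : P.IsNear x i) (hj : P.Supports x j)
    (h : j ≠ i) : symmFactor (P.vertex j) x < symmFactor (P.vertex i) x := by
  obtain ⟨r, hr, e⟩ := hi.2 j hj h
  exact symmFactor_lt_of_smul (dot_coe_circle x) (P.dot_vertex_lt_one _) (P.dot_vertex_lt_one _) hr e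

theorem exists_support_sub {t : ℝ} {i : Fin p} (hi : P.Supports (circlePt t) i) : ∃ r : ℝ, 0 < r ∧
    P.vertex i - circlePt t = r • ((circlePt (P.liftFun t) : ℂ) - circlePt t) := by
  have hx := dot_coe_circle (circlePt t)
  have ha := P.dot_vertex_lt_one i
  have h1 := one_sub_dot_pos ha hx.le
  have h2 := denom_pos ha hx.le
  refine ⟨(2 * (1 - dot (circlePt t) (P.vertex i)) *
    (1 - 2 * dot (circlePt t) (P.vertex i) + dot (P.vertex i) (P.vertex i))⁻¹)⁻¹,
    by positivity, ?_⟩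
  rw [circlePt_liftFun, hi.coe_bdryMap, pointSymm_sub ha hx.le, smul_smul, inv_mul_cancel₀, one_smul]
  positivity

theorem eventually_strict_of_not_supports {t : ℝ} {i j : Fin p} (hi : P.Supports (circlePt t) i)
    (hj : ¬ P.Supports (circlePt t) j) :
    ∀ᶠ s in 𝓝 t, 0 < cross (P.vertex i - circlePt s) (P.vertex j - circlePt s) := by
  have h : 0 < cross (P.vertex i - circlePt t) (P.vertex j - circlePt t) := by
    refine lt_of_le_of_ne (hi j) fun h => hj ?_
    obtain ⟨r, hr, e⟩ := exists_eq_smul_of_circle (dot_coe_circle _) (P.dot_vertex_lt_one i)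
      (P.dot_vertex_lt_one j) h.symm
    exact hi.of_smul hr e
  have hc : Continuous fun s => cross (P.vertex i - circlePt s) (P.vertex j - circlePt s) := by
    have := continuous_circlePt
    unfold cross
    fun_prop
  exact hc.continuousAt.eventually (lt_mem_nhds h)

/-- Vertices off the supporting line are handled by continuity. For a second vertex on the line,
`cross_of_collinear` reduces the sign to the side on which the moved boundary point lies: just
before `t` it is the polygon's side, which favours the near vertex. -/
theorem eventually_strict_left {t : ℝ} {i : Fin p} (hi : P.IsNear (circlePt t) i) :
    ∀ᶠ s in 𝓝[<] t, ∀ j, j ≠ i → 0 < cross (P.vertex i - circlePt s) (P.vertex j - circlePt s) := by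
  refine eventually_all.2 fun j => ?_
  by_cases hji : j = i
  · simp [hji]
  by_cases hj : P.Supports (circlePt t) j
  · obtain ⟨r, hr, e⟩ := hi.2 j hj hji
    have h1 : P.liftFun t - 1 < t := by linarith [P.liftFun_lt t]
    filter_upwards [Ioo_mem_nhdsLT h1] with s hs _
    obtain ⟨q, hq, e2⟩ := P.exists_support_sub hi.1
    rw [cross_of_collinear e, e2, cross_smul_left, ← circlePt_add_one s]
    have h2 := cross_circlePt_pos (P.lt_liftFun t) (show P.liftFun t < s + 1 by linarith [hs.1])
      (show s + 1 < t + 1 by linarith [hs.2])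
    exact mul_pos (by linarith) (mul_pos hq h2)
  · filter_upwards [(P.eventually_strict_of_not_supports hi.1 hj).filter_mono nhdsWithin_le_nhds]
      with s hs _ using hs

/-- Just after `t` the moved point is on the side away from the polygon, which reverses the sign and
favours the far vertex. -/
theorem eventually_strict_right {t : ℝ} {i : Fin p} (hi : P.IsFar (circlePt t) i) :
    ∀ᶠ s in 𝓝[>] t, ∀ j, j ≠ i → 0 < cross (P.vertex i - circlePt s) (P.vertex j - circlePt s) := by
  refine eventually_all.2 fun j => ?_
  by_cases hji : j = i
  · simp [hji]
  by_cases hj : P.Supports (circlePt t) j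
  · obtain ⟨r, -, hr, e⟩ := hi.2 j hj hji
    filter_upwards [Ioo_mem_nhdsGT (P.lt_liftFun t)] with s hs _
    obtain ⟨q, hq, e2⟩ := P.exists_support_sub hi.1
    rw [cross_of_collinear e, e2, cross_smul_left]
    have h2 := cross_circlePt_neg hs.1 hs.2 (P.liftFun_lt t)
    exact mul_pos_of_neg_of_neg (by linarith) (mul_neg_of_pos_of_neg hq h2)
  · filter_upwards [(P.eventually_strict_of_not_supports hi.1 hj).filter_mono nhdsWithin_le_nhds]
      with s hs _ using hs

/-- A sequence that is followed strictly, for any finite time, by orbits at infinity is the code of a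
generic point if codes are determined by finitely many letters. -/
theorem mem_genericCodes_of_boundary {n : ℕ}
    (hdet : ∀ s ∈ P.genericCodes, ∀ s' ∈ P.genericCodes, (∀ m, m < n → s m = s' m) → s = s')
    {w : ℕ → Fin p} {f : Filter ℝ} [f.NeBot]
    (h : ∀ k, ∀ᶠ t in f, ∀ j, j ≠ w k → 0 < cross (P.vertex (w k) - circlePt (P.orbitParam t k))
      (P.vertex j - circlePt (P.orbitParam t k))) : w ∈ P.genericCodes := by
  have hprefix : ∀ N, 0 < N → ∃ s ∈ P.genericCodes, ∀ k, k < N → s k = w k := by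
    intro N hN
    obtain ⟨t, ht⟩ := (eventually_all.2 fun k : Fin N => h k).exists
    have hsup : ∀ k, k < N → P.Supports (circlePt (P.orbitParam t k)) (w k) := by
      intro k hk j
      by_cases hj : j = w k
      · rw [hj, cross_self]
      · exact (ht ⟨k, hk⟩ j hj).le
    refine P.exists_genericCode_prefix w hN (dot_coe_circle (circlePt t)).le fun k hk l hl => ?_
    rw [P.reflWord_circlePt fun m hm => hsup m (hm.trans hk), map_smul, side_hat, smul_eq_mul]
    exact mul_pos (P.prod_symmFactor_pos _ _ _) (ht ⟨k, hk⟩ l hl)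
  obtain ⟨s, hs, hsw⟩ := hprefix (n + 1) (Nat.succ_pos n)
  -- Generic codes agreeing with `w` for different lengths share their first `n` letters, hence
  -- coincide, so one code agrees with `w` everywhere.
  have : s = w := by
    funext k
    obtain ⟨s', hs', hsw'⟩ := hprefix (n + 1 + k + 1) (Nat.succ_pos _)
    rw [hdet s hs s' hs' fun m hm => by rw [hsw m (by omega), hsw' m (by omega)],
      hsw' k (by omega)]
  rwa [← this]

/-- The complexity grows at every step. -/
theorem complexity_lt_succ (n : ℕ) : P.complexity n < P.complexity (n + 1) := by
  have hle : P.complexity n ≤ P.complexity (n + 1) := by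
    have himage : P.words n ⊆
        (fun (w : Fin (n + 1) → Fin p) (m : Fin n) => w m.castSucc) '' P.words (n + 1) := by
      intro w hw
      obtain ⟨y, u, hy, hu⟩ := P.mem_words_iff.1 hw
      exact ⟨fun m => u m, P.mem_words_iff.2 ⟨y, u, hy, fun _ => rfl⟩, funext fun m => (hu m).symm⟩
    exact (Set.ncard_le_ncard himage (Set.toFinite _)).trans
      (Set.ncard_image_le (P.words_finite _))
  refine lt_of_le_of_ne hle fun hn => ?_
  have hdet : ∀ s ∈ P.genericCodes, ∀ s' ∈ P.genericCodes, (∀ m, m < n → s m = s' m) → s = s' := by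
    rintro s ⟨X, hX, -, hXs⟩ s' ⟨X', hX', -, hXs'⟩ h
    exact P.code_eq_of_complexity_succ_eq hn.symm (hXs.isRegularOrbit hX) (hXs'.isRegularOrbit hX') h
  have hfin : P.genericCodes.Finite := by
    refine Set.Finite.of_finite_image (f := fun s (m : Fin n) => s m) (Set.toFinite _) ?_
    intro s hs s' hs' h
    exact hdet s hs s' hs' fun m hm => congrFun h ⟨m, hm⟩
  obtain ⟨M, hM, hper⟩ := P.exists_period hfin
  choose near hnear using P.exists_isNear
  choose far hfar using P.exists_isFar
  -- the endpoint of a singular ray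
  have hd : P.vertex (0 + 1) - P.vertex 0 ≠ 0 :=
    sub_ne_zero.2 fun h => P.succ_ne 0 (P.vertex_injective h)
  obtain ⟨q, hq, x, hx⟩ := exists_circle_on_ray (P.dot_vertex_lt_one 0) hd
  obtain ⟨t, -, -, rfl⟩ := exists_circlePt x 0
  have hx1 : P.vertex (0 + 1) - circlePt t = (1 + q⁻¹) • (P.vertex 0 - circlePt t) := by
    have e : P.vertex (0 + 1) - P.vertex 0 = q⁻¹ • (P.vertex 0 - circlePt t) := by
      rw [hx, smul_smul, inv_mul_cancel₀ hq.ne', one_smul]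
    rw [add_smul, one_smul, ← e]
    abel
  have hq1 : 1 < 1 + q⁻¹ := by have := inv_pos.2 hq; linarith
  have hcross : ∀ j, cross (P.vertex 0 - circlePt t) (P.vertex j - circlePt t) =
      q * cross (P.vertex (0 + 1) - P.vertex 0) (P.vertex j - P.vertex 0) := by
    intro j
    have e : P.vertex j - circlePt t =
        (P.vertex j - P.vertex 0) + q • (P.vertex (0 + 1) - P.vertex 0) := by
      rw [← hx]; abel
    rw [e, hx]
    simp [cross]; ring
  have hsup0 : P.Supports (circlePt t) 0 := by
    intro j
    rw [hcross]
    refine mul_nonneg hq.le ?_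
    by_cases h0 : j = 0
    · rw [h0, sub_self]; simp [cross]
    · by_cases h1 : j = 0 + 1
      · rw [h1, cross_self]
      · exact (P.convex 0 j h0 h1).le
  have hsup1 : P.Supports (circlePt t) (0 + 1) := hsup0.of_smul (by linarith) hx1
  have honly : ∀ j, P.Supports (circlePt t) j → j = 0 ∨ j = 0 + 1 := by
    intro j hj
    by_contra! h
    have h1 := hsup0.cross_eq_zero hj
    rw [hcross] at h1
    have := mul_pos hq (P.convex 0 j h.1 h.2)
    linarith
  have hne0 : P.vertex 0 - circlePt t ≠ 0 := by
    rw [hx]; exact smul_ne_zero hq.ne' hd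
  have hnear0 : near (circlePt t) = 0 := by
    rcases honly _ (hnear (circlePt t)).1 with h | h
    · exact h
    · exfalso
      obtain ⟨r, hr, e⟩ := (hnear (circlePt t)).2 0 hsup0 (by rw [h]; exact (P.succ_ne 0).symm)
      rw [h, hx1, smul_smul] at e
      have e2 : (1 - r * (1 + q⁻¹)) • (P.vertex 0 - circlePt t) = 0 := by
        rw [sub_smul, one_smul, ← e, sub_self]
      rcases smul_eq_zero.1 e2 with h2 | h2
      · nlinarith
      · exact hne0 h2
  have hfar1 : far (circlePt t) = 0 + 1 := by
    rcases honly _ (hfar (circlePt t)).1 with h | h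
    · exfalso
      obtain ⟨r, -, hr, e⟩ := (hfar (circlePt t)).2 (0 + 1) hsup1 (by rw [h]; exact P.succ_ne 0)
      rw [h, hx1] at e
      have e2 : (1 + q⁻¹ - r) • (P.vertex 0 - circlePt t) = 0 := by
        rw [sub_smul, ← e, sub_self]
      rcases smul_eq_zero.1 e2 with h2 | h2
      · linarith
      · exact hne0 h2
    · exact h
  have hleft : (fun k => near (circlePt (P.orbitParam t k))) ∈ P.genericCodes :=
    P.mem_genericCodes_of_boundary hdet (f := 𝓝[<] t) fun k =>
      (P.tendsto_orbitParam_left t k).eventually (P.eventually_strict_left (hnear _))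
  have hright : (fun k => far (circlePt (P.orbitParam t k))) ∈ P.genericCodes :=
    P.mem_genericCodes_of_boundary hdet (f := 𝓝[>] t) fun k =>
      (P.tendsto_orbitParam_right t k).eventually (P.eventually_strict_right (hfar _))
  -- by periodicity, the endpoint is a periodic point
  have hfix : circlePt (P.orbitParam t M) = circlePt t := by
    have h1 : near (circlePt (P.orbitParam t M)) = 0 := by
      have := hper _ hleft 0
      rw [zero_add] at this
      exact this.trans hnear0
    have h2 : far (circlePt (P.orbitParam t M)) = 0 + 1 := by
      have := hper _ hright 0
      rw [zero_add] at this
      exact this.trans hfar1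
    -- The supporting line from the `M`-th point contains both vertices of the first side in the
    -- same order. So this point is on the same singular ray, which meets the circle only once.
    obtain ⟨r, hr, e⟩ := (hnear (circlePt (P.orbitParam t M))).2 (0 + 1)
      (h2 ▸ (hfar (circlePt (P.orbitParam t M))).1) (by rw [h1]; exact P.succ_ne 0)
    rw [h1] at e
    have e2 : P.vertex 0 - circlePt (P.orbitParam t M) =
        (r - 1)⁻¹ • (P.vertex (0 + 1) - P.vertex 0) := by
      have e3 : P.vertex (0 + 1) - P.vertex 0 =
          (r - 1) • (P.vertex 0 - circlePt (P.orbitParam t M)) := by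
        rw [sub_smul, one_smul, ← e]; abel
      rw [e3, smul_smul, inv_mul_cancel₀ (by linarith), one_smul]
    exact Circle.ext (eq_of_ray (P.dot_vertex_lt_one 0) (dot_coe_circle _) (dot_coe_circle _)
      (inv_pos.2 (by linarith)) hq e2 hx)
  have hnull : form ((1 : ℝ), (circlePt t : ℂ)) (1, circlePt t) = 0 := by
    rw [form_hat_self, dot_coe_circle, sub_self]
  have heigen : ∀ w ∈ P.genericCodes, (∀ k, P.Supports (circlePt (P.orbitParam t k)) (w k)) →
      ∏ m ∈ Finset.range M, (symmFactor (P.vertex (w m)) (circlePt (P.orbitParam t m)))⁻¹ = 1 := by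
    intro w hw hsup
    refine P.eigenvalue_eq_one hdet hper hw hnull one_pos (P.prod_symmFactor_pos w t M) ?_
    rw [P.reflWord_circlePt fun m _ => hsup m, hfix]
  have h1 := heigen _ hleft fun k => (hnear _).1
  have h2 := heigen _ hright fun k => (hfar _).1
  -- Factor by factor the near itinerary has the larger derivative, strictly at `m = 0`, where the
  -- near and far vertices differ; this index occurs because `M` is positive.
  have h3 : ∏ m ∈ Finset.range M, (symmFactor (P.vertex (near (circlePt (P.orbitParam t m))))
        (circlePt (P.orbitParam t m)))⁻¹ <
      ∏ m ∈ Finset.range M, (symmFactor (P.vertex (far (circlePt (P.orbitParam t m))))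
        (circlePt (P.orbitParam t m)))⁻¹ := by
    refine Finset.prod_lt_prod (fun m _ => ?_) (fun m _ => ?_) ⟨0, Finset.mem_range.2 hM, ?_⟩
    · exact inv_pos.2 (symmFactor_pos (P.dot_vertex_lt_one _) (dot_coe_circle _).le)
    · exact inv_anti₀ (symmFactor_pos (P.dot_vertex_lt_one _) (dot_coe_circle _).le)
        (P.symmFactor_le_of_isNear (hnear _) (hfar _).1)
    · refine inv_strictAnti₀ (symmFactor_pos (P.dot_vertex_lt_one _) (dot_coe_circle _).le)
        (P.symmFactor_lt_of_isNear (hnear _) (hfar _).1 ?_)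
      change far (circlePt t) ≠ near (circlePt t)
      rw [hnear0, hfar1]
      exact P.succ_ne 0
  rw [h1, h2] at h3
  exact lt_irrefl _ h3

theorem le_complexity (n : ℕ) : n ≤ P.complexity n := by
  induction n with
  | zero => exact Nat.zero_le _
  | succ n ih => exact Nat.succ_le_of_lt (lt_of_le_of_lt ih (P.complexity_lt_succ n))

theorem isBigO_complexity :
    (fun n : ℕ => (n : ℝ)) =O[atTop] fun n : ℕ => (P.complexity n : ℝ) := by
  refine IsBigO.of_bound 1 (Eventually.of_forall fun n => ?_)
  rw [Real.norm_natCast, Real.norm_natCast, one_mul]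
  exact_mod_cast P.le_complexity n

end KleinPolygon

end

theorem theorem9 {p : ℕ} [NeZero p] (P : KleinPolygon p) :
    ((fun n : ℕ => (n : ℝ)) =O[atTop] fun n : ℕ => (P.complexity n : ℝ)) ∧
      (P.IsLarge →
        (fun n : ℕ => (P.complexity n : ℝ)) =Θ[atTop] fun n : ℕ => (n : ℝ)) := by
  refine ⟨P.isBigO_complexity, fun h => ?_⟩
  obtain ⟨t, ht⟩ := h.exists_orbitParam_eq
  exact ⟨P.complexity_isBigO ht, P.isBigO_complexity⟩
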